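/- An SVAS is a finite sequence of commands, each of which may be labelled (distinct commands have distinct labels), where a command is one of: an increment $x := x+1$ or a decrement $x := x-1$ of a counter, $\mathtt{push}\ a$, $\mathtt{pop}\ a$, a non-deterministic jump $\mathtt{goto}\ L\ \mathtt{or}\ L'$ to one of two labelled commands, or $\mathtt{halt}$, which occurs only as the last command. Counters range over $\mathbb{N}$ and there is one stack; execution starts at the first command with all counters $0$ and the stack empty, and aborts when a counter with value $0$ is decremented or when $\mathtt{pop}\ a$ is attempted while $a$ is not on top of the stack. The reachability problem for SVAS asks whether a given SVAS has a computation that reaches the $\mathtt{halt}$ command with all counters $0$ and the stack empty. A leaf-data forest over a finite alphabet $\Sigma$ is a finite ordered forest (roots and children linearly ordered; it may be empty) in which every node has a label from $\Sigma$ and every leaf also has a data label from $\mathbb{N}$. The logic FO$^2(+1,\prec,\sim)$ is first-order logic with two variables, ranging over the nodes of such a forest, with a unary predicate for each letter of $\Sigma$ and the binary predicates: $x \downarrow y$ ($y$ is a child of $x$); $x \rightarrow y$ ($y$ is the next sibling of $x$, consecutive roots being siblings); $x \prec y$ ($x$ and $y$ are leaves and $x$ precedes $y$ in the document order); $x \sim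 y$ ($x$ and $y$ are leaves with the same data label). No equality predicate is used. The satisfiability problem asks, given a finite alphabet $\Sigma$ and a sentence over $\Sigma$, whether the sentence is true in some leaf-data forest over $\Sigma$. **Theorem 2.** The reachability problem for SVAS is reducible in logarithmic space to the satisfiability problem for FO$^2(+1,\prec,\sim)$ on leaf-data forests: there is a function, computable by a deterministic Turing machine with a read-only input tape, a write-only output tape and work tapes on which $O(\log n)$ cells are used on inputs of length $n$, that maps every SVAS $\mathcal{S}$ to a sentence which is satisfiable on leaf-data forests if and only if $\mathcal{S}$ is a positive instance of the reachability problem. -/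

import Mathlib

/-! ## Stack vector addition systems -/

namespace StackVAS

/-- Identifiers of counters, stack symbols and labels: finite words over a binary alphabet. -/
abbrev Name : Type := List Bool

/-- The commands of an SVAS. -/
inductive Command : Type
  /-- `x := x + 1` -/
  | inc (x : Name)
  /-- `x := x - 1` -/
  | dec (x : Name)
  /-- `push a` -/
  | push (a : Name)
  /-- `pop a` -/
  | pop (a : Name)
  /-- `goto L or L'` (non-deterministic) -/
  | goto (L L' : Name)
  /-- `halt` -/
  | halt

/-- A command which may be labelled. -/
structure Line : Type where
  label : Option Name
  command : Command

/-- An SVAS: a finite sequence of possibly labelled commands. Distinct lines carry distinct labels,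
jumps are to labels that occur, and `halt` occurs only as the last command. -/
structure SVAS : Type where
  lines : List Line
  labels_nodup : (lines.filterMap Line.label).Nodup
  labels_defined : ∀ l ∈ lines, ∀ L L', l.command = Command.goto L L' →
    (∃ m ∈ lines, m.label = some L) ∧ (∃ m ∈ lines, m.label = some L')
  halt_last : ∀ i l, lines[i]? = some l → l.command = Command.halt → i + 1 = lines.length

namespace SVAS

/-- A configuration: the position of the next command to be executed, the values of the counters
and the contents of the stack (top first). -/
structure Config : Type where
  pc : ℕ
  counter : Name → ℕ
  stack : List Name

/-- The command at position `i`, if there is one. -/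
def commandAt (P : SVAS) (i : ℕ) : Option Command := P.lines[i]?.map Line.command

/-- The label at position `i`, if there is one. -/
def labelAt (P : SVAS) (i : ℕ) : Option Name := P.lines[i]?.bind Line.label

/-- One computation step. There is no step from a decrement of a counter with value `0`, from a
pop of a symbol that is not on top of the stack, and from `halt`. -/
inductive Step (P : SVAS) : Config → Config → Prop
  | inc {i : ℕ} {c : Name → ℕ} {s : List Name} {x : Name} :
      P.commandAt i = some (Command.inc x) →
      Step P ⟨i, c, s⟩ ⟨i + 1, Function.update c x (c x + 1), s⟩
  | dec {i : ℕ} {c : Name → ℕ} {s : List Name} {x : Name} :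
      P.commandAt i = some (Command.dec x) → 0 < c x →
      Step P ⟨i, c, s⟩ ⟨i + 1, Function.update c x (c x - 1), s⟩
  | push {i : ℕ} {c : Name → ℕ} {s : List Name} {a : Name} :
      P.commandAt i = some (Command.push a) →
      Step P ⟨i, c, s⟩ ⟨i + 1, c, a :: s⟩
  | pop {i : ℕ} {c : Name → ℕ} {s : List Name} {a : Name} :
      P.commandAt i = some (Command.pop a) →
      Step P ⟨i, c, a :: s⟩ ⟨i + 1, c, s⟩
  | goto {i j : ℕ} {c : Name → ℕ} {s : List Name} {L L' : Name} :
      P.commandAt i = some (Command.goto L L') →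
      (P.labelAt j = some L ∨ P.labelAt j = some L') →
      Step P ⟨i, c, s⟩ ⟨j, c, s⟩

/-- The initial configuration. -/
def init : Config := ⟨0, fun _ => 0, []⟩

/-- The reachability problem: some computation reaches the `halt` command with all counters being
`0` and the stack being empty. -/
def Reachable (P : SVAS) : Prop :=
  ∃ i, P.commandAt i = some Command.halt ∧
    Relation.ReflTransGen P.Step init ⟨i, fun _ => 0, []⟩

end SVAS

/-! ### SVAS as input words -/

/-- The finite alphabet in which SVAS are written. -/
inductive Token : Type
  | label | inc | dec | push | pop | goto | halt
  | bit (b : Bool)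
  | fin
  deriving DecidableEq, Fintype

/-- A name is written as its bits followed by a terminator. -/
def nameCode (x : Name) : List Token := x.map Token.bit ++ [Token.fin]

def Command.code : Command → List Token
  | .inc x => Token.inc :: nameCode x
  | .dec x => Token.dec :: nameCode x
  | .push a => Token.push :: nameCode a
  | .pop a => Token.pop :: nameCode a
  | .goto L L' => Token.goto :: (nameCode L ++ nameCode L')
  | .halt => [Token.halt]

def labelCode : Option Name → List Token
  | none => []
  | some L => Token.label :: nameCode L

def Line.code (l : Line) : List Token := labelCode l.label ++ l.command.code

/-- An SVAS is written as the sequence of its lines. -/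
def SVAS.code (P : SVAS) : List Token := P.lines.flatMap Line.code

theorem nameCode_append_inj {x y : Name} {r t : List Token}
    (h : nameCode x ++ r = nameCode y ++ t) : x = y ∧ r = t := by
  induction x generalizing y with
  | nil => cases y <;> simp_all [nameCode]
  | cons b x ih =>
    cases y with
    | nil => simp [nameCode] at h
    | cons b' y =>
      have h' : b = b' ∧ nameCode x ++ r = nameCode y ++ t := by
        simpa [nameCode] using h
      obtain ⟨h1, h2⟩ := ih h'.2
      exact ⟨by rw [h'.1, h1], h2⟩

theorem Command.code_append_inj {c d : Command} {r t : List Token}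
    (h : c.code ++ r = d.code ++ t) : c = d ∧ r = t := by
  cases c <;> cases d <;> simp only [Command.code, List.cons_append, List.append_assoc,
    List.cons.injEq, reduceCtorEq, false_and, true_and, List.nil_append] at h
  case goto.goto =>
    obtain ⟨h1, h2⟩ := nameCode_append_inj h
    obtain ⟨h3, h4⟩ := nameCode_append_inj h2
    exact ⟨by rw [h1, h3], h4⟩
  case halt.halt => exact ⟨rfl, h⟩
  all_goals
    obtain ⟨h1, h2⟩ := nameCode_append_inj h
    exact ⟨by rw [h1], h2⟩

theorem Line.code_append_inj {l m : Line} {r t : List Token}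
    (h : l.code ++ r = m.code ++ t) : l = m ∧ r = t := by
  obtain ⟨a, c⟩ := l
  obtain ⟨b, d⟩ := m
  cases a with
  | none =>
    cases b with
    | none =>
      obtain ⟨h1, h2⟩ := Command.code_append_inj (c := c) (d := d) h
      exact ⟨by rw [h1], h2⟩
    | some L => cases c <;> simp [Line.code, labelCode, Command.code] at h
  | some L =>
    cases b with
    | none => cases d <;> simp [Line.code, labelCode, Command.code] at h
    | some M =>
      simp only [Line.code, labelCode, List.cons_append, List.append_assoc, List.cons.injEq,
        true_and] at h
      obtain ⟨h1, h2⟩ := nameCode_append_inj h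
      obtain ⟨h3, h4⟩ := Command.code_append_inj h2
      exact ⟨by rw [h1, h3], h4⟩

theorem Line.code_ne_nil (l : Line) : l.code ≠ [] := by
  obtain ⟨a, c⟩ := l
  cases a <;> cases c <;> simp [Line.code, labelCode, Command.code]

theorem SVAS.code_injective : Function.Injective SVAS.code := by
  have key : ∀ u v : List Line, u.flatMap Line.code = v.flatMap Line.code → u = v := by
    intro u
    induction u with
    | nil =>
      intro v h
      cases v with
      | nil => rfl
      | cons m v => simp [Line.code_ne_nil] at h
    | cons l u ih =>
      intro v h
      cases v with
      | nil => simp [Line.code_ne_nil] at h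
      | cons m v =>
        simp only [List.flatMap_cons] at h
        obtain ⟨h1, h2⟩ := Line.code_append_inj h
        rw [h1, ih v h2]
  intro P Q h
  have := key _ _ h
  cases P; cases Q; simp_all

/-- The encoding of SVAS as words. -/
noncomputable def SVAS.encoding : Computability.Encoding SVAS Token where
  encode := SVAS.code
  decode := Function.partialInv SVAS.code
  decode_encode := Function.partialInv_left SVAS.code_injective

end StackVAS

/-! ## Two-variable logic on leaf-data forests -/

namespace LeafData

/-- A finite ordered forest as a set of addresses: `[i]` is the `i`-th root, and the `i`-th child of
the node `u` is `u ++ [i]` (both counted from `0`). -/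
structure Forest : Type where
  nodes : Finset (List ℕ)
  nil_notMem : [] ∉ nodes
  parent_mem : ∀ u i, u ≠ [] → u ++ [i] ∈ nodes → u ∈ nodes
  sibling_mem : ∀ u i, u ++ [i + 1] ∈ nodes → u ++ [i] ∈ nodes

namespace Forest

abbrev Node (F : Forest) : Type := {u : List ℕ // u ∈ F.nodes}

def IsLeaf (F : Forest) (p : F.Node) : Prop := ∀ i, p.1 ++ [i] ∉ F.nodes

abbrev Leaf (F : Forest) : Type := {p : F.Node // F.IsLeaf p}

/-- `x ↓ y`: the node `y` is a child of `x`. -/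
def Child (F : Forest) (x y : F.Node) : Prop := ∃ i, y.1 = x.1 ++ [i]

/-- `x → y`: the node `y` is the next sibling of `x`, where the roots count as siblings. -/
def NextSibling (F : Forest) (x y : F.Node) : Prop := ∃ u i, x.1 = u ++ [i] ∧ y.1 = u ++ [i + 1]

/-- `x ≺ y`: `x` and `y` are leaves, and `x` precedes `y` in the document order, which is the
lexicographic order on addresses. -/
def LeafPrec (F : Forest) (x y : F.Node) : Prop :=
  F.IsLeaf x ∧ F.IsLeaf y ∧ List.Lex (· < ·) x.1 y.1

end Forest

/-- A leaf-data forest: each node has a label from `A`, and each leaf also has a datum. -/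
structure LeafDataForest (A : Type) extends Forest where
  label : toForest.Node → A
  data : toForest.Leaf → ℕ

/-- `x ∼ y`: `x` and `y` are leaves with the same datum. -/
def LeafDataForest.SameData {A : Type} (F : LeafDataForest A) (x y : F.Node) : Prop :=
  ∃ (hx : F.IsLeaf x) (hy : F.IsLeaf y), F.data ⟨x, hx⟩ = F.data ⟨y, hy⟩

/-- The two variables. -/
inductive Var : Type
  | x | y
  deriving DecidableEq

instance : Fintype Var := ⟨{Var.x, Var.y}, fun v => by cases v <;> simp⟩

/-- Formulas of FO²(+1, ≺, ∼) over the alphabet `A`. There is no equality symbol among the atomic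
formulas. -/
inductive Formula (A : Type) : Type
  | letter (a : A) (v : Var)
  | child (v w : Var)
  | next (v w : Var)
  | prec (v w : Var)
  | sim (v w : Var)
  | neg (φ : Formula A)
  | and (φ ψ : Formula A)
  | or (φ ψ : Formula A)
  | imp (φ ψ : Formula A)
  | ex (v : Var) (φ : Formula A)
  | all (v : Var) (φ : Formula A)

namespace Formula

/-- The variables that occur free. -/
def freeVars {A : Type} : Formula A → Set Var
  | letter _ v => {v}
  | child v w => {v, w}
  | next v w => {v, w}
  | prec v w => {v, w}
  | sim v w => {v, w}
  | neg φ => φ.freeVars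
  | and φ ψ => φ.freeVars ∪ ψ.freeVars
  | or φ ψ => φ.freeVars ∪ ψ.freeVars
  | imp φ ψ => φ.freeVars ∪ ψ.freeVars
  | ex v φ => φ.freeVars \ {v}
  | all v φ => φ.freeVars \ {v}

/-- Truth in a leaf-data forest. A valuation may leave variables undefined, so that sentences can
be evaluated also in the empty forest; values of variables that are not free do not matter. -/
def Holds {A : Type} (F : LeafDataForest A) : Formula A → (Var → Option F.Node) → Prop
  | letter a v, s => ∃ p ∈ s v, F.label p = a
  | child v w, s => ∃ p ∈ s v, ∃ q ∈ s w, F.Child p q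
  | next v w, s => ∃ p ∈ s v, ∃ q ∈ s w, F.NextSibling p q
  | prec v w, s => ∃ p ∈ s v, ∃ q ∈ s w, F.LeafPrec p q
  | sim v w, s => ∃ p ∈ s v, ∃ q ∈ s w, F.SameData p q
  | neg φ, s => ¬ φ.Holds F s
  | and φ ψ, s => φ.Holds F s ∧ ψ.Holds F s
  | or φ ψ, s => φ.Holds F s ∨ ψ.Holds F s
  | imp φ ψ, s => φ.Holds F s → ψ.Holds F s
  | ex v φ, s => ∃ p : F.Node, φ.Holds F (Function.update s v (some p))
  | all v φ, s => ∀ p : F.Node, φ.Holds F (Function.update s v (some p))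

end Formula

/-- An instance of the satisfiability problem: a finite alphabet, of `card` letters, and a sentence
over it. -/
structure Sentence : Type where
  card : ℕ
  formula : Formula (Fin card)
  closed : formula.freeVars = ∅

/-- The satisfiability problem: the sentence is true in some leaf-data forest over its alphabet. -/
def Sentence.Satisfiable (φ : Sentence) : Prop :=
  ∃ F : LeafDataForest (Fin φ.card), φ.formula.Holds F (fun _ => none)

/-! ### Sentences as output words -/

/-- The finite alphabet in which sentences are written. -/
inductive Token : Type
  | tally | fin | letter | child | next | prec | sim | neg | and | or | imp | ex | all
  | var (v : Var)
  deriving DecidableEq, Fintype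

/-- Numbers are written in unary, with a terminator. -/
def numCode (n : ℕ) : List Token := List.replicate n Token.tally ++ [Token.fin]

/-- Formulas are written in prefix notation. -/
def Formula.code {k : ℕ} : Formula (Fin k) → List Token
  | .letter a v => Token.letter :: Token.var v :: numCode a
  | .child v w => [Token.child, Token.var v, Token.var w]
  | .next v w => [Token.next, Token.var v, Token.var w]
  | .prec v w => [Token.prec, Token.var v, Token.var w]
  | .sim v w => [Token.sim, Token.var v, Token.var w]
  | .neg φ => Token.neg :: φ.code
  | .and φ ψ => Token.and :: (φ.code ++ ψ.code)
  | .or φ ψ => Token.or :: (φ.code ++ ψ.code)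
  | .imp φ ψ => Token.imp :: (φ.code ++ ψ.code)
  | .ex v φ => Token.ex :: Token.var v :: φ.code
  | .all v φ => Token.all :: Token.var v :: φ.code

/-- An instance is written as the size of its alphabet, in unary, followed by the formula. -/
def Sentence.code (φ : Sentence) : List Token := numCode φ.card ++ φ.formula.code

theorem numCode_append_inj {m n : ℕ} {r t : List Token}
    (h : numCode m ++ r = numCode n ++ t) : m = n ∧ r = t := by
  induction m generalizing n with
  | zero => cases n <;> simp_all [numCode, List.replicate_succ]
  | succ m ih =>
    cases n with
    | zero => simp [numCode, List.replicate_succ] at h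
    | succ n =>
      have h' : numCode m ++ r = numCode n ++ t := by
        simpa [numCode, List.replicate_succ] using h
      obtain ⟨h1, h2⟩ := ih h'
      exact ⟨by rw [h1], h2⟩

theorem Formula.code_append_inj {k : ℕ} {φ ψ : Formula (Fin k)} {r t : List Token}
    (h : φ.code ++ r = ψ.code ++ t) : φ = ψ ∧ r = t := by
  induction φ generalizing ψ r t with
  | letter a v =>
    cases ψ <;> simp [Formula.code] at h
    obtain ⟨h1, h2⟩ := h
    obtain ⟨h3, h4⟩ := numCode_append_inj h2
    exact ⟨by rw [h1, Fin.ext h3], h4⟩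
  | child v w => cases ψ <;> simp_all [Formula.code]
  | next v w => cases ψ <;> simp_all [Formula.code]
  | prec v w => cases ψ <;> simp_all [Formula.code]
  | sim v w => cases ψ <;> simp_all [Formula.code]
  | neg φ ih =>
    cases ψ <;> simp [Formula.code] at h
    obtain ⟨h1, h2⟩ := ih h
    exact ⟨by rw [h1], h2⟩
  | and φ φ' ih ih' | or φ φ' ih ih' | imp φ φ' ih ih' =>
    cases ψ <;> simp [Formula.code] at h
    obtain ⟨h1, h2⟩ := ih h
    obtain ⟨h3, h4⟩ := ih' h2
    exact ⟨by rw [h1, h3], h4⟩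
  | ex v φ ih | all v φ ih =>
    cases ψ <;> simp [Formula.code] at h
    obtain ⟨h1, h2⟩ := h
    obtain ⟨h3, h4⟩ := ih h2
    exact ⟨by rw [h1, h3], h4⟩

theorem Sentence.code_injective : Function.Injective Sentence.code := by
  rintro ⟨k, φ, hφ⟩ ⟨l, ψ, hψ⟩ h
  obtain ⟨h1, h2⟩ := numCode_append_inj h
  obtain rfl : k = l := h1
  have h3 : φ.code ++ [] = ψ.code ++ [] := by simpa using h2
  obtain rfl := (Formula.code_append_inj h3).1
  rfl

/-- The encoding of sentences as words. -/
noncomputable def Sentence.encoding : Computability.Encoding Sentence Token where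
  encode := Sentence.code
  decode := Function.partialInv Sentence.code
  decode_encode := Function.partialInv_left Sentence.code_injective

end LeafData

/-! ## Logarithmic-space reductions -/

namespace LogSpace

/-- Head movements. -/
inductive Move : Type
  | left | stay | right

/-- What the head on the read-only input tape sees: an end marker or a symbol of the input. -/
inductive InputCell (I : Type) : Type
  | leftEnd
  | sym (a : I)
  | rightEnd

/-- A deterministic Turing machine with a two-way read-only input tape with end markers, finitely
many work tapes, and a write-only output tape. Depending on the state and the scanned symbols, it
either halts or changes state, moves the input head, writes and moves on every work tape, and
appends a word to the output. -/
structure Transducer (I O : Type) : Type 1 where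
  State : Type
  Work : Type
  finite_state : Finite State
  finite_work : Finite Work
  tapes : ℕ
  blank : Work
  start : State
  step : State → InputCell I → (Fin tapes → Work) →
    Option (State × Move × (Fin tapes → Work × Move) × List O)

namespace Transducer

variable {I O : Type}

/-- Configurations. The work tapes are infinite to the right, with cells `0, 1, 2, …`; on the input
`w` the input head is in one of the cells `0` (left end marker), `1, …, |w|` (the letters of `w`)
and `|w| + 1` (right end marker). -/
structure Config (M : Transducer I O) : Type where
  state : M.State
  inputHead : ℕ
  tape : Fin M.tapes → ℕ → M.Work
  head : Fin M.tapes → ℕ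
  output : List O

/-- The contents of the `i`-th cell of the input tape. -/
def inputCell (w : List I) : ℕ → InputCell I
  | 0 => InputCell.leftEnd
  | i + 1 => match w[i]? with
    | some a => InputCell.sym a
    | none => InputCell.rightEnd

/-- Movement of a head; a head that would leave its tape on the left stays. -/
def moveHead : Move → ℕ → ℕ
  | Move.left, i => i - 1
  | Move.stay, i => i
  | Move.right, i => i + 1

/-- The initial configuration. -/
def init (M : Transducer I O) : M.Config where
  state := M.start
  inputHead := 0
  tape := fun _ _ => M.blank
  head := fun _ => 0
  output := []

/-- The next configuration on the input `w`, if the machine does not halt. The input head does not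
move beyond the right end marker. -/
def next (M : Transducer I O) (w : List I) (c : M.Config) : Option M.Config :=
  (M.step c.state (inputCell w c.inputHead) (fun i => c.tape i (c.head i))).map fun r =>
    { state := r.1
      inputHead := min (moveHead r.2.1 c.inputHead) (w.length + 1)
      tape := fun i => Function.update (c.tape i) (c.head i) (r.2.2.1 i).1
      head := fun i => moveHead (r.2.2.1 i).2 (c.head i)
      output := c.output ++ r.2.2.2 }

/-- On the input `w` the machine halts with the output `v`. -/
def HaltsWith (M : Transducer I O) (w : List I) (v : List O) : Prop :=
  ∃ c ∈ StateTransition.eval (M.next w) M.init, c.output = v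

/-- On the input `w` the machine uses at most `s` cells of each work tape. -/
def UsesSpace (M : Transducer I O) (w : List I) (s : ℕ) : Prop :=
  ∀ c, StateTransition.Reaches (M.next w) M.init c → ∀ i, c.head i < s

end Transducer

/-- The function `f` is computable in logarithmic space with respect to the given encodings over
finite alphabets. -/
def Computable {α β I O : Type} [Finite I] [Finite O] (ea : Computability.Encoding α I)
    (eb : Computability.Encoding β O) (f : α → β) : Prop :=
  ∃ (M : Transducer I O) (k : ℕ), ∀ a : α,
    M.HaltsWith (ea.encode a) (eb.encode (f a)) ∧
    M.UsesSpace (ea.encode a) (k * Nat.log 2 (ea.encode a).length + k)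

/-- The problem `p` is many-one reducible in logarithmic space to the problem `q`. -/
def Reducible {α β I O : Type} [Finite I] [Finite O] (ea : Computability.Encoding α I)
    (eb : Computability.Encoding β O) (p : α → Prop) (q : β → Prop) : Prop :=
  ∃ f : α → β, Computable ea eb f ∧ ∀ a, p a ↔ q (f a)

end LogSpace

/-! A halting computation is drawn as a forest whose nodes, in document order, are the executed
commands; the label of a node is the position of its command. After an increment, a decrement or a
jump, the next command sits at the next sibling. After `push a` it sits at the first child. A `pop
a` is a childless last child of a node labelled `push a`, and the next command sits at the next
sibling of that parent. Hence the proper ancestors of a node spell the stack before its command.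
`halt` is a childless last root.

Counters are controlled by data. The datum of an `inc x` occurs at some later leaf, and only at `dec
x` among later leaves; the datum of a `dec x` occurs at some earlier leaf, and only at `inc x` among
earlier leaves. Two increments cannot share a datum, since the later one would have to be a
decrement, and dually. So the data pair each increment with exactly one later decrement of the same
counter: no counter becomes negative, and all counters end at zero. All these conditions are local
and need only two variables. One extra letter, which is forbidden, stands for the position behind
the last line.

From a model, `exists_reaches_last` extracts the computation: from any node and with any stack, the
commands can be executed up to the last sibling, returning to the same stack, where the children of
a `push` node form the excursion between the push and its pop. Counter values are read off as
differences of two counts (`counterAt`). Conversely, `exists_inv` builds the forest along a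
computation. A decrement receives the datum of a pending increment, every other node a fresh one.

For logarithmic space, the code of the sentence has one clause per line, with disjunctions over the
lines that contain a given name. It can be printed by rescanning the input with boundedly many
registers that hold positions or numbers of commands. The registers are binary numerals on the work
tapes. Programs over them are structured terms, and `Exec.haltsWithin` turns these into a transducer
whose states are lists of programs still to be executed. `runs_printSentence` describes the printed
word, and `code_sentence` identifies it with the code of the sentence. -/

/-! ## Structured programs for transducers -/

namespace LogSpace

/-- Structured programs over the tapes of a transducer: single steps, sequencing, branching and
loops guarded by what the heads scan. -/
inductive Prog (I O W : Type) (k : ℕ) : Type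
  | act (f : InputCell I → (Fin k → W) → Move × (Fin k → W × Move) × List O)
  | seq (p q : Prog I O W k)
  | ite (t : InputCell I → (Fin k → W) → Bool) (p q : Prog I O W k)
  | loop (t : InputCell I → (Fin k → W) → Bool) (p : Prog I O W k)

/-- The part of a configuration on which programs operate. -/
@[ext] structure Mem (O W : Type) (k : ℕ) : Type where
  inputHead : ℕ
  tape : Fin k → ℕ → W
  head : Fin k → ℕ
  output : List O

variable {I O W : Type} {k : ℕ}

namespace Mem

def scanned (m : Mem O W k) : Fin k → W := fun i => m.tape i (m.head i)

/-- The effect of one transducer step on the input `w`. -/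
def apply (w : List I) (m : Mem O W k) (r : Move × (Fin k → W × Move) × List O) : Mem O W k where
  inputHead := min (Transducer.moveHead r.1 m.inputHead) (w.length + 1)
  tape := fun i => Function.update (m.tape i) (m.head i) (r.2.1 i).1
  head := fun i => Transducer.moveHead (r.2.1 i).2 (m.head i)
  output := m.output ++ r.2.2

end Mem

namespace Prog

/-- The step that changes nothing. -/
def idle (a : Fin k → W) : Move × (Fin k → W × Move) × List O :=
  (Move.stay, fun i => (a i, Move.stay), [])

theorem apply_idle (w : List I) (m : Mem O W k) (h : m.inputHead ≤ w.length + 1) :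
    m.apply w (idle m.scanned) = m := by
  ext <;> simp [Mem.apply, idle, Mem.scanned, Transducer.moveHead, h]

/-- One step on a list of programs that remain to be executed. -/
def stepList : List (Prog I O W k) → InputCell I → (Fin k → W) →
    Option (List (Prog I O W k) × Move × (Fin k → W × Move) × List O)
  | [], _, _ => none
  | act f :: K, c, a => some (K, f c a)
  | seq p q :: K, _, a => some (p :: q :: K, idle a)
  | ite t p q :: K, c, a => some ((if t c a then p else q) :: K, idle a)
  | loop t p :: K, c, a => some (if t c a then p :: loop t p :: K else K, idle a)

/-- The lists of programs that arise in the execution of `p` before `K`. -/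
def conts : Prog I O W k → List (Prog I O W k) → Set (List (Prog I O W k))
  | act f, K => {act f :: K}
  | seq p q, K => insert (seq p q :: K) (p.conts (q :: K) ∪ q.conts K)
  | ite t p q, K => insert (ite t p q :: K) (p.conts K ∪ q.conts K)
  | loop t p, K => insert (loop t p :: K) (p.conts (loop t p :: K))

/-- A loop puts one fixed list back in front of its body, however often the body is run, so only
finitely many continuations arise. This allows them to serve as states. -/
theorem finite_conts (p : Prog I O W k) (K : List (Prog I O W k)) : (p.conts K).Finite := by
  induction p generalizing K with
  | act f => exact Set.finite_singleton _
  | seq p q hp hq => exact ((hp _).union (hq _)).insert _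
  | ite t p q hp hq => exact ((hp _).union (hq _)).insert _
  | loop t p hp => exact (hp _).insert _

theorem mem_conts (p : Prog I O W k) (K : List (Prog I O W k)) : p :: K ∈ p.conts K := by
  cases p <;> simp [conts]

open Classical in
/-- The transducer that executes a program. -/
noncomputable def machine [Finite W] (p : Prog I O W k) (blank : W) : Transducer I O where
  State := {K : List (Prog I O W k) // K ∈ insert [] (p.conts [])}
  Work := W
  finite_state := ((p.finite_conts []).insert _).to_subtype
  finite_work := inferInstance
  tapes := k
  blank := blank
  start := ⟨p :: [], Set.mem_insert_of_mem _ (p.mem_conts _)⟩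
  step K c a := (stepList K.1 c a).bind fun r =>
    -- The set of continuations is closed under `stepList`, so the other branch is only a formal
    -- default.
    if h : r.1 ∈ insert [] (p.conts []) then some (⟨r.1, h⟩, r.2) else none

/-- The program `p` transforms `m` into `m'`, with all heads in the first `s` cells throughout. -/
inductive Exec (w : List I) (s : ℕ) : Prog I O W k → Mem O W k → Mem O W k → Prop
  | act {f m} : (∀ i, m.head i < s) →
      Exec w s (act f) m (m.apply w (f (Transducer.inputCell w m.inputHead) m.scanned))
  | seq {p q m m' m''} : Exec w s p m m' → Exec w s q m' m'' → Exec w s (seq p q) m m''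
  | ite_true {t p q m m'} : t (Transducer.inputCell w m.inputHead) m.scanned = true →
      Exec w s p m m' → Exec w s (ite t p q) m m'
  | ite_false {t p q m m'} : t (Transducer.inputCell w m.inputHead) m.scanned = false →
      Exec w s q m m' → Exec w s (ite t p q) m m'
  | loop_true {t p m m' m''} : t (Transducer.inputCell w m.inputHead) m.scanned = true →
      Exec w s p m m' → Exec w s (loop t p) m' m'' → Exec w s (loop t p) m m''
  | loop_false {t p m} : t (Transducer.inputCell w m.inputHead) m.scanned = false →
      Exec w s (loop t p) m m

theorem Exec.inputHead_le {w : List I} {s : ℕ} {p : Prog I O W k} {m m' : Mem O W k}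
    (h : Exec w s p m m') (hm : m.inputHead ≤ w.length + 1) : m'.inputHead ≤ w.length + 1 := by
  induction h with
  | act _ => exact min_le_right _ _
  | seq _ _ h1 h2 => exact h2 (h1 hm)
  | ite_true _ _ h | ite_false _ _ h => exact h hm
  | loop_true _ _ _ h1 h2 => exact h2 (h1 hm)
  | loop_false _ => exact hm

end Prog

/-! ### Halting runs with bounded heads -/

namespace Transducer

/-- From the configuration `c` the machine halts with output `v`, and all heads stay in the first
`s` cells. -/
inductive HaltsWithin (M : Transducer I O) (w : List I) (s : ℕ) (v : List O) : M.Config → Prop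
  | halt {c} : M.next w c = none → (∀ i, c.head i < s) → c.output = v → HaltsWithin M w s v c
  | step {c c'} : M.next w c = some c' → (∀ i, c.head i < s) → HaltsWithin M w s v c' →
      HaltsWithin M w s v c

variable {M : Transducer I O} {w : List I} {s : ℕ} {v : List O} {c : M.Config}

theorem HaltsWithin.head_lt (h : HaltsWithin M w s v c) : ∀ i, c.head i < s := by
  cases h <;> assumption

theorem HaltsWithin.exists_mem_eval (h : HaltsWithin M w s v c) :
    ∃ d ∈ StateTransition.eval (M.next w) c, d.output = v := by
  induction h with
  | @halt c h1 _ h2 => exact ⟨c, StateTransition.mem_eval.2 ⟨Relation.ReflTransGen.refl, h1⟩, h2⟩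
  | step h1 _ _ ih =>
    obtain ⟨d, hd, hv⟩ := ih
    obtain ⟨hd1, hd2⟩ := StateTransition.mem_eval.1 hd
    exact ⟨d, StateTransition.mem_eval.2 ⟨Relation.ReflTransGen.head h1 hd1, hd2⟩, hv⟩

/-- The machine is deterministic, so every configuration that is reached lies on the single run
recorded by `h`. -/
theorem HaltsWithin.head_lt_of_reaches (h : HaltsWithin M w s v c) {d : M.Config}
    (hd : StateTransition.Reaches (M.next w) c d) : ∀ i, d.head i < s := by
  induction h with
  | halt h1 h2 _ =>
    rcases Relation.ReflTransGen.cases_head hd with rfl | ⟨e, he, _⟩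
    · exact h2
    · simp [h1] at he
  | step h1 h2 _ ih =>
    rcases Relation.ReflTransGen.cases_head hd with rfl | ⟨e, he, h3⟩
    · exact h2
    · have : e = _ := Option.some.inj ((Option.mem_def.1 he).symm.trans h1)
      exact ih (this ▸ h3)

end Transducer

/-! ### Correctness of the compiled machine -/

namespace Prog

variable [Finite W]

/-- The configuration with the given remaining programs and memory. -/
def config (p : Prog I O W k) (b : W) (K : List (Prog I O W k)) (hK : K ∈ insert [] (p.conts []))
    (m : Mem O W k) : (p.machine b).Config where
  state := ⟨K, hK⟩
  inputHead := m.inputHead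
  tape := m.tape
  head := m.head
  output := m.output

theorem next_config (p : Prog I O W k) (b : W) (w : List I) {K : List (Prog I O W k)}
    (hK : K ∈ insert [] (p.conts [])) (m : Mem O W k) {r}
    (hr : stepList K (Transducer.inputCell w m.inputHead) m.scanned = some r)
    (hr' : r.1 ∈ insert [] (p.conts [])) :
    (p.machine b).next w (p.config b K hK m) = some (p.config b r.1 hr' (m.apply w r.2)) := by
  have : (p.machine b).step ⟨K, hK⟩ (Transducer.inputCell w m.inputHead) m.scanned =
      some (⟨r.1, hr'⟩, r.2) := by
    simp only [machine, hr, Option.bind_some, hr', dif_pos]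
  have h2 := congrArg (Option.map fun r : _ × Move × (Fin k → W × Move) × List O => 
    ({ state := r.1
       inputHead := min (Transducer.moveHead r.2.1 m.inputHead) (w.length + 1)
       tape := fun i => Function.update (m.tape i) (m.head i) (r.2.2.1 i).1
       head := fun i => Transducer.moveHead (r.2.2.1 i).2 (m.head i)
       output := m.output ++ r.2.2.2 } : (p.machine b).Config)) this
  exact h2

/-- The run is assembled backwards: a halting run from the remaining programs `K` and the final
memory is extended by the steps for `p`. The hypothesis `hp` keeps all intermediate lists inside the
state set of the whole program `p₀`. Control steps only idle, so their head bound is that of the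
configuration after them. -/
theorem Exec.haltsWithin {p₀ : Prog I O W k} {b : W} {w : List I} {s : ℕ} {v : List O}
    {p : Prog I O W k} {m m' : Mem O W k} (h : Exec w s p m m')
    (hm : m.inputHead ≤ w.length + 1) (K : List (Prog I O W k))
    (hp : p.conts K ⊆ insert [] (p₀.conts [])) (hK : K ∈ insert [] (p₀.conts []))
    (hg : Transducer.HaltsWithin (p₀.machine b) w s v (p₀.config b K hK m')) :
    Transducer.HaltsWithin (p₀.machine b) w s v
      (p₀.config b (p :: K) (hp (p.mem_conts K)) m) := by
  induction h generalizing K with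
  | act h => exact .step (next_config p₀ b w _ _ rfl hK) h hg
  | @seq p q m m' m'' h1 h2 ih1 ih2 =>
    have hp' := Set.union_subset_iff.1 ((Set.insert_subset_iff.1 hp).2)
    have g := ih1 hm (q :: K) hp'.1 (hp'.2 (q.mem_conts K))
      (ih2 (h1.inputHead_le hm) K hp'.2 hK hg)
    refine .step (next_config p₀ b w _ _ rfl (hp'.1 (p.mem_conts _))) g.head_lt ?_
    rw [apply_idle w m hm]
    exact g
  | @ite_true t p q m m' ht h ih =>
    have hp' := Set.union_subset_iff.1 ((Set.insert_subset_iff.1 hp).2)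
    have g := ih hm K hp'.1 hK hg
    refine .step (next_config p₀ b w _ m (r := (p :: K, idle m.scanned)) (by simp [stepList, ht])
      (hp'.1 (p.mem_conts _))) g.head_lt ?_
    rw [apply_idle w m hm]
    exact g
  | @ite_false t p q m m' ht h ih =>
    have hp' := Set.union_subset_iff.1 ((Set.insert_subset_iff.1 hp).2)
    have g := ih hm K hp'.2 hK hg
    refine .step (next_config p₀ b w _ m (r := (q :: K, idle m.scanned)) (by simp [stepList, ht])
      (hp'.2 (q.mem_conts _))) g.head_lt ?_
    rw [apply_idle w m hm]
    exact g
  | @loop_true t p m m' m'' ht h1 h2 ih1 ih2 =>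
    have hp' := (Set.insert_subset_iff.1 hp).2
    have g := ih1 hm (loop t p :: K) hp' (hp (mem_conts _ K)) (ih2 (h1.inputHead_le hm) K hp hK hg)
    refine .step (next_config p₀ b w _ m (r := (p :: loop t p :: K, idle m.scanned))
      (by simp [stepList, ht]) (hp' (p.mem_conts _))) g.head_lt ?_
    rw [apply_idle w m hm]
    exact g
  | @loop_false t p m ht =>
    refine .step (next_config p₀ b w _ m (r := (K, idle m.scanned))
      (by simp [stepList, ht]) hK) hg.head_lt ?_
    rw [apply_idle w m hm]
    exact hg

/-- The memory at the start of a computation. -/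
def initMem (b : W) : Mem O W k := ⟨0, fun _ _ => b, fun _ => 0, []⟩

theorem Exec.machine {p : Prog I O W k} {b : W} {w : List I} {s : ℕ} {m : Mem O W k}
    (h : Exec w s p (initMem b) m) (hm : ∀ i, m.head i < s) :
    (p.machine b).HaltsWith w m.output ∧ (p.machine b).UsesSpace w s := by
  have g := h.haltsWithin (b := b) (v := m.output) (p₀ := p) (Nat.zero_le _) []
    (Set.subset_insert _ _) (Set.mem_insert _ _) (.halt (by simp [Transducer.next, config, Prog.machine, stepList]) hm rfl)
  exact ⟨g.exists_mem_eval, fun c hc => g.head_lt_of_reaches hc⟩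

end Prog

end LogSpace

/-! ## Binary counters on the work tapes -/

namespace LogSpace

/-- The symbols on work tapes: a marker for the first cell, and the digits one and two of bijective
binary numeration, in which zero is the empty word. -/
inductive Cell : Type
  | blank | mark | one | two
  deriving DecidableEq

instance : Finite Cell :=
  Finite.of_surjective ![Cell.blank, Cell.mark, Cell.one, Cell.two] fun c => by
    cases c
    exacts [⟨0, rfl⟩, ⟨1, rfl⟩, ⟨2, rfl⟩, ⟨3, rfl⟩]

namespace Cell

/-- The successor on bijective binary numerals, least significant digit first; `true` is the digit
two. -/
def succDigits : List Bool → List Bool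
  | [] => [false]
  | false :: L => true :: L
  | true :: L => false :: succDigits L

def digits (n : ℕ) : List Bool := succDigits^[n] []

theorem digits_succ (n : ℕ) : digits (n + 1) = succDigits (digits n) :=
  Function.iterate_succ_apply' _ _ _

/-- The value of a bijective binary numeral. -/
def value : List Bool → ℕ
  | [] => 0
  | b :: L => (if b then 2 else 1) + 2 * value L

theorem value_succDigits (L : List Bool) : value (succDigits L) = value L + 1 := by
  induction L with
  | nil => rfl
  | cons b L ih => cases b <;> simp [succDigits, value, ih] <;> omega

theorem value_digits (n : ℕ) : value (digits n) = n := by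
  induction n with
  | zero => rfl
  | succ n ih => rw [digits_succ, value_succDigits, ih]

/-- The least numeral of a given length consists of ones only, and its value is one less than a
power of two. -/
theorem two_pow_length_le (L : List Bool) : 2 ^ L.length ≤ value L + 1 := by
  induction L with
  | nil => simp [value]
  | cons b L ih => cases b <;> simp [value, pow_succ] <;> omega

theorem length_digits_le (n : ℕ) : (digits n).length ≤ Nat.log 2 (n + 1) := by
  refine Nat.le_log_of_pow_le (by norm_num) ?_
  simpa [value_digits] using two_pow_length_le (digits n)

theorem digits_eq_nil_iff {n : ℕ} : digits n = [] ↔ n = 0 :=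
  ⟨fun h => by rw [← value_digits n, h]; rfl, fun h => by rw [h]; rfl⟩

def digit (b : Bool) : Cell := if b then two else one

/-- The tape with the given digits, behind the marker. -/
def tapeOf (L : List Bool) : ℕ → Cell
  | 0 => mark
  | i + 1 => (L[i]?).elim blank digit

theorem tapeOf_cons_one (b : Bool) (P L : List Bool) :
    tapeOf (P ++ b :: L) (P.length + 1) = digit b := by
  simp [tapeOf]

theorem tapeOf_length_add_one (L : List Bool) : tapeOf L (L.length + 1) = blank := by
  simp [tapeOf]

theorem tapeOf_ne_mark (L : List Bool) (i : ℕ) : tapeOf L (i + 1) ≠ mark := by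
  simp only [tapeOf]
  cases L[i]? with
  | none => simp
  | some b => cases b <;> simp [digit]

theorem update_tapeOf (b c : Bool) (P L : List Bool) :
    Function.update (tapeOf (P ++ b :: L)) (P.length + 1) (digit c) = tapeOf (P ++ c :: L) := by
  funext i
  rcases i with _ | i
  · simp [tapeOf]
  · by_cases h : i = P.length
    · subst h; simp [tapeOf]
    · rw [Function.update_of_ne (by omega)]
      rcases lt_or_gt_of_ne h with h | h
      · simp [tapeOf, List.getElem?_append_left h]
      · obtain ⟨d, rfl⟩ := Nat.exists_eq_add_of_lt h
        simp [tapeOf, List.getElem?_append_right, Nat.add_assoc]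

theorem update_tapeOf_end (c : Bool) (P : List Bool) :
    Function.update (tapeOf P) (P.length + 1) (digit c) = tapeOf (P ++ [c]) := by
  funext i
  rcases i with _ | i
  · simp [tapeOf]
  · by_cases h : i = P.length
    · subst h; simp [tapeOf]
    · rw [Function.update_of_ne (by omega)]
      rcases lt_or_gt_of_ne h with h | h
      · simp [tapeOf, List.getElem?_append_left h]
      · obtain ⟨d, rfl⟩ := Nat.exists_eq_add_of_lt h
        simp [tapeOf, Nat.add_assoc]

theorem update_tapeOf_blank (b : Bool) (P : List Bool) :
    Function.update (tapeOf (P ++ [b])) (P.length + 1) blank = tapeOf P := by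
  rw [← update_tapeOf_end b P, Function.update_idem, ← tapeOf_length_add_one P,
    Function.update_eq_self]

end Cell

open Cell

variable {I O : Type} {k : ℕ}

/-- The memory with other contents of the tape `r`. -/
def Mem.setTape (m : Mem O Cell k) (r : Fin k) (t : ℕ → Cell) (h : ℕ) : Mem O Cell k :=
  { m with tape := Function.update m.tape r t, head := Function.update m.head r h }

namespace Prog

/-- A step in which only the head on the tape `r` writes and moves. -/
def onTape (r : Fin k) (g : Cell → Cell × Move) : Prog I O Cell k :=
  act fun _ a => (Move.stay, fun i => if i = r then g (a i) else (a i, Move.stay), [])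

def scans (r : Fin k) (g : Cell → Bool) : InputCell I → (Fin k → Cell) → Bool := fun _ a => g (a r)

section
variable {w : List I} {s : ℕ} {m : Mem O Cell k} {r : Fin k}

theorem scanned_setTape (t : ℕ → Cell) (h : ℕ) : (m.setTape r t h).scanned r = t h := by
  simp [Mem.setTape, Mem.scanned]

/-- A frame rule: the memory outside the tape `r` is an arbitrary `m`, and programs on one tape can
be verified through `setTape` alone. -/
theorem exec_onTape {g : Cell → Cell × Move} {t : ℕ → Cell} {h : ℕ}
    (hm : m.inputHead ≤ w.length + 1) (hs : ∀ i, m.head i < s) (h' : h < s) :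
    Exec w s (onTape r g) (m.setTape r t h)
      (m.setTape r (Function.update t h (g (t h)).1) (Transducer.moveHead (g (t h)).2 h)) := by
  have key : m.setTape r (Function.update t h (g (t h)).1) (Transducer.moveHead (g (t h)).2 h) =
      (m.setTape r t h).apply w (Move.stay, fun i => if i = r then g ((m.setTape r t h).scanned i)
        else ((m.setTape r t h).scanned i, Move.stay), []) := by
    ext i
    · simp [Mem.apply, Transducer.moveHead, Mem.setTape, hm]
    · by_cases hi : i = r
      · subst hi; simp [Mem.apply, Mem.setTape, Mem.scanned]
      · simp [Mem.apply, Mem.setTape, Mem.scanned, hi]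
    · by_cases hi : i = r
      · subst hi; simp [Mem.apply, Mem.setTape, Mem.scanned]
      · simp [Mem.apply, Mem.setTape, Transducer.moveHead, hi]
    · simp [Mem.apply, Mem.setTape]
  rw [key]
  refine Exec.act fun i => ?_
  by_cases hi : i = r
  · subst hi; simpa [Mem.setTape] using h'
  · simpa [Mem.setTape, hi] using hs i

/-- Return to the least significant digit. -/
def rewindTape (r : Fin k) : Prog I O Cell k :=
  seq (loop (scans r fun c => decide (c ≠ mark)) (onTape r fun c => (c, Move.left)))
    (onTape r fun c => (c, Move.right))

theorem exec_rewindTape (hm : m.inputHead ≤ w.length + 1) (hs : ∀ i, m.head i < s) (L : List Bool)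
    (h : ℕ) (h' : h < s) :
    Exec w s (rewindTape r) (m.setTape r (tapeOf L) h) (m.setTape r (tapeOf L) 1) := by
  have key : Exec w s (loop (scans r fun c => decide (c ≠ mark)) (onTape r fun c => (c, Move.left)))
      (m.setTape r (tapeOf L) h) (m.setTape r (tapeOf L) 0) := by
    induction h with
    | zero => exact .loop_false (by simp [scans, scanned_setTape, tapeOf])
    | succ h ih =>
      refine .loop_true (by simp [scans, scanned_setTape, tapeOf_ne_mark])
        (exec_onTape hm hs h') ?_
      simpa [Transducer.moveHead] using ih (by omega)
  refine .seq key ?_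
  have := exec_onTape (I := I) (O := O) (w := w) (r := r) (m := m) (s := s)
    (g := fun c => (c, Move.right)) (t := tapeOf L) (h := 0) hm hs (by omega)
  simpa [Transducer.moveHead] using this

/-- Increment of the numeral on the tape `r`. -/
def incTape (r : Fin k) : Prog I O Cell k :=
  seq (seq (loop (scans r fun c => decide (c = two)) (onTape r fun _ => (one, Move.right)))
    (onTape r fun c => (if c = one then two else one, Move.stay))) (rewindTape r)

/-- Induction along the carry: `P` holds the digits already passed and `L` those still to be
treated. The head stops where the carry stops, hence the existential position; the rewinding program
accepts any. -/
theorem exec_incTape_aux (hm : m.inputHead ≤ w.length + 1) (hs : ∀ i, m.head i < s)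
    (L P : List Bool) (h' : (P ++ L).length + 1 < s) : ∃ h < s,
    Exec w s (seq (loop (scans r fun c => decide (c = two)) (onTape r fun _ => (one, Move.right)))
      (onTape r fun c => (if c = one then two else one, Move.stay)))
      (m.setTape r (tapeOf (P ++ L)) (P.length + 1)) (m.setTape r (tapeOf (P ++ succDigits L)) h) := by
  simp only [List.length_append] at h'
  have hP : P.length + 1 < s := by omega
  induction L generalizing P with
  | nil =>
    refine ⟨P.length + 1, hP, .seq (.loop_false ?_) ?_⟩
    · simp [scans, scanned_setTape, tapeOf]
    · have := exec_onTape (I := I) (w := w) (m := m) (r := r)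
        (g := fun c => (if c = one then two else one, Move.stay)) (t := tapeOf P) hm hs hP
      rw [tapeOf_length_add_one] at this
      simpa [succDigits, ← update_tapeOf_end, digit, Transducer.moveHead] using this
  | cons b L ih =>
    cases b with
    | false =>
      refine ⟨P.length + 1, hP, .seq (.loop_false ?_) ?_⟩
      · simp [scans, scanned_setTape, tapeOf, digit]
      · have := exec_onTape (I := I) (w := w) (m := m) (r := r)
          (g := fun c => (if c = one then two else one, Move.stay)) (t := tapeOf (P ++ false :: L))
          hm hs hP
        rw [tapeOf_cons_one] at this
        simpa [succDigits, ← update_tapeOf false true, digit, Transducer.moveHead] using this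
    | true =>
      obtain ⟨h, hh, ih⟩ := ih (P ++ [false]) (by simp at h' ⊢; omega) (by simp at h' ⊢; omega)
      refine ⟨h, hh, ?_⟩
      -- The induction hypothesis starts one cell further to the right, so its loop has to be
      -- prefixed by one iteration.
      cases ih with
      | @seq _ _ _ m' _ h1 h2 =>
        refine .seq (m' := m') (.loop_true ?_ (exec_onTape hm hs hP) ?_) ?_
        rotate_left 2
        · simpa [succDigits] using h2
        · simp [scans, scanned_setTape, tapeOf, digit]
        · have : Function.update (tapeOf (P ++ true :: L)) (P.length + 1) one = _ :=
            update_tapeOf true false P L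
          simpa [Transducer.moveHead, this] using h1

theorem exec_incTape (hm : m.inputHead ≤ w.length + 1) (hs : ∀ i, m.head i < s)
    (L : List Bool) (h' : L.length + 1 < s) :
    Exec w s (incTape r) (m.setTape r (tapeOf L) 1) (m.setTape r (tapeOf (succDigits L)) 1) := by
  obtain ⟨h, hh, h1⟩ := exec_incTape_aux (O := O) (r := r) hm hs L [] (by simpa using h')
  exact .seq h1 (exec_rewindTape hm hs _ _ hh)

/-- Decrement of a non-empty numeral on the tape `r`. -/
def decTape (r : Fin k) : Prog I O Cell k :=
  seq (seq (loop (scans r fun c => decide (c = one)) (onTape r fun _ => (two, Move.right)))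
    (ite (scans r fun c => decide (c = two)) (onTape r fun _ => (one, Move.stay))
      (seq (onTape r fun c => (c, Move.left)) (onTape r fun _ => (blank, Move.stay)))))
    (rewindTape r)

/-- Writing the initial numeral as a successor makes the borrow the reversal of the carry and
replaces the assumption that it is non-empty. The bound is one larger than for the increment: if the
borrow runs through the top digit, the head visits the blank behind it before erasing that digit. -/
theorem exec_decTape_aux (hm : m.inputHead ≤ w.length + 1) (hs : ∀ i, m.head i < s)
    (L P : List Bool) (h' : (P ++ L).length + 2 < s) : ∃ h < s,
    Exec w s (seq (loop (scans r fun c => decide (c = one)) (onTape r fun _ => (two, Move.right)))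
      (ite (scans r fun c => decide (c = two)) (onTape r fun _ => (one, Move.stay))
      (seq (onTape r fun c => (c, Move.left)) (onTape r fun _ => (blank, Move.stay)))))
      (m.setTape r (tapeOf (P ++ succDigits L)) (P.length + 1)) (m.setTape r (tapeOf (P ++ L)) h) := by
  simp only [List.length_append] at h'
  have hP : P.length + 1 < s := by omega
  induction L generalizing P with
  | nil =>
    -- The top digit is a one. The loop turns it into a two and stops on the blank behind it, so the
    -- second branch steps back and erases it.
    refine ⟨P.length + 1, hP, .seq (.loop_true ?_ (exec_onTape hm hs hP) (.loop_false ?_))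
      (.ite_false ?_ (.seq (m' := m.setTape r (tapeOf (P ++ [true])) (P.length + 1)) ?_ ?_))⟩
    · simp [scans, scanned_setTape, tapeOf, digit, succDigits]
    · simp [scans, scanned_setTape, tapeOf, succDigits, Transducer.moveHead]
    · simp [scans, scanned_setTape, tapeOf, succDigits, Transducer.moveHead]
    · have h2 := update_tapeOf false true P []
      simp only [digit, if_true] at h2
      have := exec_onTape (I := I) (w := w) (m := m) (r := r) (h := P.length + 1 + 1)
        (g := fun c => (c, Move.left)) (t := tapeOf (P ++ [true])) hm hs (by simp at h'; omega)
      simpa [Transducer.moveHead, succDigits, h2] using this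
    · have := exec_onTape (I := I) (w := w) (m := m) (r := r) (h := P.length + 1)
        (g := fun _ => (blank, Move.stay)) (t := tapeOf (P ++ [true])) hm hs hP
      simpa [Transducer.moveHead, update_tapeOf_blank] using this
  | cons b L ih =>
    cases b with
    | false =>
      refine ⟨P.length + 1, hP, .seq (.loop_false ?_) (.ite_true ?_ ?_)⟩
      · simp [scans, scanned_setTape, tapeOf, digit, succDigits]
      · simp [scans, scanned_setTape, tapeOf, digit, succDigits]
      · have := exec_onTape (I := I) (w := w) (m := m) (r := r) (h := P.length + 1)
          (g := fun _ => (one, Move.stay)) (t := tapeOf (P ++ true :: L)) hm hs hP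
        have h2 : Function.update (tapeOf (P ++ true :: L)) (P.length + 1) one = _ :=
          update_tapeOf true false P L
        simpa [Transducer.moveHead, h2, succDigits] using this
    | true =>
      obtain ⟨h, hh, ih⟩ := ih (P ++ [true]) (by simp at h' ⊢; omega) (by simp at h' ⊢; omega)
      refine ⟨h, hh, ?_⟩
      cases ih with
      | @seq _ _ _ m' _ h1 h2 =>
        refine .seq (m' := m') (.loop_true ?_ (exec_onTape hm hs hP) ?_) ?_
        rotate_left 2
        · simpa [succDigits] using h2
        · simp [scans, scanned_setTape, tapeOf, digit, succDigits]
        · have := update_tapeOf false true P (succDigits L)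
          simp only [digit, if_true] at this
          simpa [Transducer.moveHead, this, succDigits] using h1

theorem exec_decTape (hm : m.inputHead ≤ w.length + 1) (hs : ∀ i, m.head i < s)
    (L : List Bool) (h' : L.length + 2 < s) :
    Exec w s (decTape r) (m.setTape r (tapeOf (succDigits L)) 1) (m.setTape r (tapeOf L) 1) := by
  obtain ⟨h, hh, h1⟩ := exec_decTape_aux (O := O) (r := r) hm hs L [] (by simpa using h')
  exact .seq h1 (exec_rewindTape hm hs _ _ hh)

end

/-! ### Register programs -/

/-- The position of the input head, the values of the registers and the output. -/
structure Regs (O : Type) (k : ℕ) : Type where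
  pos : ℕ
  val : Fin k → ℕ
  out : List O

/-- The memory in which every tape holds the numeral of its register. -/
def Regs.mem (σ : Regs O k) : Mem O Cell k :=
  ⟨σ.pos, fun i => tapeOf (digits (σ.val i)), fun _ => 1, σ.out⟩

/-- The number of tape cells for numerals up to `n + 1`. -/
def space (n : ℕ) : ℕ := Nat.log 2 (n + 2) + 4

/-- The program `p` transforms `σ` into `τ`. -/
def Runs (w : List I) (p : Prog I O Cell k) (σ τ : Regs O k) : Prop :=
  Exec w (space w.length) p σ.mem τ.mem

/-- Movement of the input head and output. -/
def io (d : Move) (l : List O) : Prog I O Cell k := act fun _ a => (d, fun i => (a i, Move.stay), l)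

def reads (t : InputCell I → Bool) : InputCell I → (Fin k → Cell) → Bool := fun c _ => t c

def nonzero (r : Fin k) : InputCell I → (Fin k → Cell) → Bool := scans r fun c => decide (c ≠ blank)

section
variable {w : List I} {v : Fin k → ℕ} {r : Fin k} {o : List O} {h : ℕ} {σ τ υ : Regs O k}

theorem Runs.io {d : Move} {l : List O} : Runs w (io d l) ⟨h, v, o⟩
    ⟨min (Transducer.moveHead d h) (w.length + 1), v, o ++ l⟩ := by
  have := Exec.act (I := I) (w := w) (s := space w.length) (m := Regs.mem ⟨h, v, o⟩)
    (f := fun _ a => (d, fun i => (a i, Move.stay), l)) (fun i => by simp [Regs.mem, space])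
  simpa [Runs, Prog.io, Mem.apply, Regs.mem, Mem.scanned, Transducer.moveHead] using this

theorem Runs.left (hh : h ≤ w.length) : Runs w (Prog.io Move.left []) ⟨h + 1, v, o⟩ ⟨h, v, o⟩ := by
  have := Runs.io (w := w) (d := Move.left) (l := []) (h := h + 1) (v := v) (o := o)
  simpa [Transducer.moveHead, Nat.min_eq_left (Nat.le_succ_of_le hh)] using this

theorem Runs.right (hh : h ≤ w.length) : Runs w (Prog.io Move.right []) ⟨h, v, o⟩ ⟨h + 1, v, o⟩ := by
  have := Runs.io (w := w) (d := Move.right) (l := []) (h := h) (v := v) (o := o)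
  simpa [Transducer.moveHead, hh] using this

theorem Runs.write {l : List O} (hh : h ≤ w.length + 1) :
    Runs w (Prog.io Move.stay l) ⟨h, v, o⟩ ⟨h, v, o ++ l⟩ := by
  have := Runs.io (w := w) (d := Move.stay) (l := l) (h := h) (v := v) (o := o)
  simpa [Transducer.moveHead, hh] using this

theorem mem_setTape (n : ℕ) : Regs.mem ⟨h, Function.update v r n, o⟩ =
    (Regs.mem ⟨h, v, o⟩).setTape r (tapeOf (digits n)) 1 := by
  simp only [Regs.mem, Mem.setTape, Mem.mk.injEq, true_and, and_true]
  constructor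
  · funext i
    by_cases hi : i = r
    · subst hi; simp
    · simp [hi]
  · simp

theorem length_digits_lt {n a : ℕ} (ha : a ≤ n) : (digits a).length + 2 < space n := by
  have h1 := length_digits_le a
  have h2 : Nat.log 2 (a + 1) ≤ Nat.log 2 (n + 2) := Nat.log_mono_right (by omega)
  simp only [space]
  omega

theorem Runs.inc (hh : h ≤ w.length + 1) (hv : v r ≤ w.length) :
    Runs w (incTape r) ⟨h, v, o⟩ ⟨h, Function.update v r (v r + 1), o⟩ := by
  have := length_digits_lt hv
  have h1 := exec_incTape (w := w) (m := Regs.mem ⟨h, v, o⟩) (r := r) (s := space w.length) hh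
    (fun i => by simp [Regs.mem, space]) (digits (v r)) (by omega)
  rw [← digits_succ, ← mem_setTape, ← mem_setTape, Function.update_eq_self] at h1
  exact h1

theorem Runs.dec (hh : h ≤ w.length + 1) {a : ℕ} (ha : v r = a + 1) (hv : a ≤ w.length) :
    Runs w (decTape r) ⟨h, v, o⟩ ⟨h, Function.update v r a, o⟩ := by
  have h1 := exec_decTape (w := w) (m := Regs.mem ⟨h, v, o⟩) (r := r) (s := space w.length) hh
    (fun i => by simp [Regs.mem, space]) (digits a) (length_digits_lt hv)
  rw [← digits_succ, ← mem_setTape, ← mem_setTape, ← ha, Function.update_eq_self] at h1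
  exact h1

theorem Runs.seq {p q : Prog I O Cell k} (h1 : Runs w p σ τ) (h2 : Runs w q τ υ) :
    Runs w (seq p q) σ υ := Exec.seq h1 h2

/-- In bijective numeration only zero has the empty numeral, so inspecting the least significant
cell decides whether a register is zero. -/
theorem nonzero_mem (c : InputCell I) : nonzero r c σ.mem.scanned = decide (σ.val r ≠ 0) := by
  have h : tapeOf (digits (σ.val r)) 1 ≠ blank ↔ σ.val r ≠ 0 := by
    rw [Ne, Ne, ← digits_eq_nil_iff (n := σ.val r), not_iff_not]
    cases digits (σ.val r) with
    | nil => simp [tapeOf]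
    | cons b L => cases b <;> simp [tapeOf, digit]
  exact decide_eq_decide.2 h

theorem Runs.ite {t : InputCell I → Bool} {p q : Prog I O Cell k}
    (hp : t (Transducer.inputCell w σ.pos) = true → Runs w p σ τ)
    (hq : t (Transducer.inputCell w σ.pos) = false → Runs w q σ τ) :
    Runs w (ite (reads t) p q) σ τ := by
  by_cases ht : t (Transducer.inputCell w σ.pos) = true
  · exact Exec.ite_true ht (hp ht)
  · exact Exec.ite_false (Bool.eq_false_iff.2 ht) (hq (Bool.eq_false_iff.2 ht))

theorem Runs.ite_nonzero {p q : Prog I O Cell k} (hp : σ.val r ≠ 0 → Runs w p σ τ)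
    (hq : σ.val r = 0 → Runs w q σ τ) : Runs w (Prog.ite (nonzero r) p q) σ τ := by
  by_cases ht : σ.val r = 0
  · exact Exec.ite_false (by simp [nonzero_mem, ht]) (hq ht)
  · exact Exec.ite_true (by simp [nonzero_mem, ht]) (hp ht)

theorem Runs.loop {t : InputCell I → (Fin k → Cell) → Bool} {p : Prog I O Cell k}
    (S : ℕ → Regs O k) (N : ℕ)
    (h1 : ∀ i < N, t (Transducer.inputCell w (S i).pos) (S i).mem.scanned = true ∧
      Runs w p (S i) (S (i + 1)))
    (h2 : t (Transducer.inputCell w (S N).pos) (S N).mem.scanned = false) :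
    Runs w (Prog.loop t p) (S 0) (S N) := by
  -- Induction on the number `j` of rounds that remain.
  have key : ∀ j ≤ N, Runs w (Prog.loop t p) (S (N - j)) (S N) := by
    intro j
    induction j with
    | zero => exact fun _ => Exec.loop_false h2
    | succ j ih =>
      intro hj
      obtain ⟨h3, h4⟩ := h1 (N - (j + 1)) (by omega)
      refine Exec.loop_true h3 h4 ?_
      have : N - (j + 1) + 1 = N - j := by omega
      rw [this]
      exact ih (by omega)
  simpa using key N le_rfl

theorem Runs.loop_nonzero {p : Prog I O Cell k} (S : ℕ → Regs O k) (N : ℕ)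
    (h1 : ∀ i < N, (S i).val r ≠ 0 ∧ Runs w p (S i) (S (i + 1))) (h2 : (S N).val r = 0) :
    Runs w (Prog.loop (nonzero r) p) (S 0) (S N) :=
  Runs.loop S N (fun i hi => ⟨by simp [nonzero_mem, (h1 i hi).1], (h1 i hi).2⟩)
    (by simp [nonzero_mem, h2])

end

/-- Write the markers. -/
def setup : Prog I O Cell k := act fun _ _ => (Move.stay, fun _ => (mark, Move.right), [])

theorem Runs.machine {w : List I} {p : Prog I O Cell k} {τ : Regs O k}
    (h : Runs w p ⟨0, fun _ => 0, []⟩ τ) :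
    ((Prog.seq setup p).machine blank).HaltsWith w τ.out ∧
      ((Prog.seq setup p).machine blank).UsesSpace w (space w.length) := by
  have h0 : Exec w (space w.length) (setup : Prog I O Cell k) (initMem blank)
      (Regs.mem ⟨0, fun _ => 0, []⟩) := by
    have := Exec.act (I := I) (w := w) (s := space w.length) (m := (initMem blank : Mem O Cell k))
      (f := fun _ _ => (Move.stay, fun _ => (mark, Move.right), [])) (fun i => by simp [initMem, space])
    have h2 : Function.update (fun _ => blank) 0 mark = tapeOf (digits 0) := by
      funext i
      rcases i with _ | i <;> simp [tapeOf, digits]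
    simpa [setup, Mem.apply, initMem, Regs.mem, Transducer.moveHead, h2] using this
  exact (Exec.seq h0 h).machine (fun i => by simp [Regs.mem, space])

/-- For `n ≥ 2` one has `n + 2 ≤ 2 * n`, which costs one in the logarithm; the two smaller values
are computed. -/
theorem space_le (n : ℕ) : space n ≤ 6 * Nat.log 2 n + 6 := by
  simp only [space]
  rcases Nat.lt_or_ge n 2 with hn | hn
  · interval_cases n
    · have : Nat.log 2 2 ≤ 1 := Nat.lt_succ_iff.1 (Nat.log_lt_of_lt_pow (by norm_num) (by norm_num))
      simp only [zero_add]
      omega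
    · have : Nat.log 2 3 ≤ 1 := Nat.lt_succ_iff.1 (Nat.log_lt_of_lt_pow (by norm_num) (by norm_num))
      simp only [Nat.reduceAdd]
      omega
  · have h1 : Nat.log 2 (n + 2) ≤ Nat.log 2 (n * 2) := Nat.log_mono_right (by omega)
    rw [Nat.log_mul_base (by norm_num) (by omega)] at h1
    omega

end Prog

end LogSpace

/-! ### Auxiliary register programs -/

namespace LogSpace

namespace InputCell

variable {I : Type}

def isLeftEnd : InputCell I → Bool
  | leftEnd => true
  | _ => false

def isRightEnd : InputCell I → Bool
  | rightEnd => true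
  | _ => false

/-- The cell holds a letter with the property `P`. -/
def holds (P : I → Bool) : InputCell I → Bool
  | sym a => P a
  | _ => false

end InputCell

namespace Transducer

variable {I : Type} {w ts : List I} {t : I} {b : ℕ}

theorem inputCell_of_drop_eq_cons (h : w.drop b = t :: ts) :
    inputCell w (b + 1) = InputCell.sym t := by
  have h2 : w[b]? = some t := by
    have := congrArg List.head? h
    simpa [List.head?_drop] using this
  simp [inputCell, h2]

theorem inputCell_of_drop_eq_nil (h : w.drop b = []) : inputCell w (b + 1) = InputCell.rightEnd := by
  have h2 : w[b]? = none := by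
    have := congrArg List.head? h
    simpa [List.head?_drop] using this
  simp [inputCell, h2]

theorem isLeftEnd_inputCell_succ (w : List I) (b : ℕ) : (inputCell w (b + 1)).isLeftEnd = false := by
  simp only [inputCell]
  cases w[b]? <;> rfl

end Transducer

theorem _root_.List.drop_succ_of_drop_eq_cons {α : Type*} {w ts : List α} {t : α} {b : ℕ}
    (h : w.drop b = t :: ts) : w.drop (b + 1) = ts := by
  rw [← List.drop_drop, h]; rfl

theorem _root_.List.length_eq_of_drop_eq_cons {α : Type*} {w ts : List α} {t : α} {b : ℕ}
    (h : w.drop b = t :: ts) : w.length = b + ts.length + 1 := by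
  have := congrArg List.length h
  simp at this
  omega

namespace Prog

variable {I O : Type} {k : ℕ}

def nop : Prog I O Cell k := io Move.stay []

/-- Repeat `p` as often as the register `r` says; `t` is used to restore `r`. -/
def repeatReg (t r : Fin k) (p : Prog I O Cell k) : Prog I O Cell k :=
  seq (loop (nonzero r) (seq (decTape r) (seq (incTape t) p)))
    (loop (nonzero t) (seq (decTape t) (incTape r)))

/-- Move the input head to the right by the value of the register `r`. -/
def advance (t r : Fin k) : Prog I O Cell k := repeatReg t r (io Move.right [])

def toLeftEnd : Prog I O Cell k := loop (reads fun c => !c.isLeftEnd) (io Move.left [])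

def clear (r : Fin k) : Prog I O Cell k := loop (nonzero r) (decTape r)

/-- Store the position of the input head in the register `r`, which has to be `0`. -/
def save (t r : Fin k) : Prog I O Cell k :=
  seq (loop (reads fun c => !c.isLeftEnd) (seq (incTape r) (io Move.left []))) (advance t r)

variable {w : List I} {v : Fin k → ℕ} {r t : Fin k} {o : List O} {h : ℕ} {σ τ υ : Regs O k}

theorem Runs.nop (hh : h ≤ w.length + 1) : Runs w nop (⟨h, v, o⟩ : Regs O k) ⟨h, v, o⟩ := by
  simpa [Prog.nop] using Runs.write (O := O) (w := w) (v := v) (o := o) (l := []) hh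

theorem Runs.loop_step {c : InputCell I → Bool} {p : Prog I O Cell k}
    (h1 : c (Transducer.inputCell w σ.pos) = true) (h2 : Runs w p σ τ)
    (h3 : Runs w (Prog.loop (reads c) p) τ υ) : Runs w (Prog.loop (reads c) p) σ υ :=
  Exec.loop_true h1 h2 h3

theorem Runs.loop_done {c : InputCell I → Bool} {p : Prog I O Cell k}
    (h1 : c (Transducer.inputCell w σ.pos) = false) : Runs w (Prog.loop (reads c) p) σ σ :=
  Exec.loop_false h1

theorem Runs.loop_nonzero_step {p : Prog I O Cell k} (h1 : σ.val r ≠ 0) (h2 : Runs w p σ τ)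
    (h3 : Runs w (Prog.loop (nonzero r) p) τ υ) : Runs w (Prog.loop (nonzero r) p) σ υ :=
  Exec.loop_true (by simp [nonzero_mem, h1]) h2 h3

theorem Runs.loop_nonzero_done {p : Prog I O Cell k} (h1 : σ.val r = 0) :
    Runs w (Prog.loop (nonzero r) p) σ σ :=
  Exec.loop_false (by simp [nonzero_mem, h1])

/-- After `i` rounds the register `r` holds `v r - i` and `t` holds `i`; the second loop pours `t`
back into `r`. The functions `H` and `Q` give the input head and the output after each round. The
body is required to work for all register contents, because it runs while `r` and `t` are altered.
-/
theorem Runs.repeatReg {p : Prog I O Cell k} (H : ℕ → ℕ) (Q : ℕ → List O) (hrt : r ≠ t)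
    (ht : v t = 0) (hv : v r ≤ w.length + 1) (hH : ∀ i ≤ v r, H i ≤ w.length + 1)
    (hp : ∀ i < v r, ∀ v', Runs w p (⟨H i, v', Q i⟩ : Regs O k) ⟨H (i + 1), v', Q (i + 1)⟩) :
    Runs w (repeatReg t r p) ⟨H 0, v, Q 0⟩ ⟨H (v r), v, Q (v r)⟩ := by
  have e1 : v = Function.update (Function.update v r (v r - 0)) t 0 := by
    rw [Nat.sub_zero, Function.update_eq_self, ← ht, Function.update_eq_self]
  have e2 : Function.update (Function.update v r (v r - v r)) t (v r) =
      Function.update (Function.update v r 0) t (v r - 0) := by simp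
  have e3 : Function.update (Function.update v r (v r)) t (v r - v r) = v := by
    rw [Nat.sub_self, Function.update_eq_self, ← ht, Function.update_eq_self]
  have h1 := Runs.loop_nonzero (w := w) (r := r) (p := Prog.seq (decTape r) (Prog.seq (incTape t) p))
    (fun i => ⟨H i, Function.update (Function.update v r (v r - i)) t i, Q i⟩) (v r)
    (fun i hi => by
      have hHi := hH i hi.le
      refine ⟨by simp [hrt]; omega, ?_⟩
      refine Runs.seq (Runs.dec (a := v r - (i + 1)) hHi (by simp [hrt]; omega) (by omega)) ?_
      refine Runs.seq (Runs.inc hHi (by simp [hrt.symm]; omega)) ?_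
      have := hp i hi (Function.update (Function.update v r (v r - (i + 1))) t (i + 1))
      convert this using 2
      funext j
      by_cases hj : j = t
      · subst hj; simp [hrt.symm]
      · by_cases hj' : j = r
        · subst hj'; simp [hrt]
        · simp [hj, hj'])
    (by simp [hrt])
  have h2 := Runs.loop_nonzero (w := w) (r := t) (p := Prog.seq (decTape t) (incTape r))
    (fun i => ⟨H (v r), Function.update (Function.update v r i) t (v r - i), Q (v r)⟩) (v r)
    (fun i hi => by
      have hHi := hH _ le_rfl
      refine ⟨by simp; omega, ?_⟩
      refine Runs.seq (Runs.dec (a := v r - (i + 1)) hHi (by simp; omega) (by omega)) ?_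
      have := Runs.inc (O := O) (w := w) (h := H (v r)) (o := Q (v r)) (r := r)
        (v := Function.update (Function.update (Function.update v r i) t (v r - i)) t
          (v r - (i + 1))) hHi (by simp [hrt]; omega)
      convert this using 2
      funext j
      by_cases hj : j = t
      · subst hj; simp [hrt.symm]
      · by_cases hj' : j = r
        · subst hj'; simp [hrt]
        · simp [hj, hj'])
    (by simp)
  simp only [← e1] at h1
  simp only [e3] at h2
  refine Runs.seq h1 ?_
  rw [e2]
  exact h2

theorem Runs.advance (hrt : r ≠ t) (ht : v t = 0) (hv : h + v r ≤ w.length + 1) :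
    Runs w (advance t r) (⟨h, v, o⟩ : Regs O k) ⟨h + v r, v, o⟩ :=
  Runs.repeatReg (fun i => h + i) (fun _ => o) hrt ht (by omega) (fun i hi => by omega)
    fun i hi v' => Runs.right (by omega)

theorem Runs.printReg {a : O} (hrt : r ≠ t) (ht : v t = 0) (hv : v r ≤ w.length + 1)
    (hh : h ≤ w.length + 1) :
    Runs w (Prog.repeatReg t r (Prog.io Move.stay [a])) (⟨h, v, o⟩ : Regs O k)
      ⟨h, v, o ++ List.replicate (v r) a⟩ := by
  have := Runs.repeatReg (w := w) (v := v) (p := Prog.io Move.stay [a]) (fun _ => h)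
    (fun i => o ++ List.replicate i a) hrt ht hv
    (fun i hi => hh) fun i hi v' => by
      simpa [List.replicate_succ'] using
        Runs.write (w := w) (v := v') (l := [a]) (o := o ++ List.replicate i a) hh
  simpa using this

theorem Runs.toLeftEnd (hh : h ≤ w.length + 1) :
    Runs w toLeftEnd (⟨h, v, o⟩ : Regs O k) ⟨0, v, o⟩ := by
  induction h with
  | zero => exact Runs.loop_done rfl
  | succ h ih =>
    exact Runs.loop_step (by simp [Transducer.isLeftEnd_inputCell_succ])
      (Runs.left (by omega)) (ih (by omega))

theorem Runs.clear (hh : h ≤ w.length + 1) (hv : v r ≤ w.length + 1) :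
    Runs w (clear r) (⟨h, v, o⟩ : Regs O k) ⟨h, Function.update v r 0, o⟩ := by
  obtain ⟨n, hn⟩ : ∃ n, n = v r := ⟨_, rfl⟩
  induction n generalizing v with
  | zero =>
    have : Function.update v r 0 = v := by rw [hn, Function.update_eq_self]
    rw [this]
    exact Runs.loop_nonzero_done hn.symm
  | succ n ih =>
    have := ih (v := Function.update v r n) (by simp; omega) (by simp)
    rw [Function.update_idem] at this
    exact Runs.loop_nonzero_step (by show v r ≠ 0; omega) (Runs.dec hh hn.symm (by omega)) this

/-- The register counts the steps to the left end marker, and moving right by its value restores the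
head. -/
theorem Runs.save (hrt : r ≠ t) (ht : v t = 0) (hr : v r = 0) (hh : h ≤ w.length + 1) :
    Runs w (save t r) (⟨h, v, o⟩ : Regs O k) ⟨h, Function.update v r h, o⟩ := by
  -- The current head position plus the number of steps already counted is always `h`.
  have h1 : ∀ j i, i + j = h → Runs w
      (Prog.loop (reads fun c => !c.isLeftEnd) (Prog.seq (incTape r) (Prog.io Move.left [])))
      (⟨i, Function.update v r j, o⟩ : Regs O k) ⟨0, Function.update v r h, o⟩ := by
    intro j i
    induction i generalizing j with
    | zero => rintro rfl; rw [zero_add]; exact Runs.loop_done rfl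
    | succ i ih =>
      intro hj
      refine Runs.loop_step (by simp [Transducer.isLeftEnd_inputCell_succ])
        (Runs.seq (Runs.inc (by omega) (by simp; omega)) (Runs.left (by omega))) ?_
      simpa using ih (j + 1) (by omega)
  have h2 := h1 0 h rfl
  have e : Function.update v r 0 = v := by rw [← hr, Function.update_eq_self]
  rw [e] at h2
  refine Runs.seq h2 ?_
  have h3 := Runs.advance (O := O) (w := w) (h := 0) (v := Function.update v r h) (o := o) hrt
    (by simp [hrt.symm, ht]) (by simpa using hh)
  simpa using h3

end Prog

end LogSpace

/-! ## The reduction as a function on words, and a program for it -/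

namespace SVASReduction

open LogSpace LogSpace.Prog

/-- Each line contains exactly one such token, so the number of a line is the number of such tokens
in the lines before it. This lets a program number the lines by scanning. -/
def isCommand : StackVAS.Token → Bool
  | .inc | .dec | .push | .pop | .goto | .halt => true
  | _ => false

/-- Two words begin with the code of the same name. -/
def sameName : List StackVAS.Token → List StackVAS.Token → Bool
  | .bit b :: x, .bit c :: y => b == c && sameName x y
  | .fin :: _, .fin :: _ => true
  | _, _ => false

/-- The word behind the first terminator. -/
def skipName (x : List StackVAS.Token) : List StackVAS.Token :=
  (x.dropWhile fun t => decide (t ≠ .fin)).tail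

/-- The code of the disjuncts for the positions of the token `k` followed by the name at the
beginning of `x`. -/
def occurrences (k : StackVAS.Token) (x : List StackVAS.Token) :
    ℕ → List StackVAS.Token → List LeafData.Token
  | _, [] => []
  | j, t :: y =>
    (if t = k ∧ sameName x y = true then
      [.or, .letter, .var .y] ++ List.replicate j .tally ++ [.fin] else []) ++
    occurrences k x (if isCommand t then j + 1 else j) y

/-- The pieces from which the code of a clause is composed. -/
inductive Piece : Type
  /-- a fixed word -/
  | text (l : List LeafData.Token)
  /-- the number of the current command in unary -/
  | index
  /-- the positions of the given token with the current name -/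
  | names (k : StackVAS.Token)
  /-- proceed to the next name -/
  | skip

/-- Here `w` is the whole input, which is scanned for occurrences, while the list argument is the
part of the input from the current name on. -/
def pieceCode (w : List StackVAS.Token) (i : ℕ) :
    List StackVAS.Token → List Piece → List LeafData.Token
  | _, [] => []
  | x, .text l :: ps => l ++ pieceCode w i x ps
  | x, .index :: ps => List.replicate i .tally ++ pieceCode w i x ps
  | x, .names k :: ps => occurrences k x 0 w ++ pieceCode w i x ps
  | x, .skip :: ps => pieceCode w i (skipName x) ps

/-- The code of the clauses for all commands, given the pieces for each type of commands. -/
def clausesCode (C : StackVAS.Token → List Piece) (w : List StackVAS.Token) :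
    ℕ → List StackVAS.Token → List LeafData.Token
  | _, [] => []
  | i, t :: x => if isCommand t then pieceCode w i x (C t) ++ clausesCode C w (i + 1) x
    else clausesCode C w i x

/-! ### The program -/

abbrev Program : Type := Prog StackVAS.Token LeafData.Token Cell 9

/-- The values of the registers: the position and the number of the current command, the position
of the current name, the position of another name, the number of another command, the position in
the names, and two flags. Another register is used for temporary values. -/
def regs (p i a b j q f g : ℕ) : Fin 9 → ℕ := ![p, i, a, b, j, q, f, g, 0]

section
variable (p i a b j q f g n : ℕ)
@[simp] theorem regs_0 : regs p i a b j q f g 0 = p := rfl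
@[simp] theorem regs_1 : regs p i a b j q f g 1 = i := rfl
@[simp] theorem regs_2 : regs p i a b j q f g 2 = a := rfl
@[simp] theorem regs_3 : regs p i a b j q f g 3 = b := rfl
@[simp] theorem regs_4 : regs p i a b j q f g 4 = j := rfl
@[simp] theorem regs_5 : regs p i a b j q f g 5 = q := rfl
@[simp] theorem regs_6 : regs p i a b j q f g 6 = f := rfl
@[simp] theorem regs_7 : regs p i a b j q f g 7 = g := rfl
@[simp] theorem regs_8 : regs p i a b j q f g 8 = 0 := rfl
@[simp] theorem update_regs_0 :
    Function.update (regs p i a b j q f g) 0 n = regs n i a b j q f g := by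
  funext r; fin_cases r <;> rfl
@[simp] theorem update_regs_1 :
    Function.update (regs p i a b j q f g) 1 n = regs p n a b j q f g := by
  funext r; fin_cases r <;> rfl
@[simp] theorem update_regs_2 :
    Function.update (regs p i a b j q f g) 2 n = regs p i n b j q f g := by
  funext r; fin_cases r <;> rfl
@[simp] theorem update_regs_3 :
    Function.update (regs p i a b j q f g) 3 n = regs p i a n j q f g := by
  funext r; fin_cases r <;> rfl
@[simp] theorem update_regs_4 :
    Function.update (regs p i a b j q f g) 4 n = regs p i a b n q f g := by
  funext r; fin_cases r <;> rfl
@[simp] theorem update_regs_5 :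
    Function.update (regs p i a b j q f g) 5 n = regs p i a b j n f g := by
  funext r; fin_cases r <;> rfl
@[simp] theorem update_regs_6 :
    Function.update (regs p i a b j q f g) 6 n = regs p i a b j q n g := by
  funext r; fin_cases r <;> rfl
@[simp] theorem update_regs_7 :
    Function.update (regs p i a b j q f g) 7 n = regs p i a b j q f n := by
  funext r; fin_cases r <;> rfl
end

/-- The input head is on the token `t`. -/
def onToken (t : StackVAS.Token) : InputCell StackVAS.Token → Bool :=
  InputCell.holds fun u => decide (u = t)

/-- Inspect the other name at the current position. -/
def probe (t : StackVAS.Token) (u : Program) : Program :=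
  seq toLeftEnd <| seq (advance 8 3) <| seq (advance 8 5) <|
    ite (reads (onToken t)) u (decTape 7)

/-- Registers 2 and 3 hold the positions of the two names and register 5 the common offset. Register
7 keeps the comparison going and is cleared at a mismatch or at the end; register 6 records that
both names ended together. -/
def compareStep : Program :=
  seq (advance 8 2) <| seq (advance 8 5) <|
    seq (ite (reads (onToken (.bit true))) (probe (.bit true) (incTape 5)) <|
      ite (reads (onToken (.bit false))) (probe (.bit false) (incTape 5)) <|
      ite (reads (onToken .fin)) (probe .fin (seq (incTape 6) (decTape 7))) (decTape 7))
    toLeftEnd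

/-- Compare the current name with the name at the input head. -/
def compareNames : Program :=
  seq (save 8 3) <| seq toLeftEnd <| seq (incTape 7) <| seq (loop (nonzero 7) compareStep) <|
    seq (clear 5) <| seq (advance 8 3) <| clear 3

section
variable {w x y : List StackVAS.Token} {p i a b j q f g h h' n : ℕ} {o : List LeafData.Token}
  {t : StackVAS.Token} {v v' : Fin 9 → ℕ}

theorem onToken_cons (hx : w.drop a = t :: x) (u : StackVAS.Token) :
    onToken u (Transducer.inputCell w (a + 1)) = decide (t = u) := by
  rw [Transducer.inputCell_of_drop_eq_cons hx]; rfl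

theorem onToken_nil (hx : w.drop a = []) (u : StackVAS.Token) :
    onToken u (Transducer.inputCell w (a + 1)) = false := by
  rw [Transducer.inputCell_of_drop_eq_nil hx]; rfl

theorem runs_ite_true {k : ℕ} {I O : Type} {w : List I} {c : InputCell I → Bool}
    {P Q : Prog I O Cell k} {σ τ : Regs O k}
    (h1 : c (Transducer.inputCell w σ.pos) = true) (h2 : Runs w P σ τ) :
    Runs w (ite (reads c) P Q) σ τ := Exec.ite_true h1 h2

theorem runs_ite_false {k : ℕ} {I O : Type} {w : List I} {c : InputCell I → Bool}
    {P Q : Prog I O Cell k} {σ τ : Regs O k}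
    (h1 : c (Transducer.inputCell w σ.pos) = false) (h2 : Runs w Q σ τ) :
    Runs w (ite (reads c) P Q) σ τ := Exec.ite_false h1 h2

theorem runs_dec_flag (hh : h ≤ w.length + 1) :
    Runs w (decTape 7) (⟨h, regs p i a b j q f 1, o⟩ : Regs LeafData.Token 9)
      ⟨h, regs p i a b j q f 0, o⟩ := by
  simpa using Runs.dec (O := LeafData.Token) (w := w) (v := regs p i a b j q f 1) (r := 7) (o := o)
    (a := 0) hh rfl (Nat.zero_le _)

theorem runs_probe (u : Program) (hh : h ≤ w.length + 1) (hb : b + q ≤ w.length)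
    (hu : Runs w (ite (reads (onToken t)) u (decTape 7))
      ⟨b + q + 1, regs p i a (b + 1) j q f g, o⟩ ⟨h', v', o⟩) :
    Runs w (probe t u) ⟨h, regs p i a (b + 1) j q f g, o⟩ ⟨h', v', o⟩ := by
  refine (Runs.toLeftEnd hh).seq <| (Runs.advance (by decide) rfl ?_).seq <|
    (Runs.advance (by decide) rfl ?_).seq ?_
  · simp ; omega
  · simp ; omega
  · convert hu using 2
    simp ; omega

/-- Induction on the word `x` behind the current offset. The final offset is only bounded, which
suffices for clearing it. Positions are shifted by one, since cell `0` of the input tape is the left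
end marker. -/
theorem runs_compareStep_loop (hx : w.drop (a + q) = x) (hy : w.drop (b + q) = y)
    (ha : a + q ≤ w.length) (hb : b + q ≤ w.length) : ∃ q' ≤ w.length,
    Runs w (loop (nonzero 7) compareStep)
      ⟨0, regs p i (a + 1) (b + 1) j q 0 1, o⟩
      ⟨0, regs p i (a + 1) (b + 1) j q' (if sameName x y = true then 1 else 0) 0, o⟩ := by
  -- The navigation common to all cases: from the left end to the current letter of the first name,
  -- and back to the left end after the branching.
  have start : ∀ (q h' : ℕ) (v' : Fin 9 → ℕ), a + q ≤ w.length → h' ≤ w.length + 1 → Runs w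
      (ite (reads (onToken (.bit true))) (probe (.bit true) (incTape 5)) <|
      ite (reads (onToken (.bit false))) (probe (.bit false) (incTape 5)) <|
      ite (reads (onToken .fin)) (probe .fin (seq (incTape 6) (decTape 7))) (decTape 7))
      ⟨a + q + 1, regs p i (a + 1) (b + 1) j q 0 1, o⟩ ⟨h', v', o⟩ →
      Runs w compareStep ⟨0, regs p i (a + 1) (b + 1) j q 0 1, o⟩ ⟨0, v', o⟩ := by
    intro q h' v' ha hh' hr
    refine (Runs.advance (by decide) rfl ?_).seq <|
      (Runs.advance (by decide) rfl ?_).seq <| Runs.seq ?_ (Runs.toLeftEnd hh')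
    · simp ; omega
    · simp ; omega
    · convert hr using 2
      simp ; omega
  have exitLoop : ∀ q, Runs w (loop (nonzero 7) compareStep)
      (⟨0, regs p i (a + 1) (b + 1) j q 0 0, o⟩ : Regs LeafData.Token 9)
      ⟨0, regs p i (a + 1) (b + 1) j q 0 0, o⟩ := fun q => Runs.loop_nonzero_done rfl
  induction x generalizing q y with
  | nil =>
    refine ⟨q, by omega, ?_⟩
    have h2 : sameName [] y = false := by simp [sameName]
    rw [h2]
    refine Runs.loop_nonzero_step one_ne_zero (start q (a + q + 1) (regs p i (a + 1) (b + 1) j q 0 0) ha (by omega) ?_) (exitLoop q)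
    exact runs_ite_false (onToken_nil hx _) <| runs_ite_false (onToken_nil hx _) <|
      runs_ite_false (onToken_nil hx _) <| runs_dec_flag (by omega)
  | cons t x ih =>
    have hax := List.length_eq_of_drop_eq_cons hx
    -- the effect of a probe that fails
    have fail : ∀ u P, onToken u (Transducer.inputCell w (b + q + 1)) = false →
        Runs w (probe u P) ⟨a + q + 1, regs p i (a + 1) (b + 1) j q 0 1, o⟩
          ⟨b + q + 1, regs p i (a + 1) (b + 1) j q 0 0, o⟩ := by
      intro u P hu
      exact runs_probe P (by omega) hb (runs_ite_false hu (runs_dec_flag (by omega)))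
    -- The two bits are treated alike: if the other name has the same bit the offset grows and the
    -- induction hypothesis applies, otherwise the flag is cleared.
    have bit : ∀ c, t = .bit c → (∀ h' v', h' ≤ w.length + 1 →
        Runs w (probe (.bit c) (incTape 5)) ⟨a + q + 1, regs p i (a + 1) (b + 1) j q 0 1, o⟩
          ⟨h', v', o⟩ →
        Runs w compareStep ⟨0, regs p i (a + 1) (b + 1) j q 0 1, o⟩ ⟨0, v', o⟩) →
        ∃ q' ≤ w.length, Runs w (loop (nonzero 7) compareStep)
          ⟨0, regs p i (a + 1) (b + 1) j q 0 1, o⟩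
          ⟨0, regs p i (a + 1) (b + 1) j q' (if sameName (t :: x) y = true then 1 else 0) 0, o⟩ := by
      rintro c rfl hr
      by_cases hc : ∃ y', y = .bit c :: y'
      · obtain ⟨y', rfl⟩ := hc
        have hby := List.length_eq_of_drop_eq_cons hy
        obtain ⟨q', hq', h3⟩ := ih (q := q + 1) (y := y') (List.drop_succ_of_drop_eq_cons hx)
          (List.drop_succ_of_drop_eq_cons hy) (by omega) (by omega)
        refine ⟨q', hq', ?_⟩
        have e : sameName (.bit c :: x) (.bit c :: y') = sameName x y' := by simp [sameName]
        rw [e]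
        refine Runs.loop_nonzero_step one_ne_zero (hr (b + q + 1)
          (regs p i (a + 1) (b + 1) j (q + 1) 0 1) (by omega)
          (runs_probe _ (by omega) hb (runs_ite_true ?_ ?_))) h3
        · simp [onToken_cons hy]
        · simpa  using Runs.inc (O := LeafData.Token) (w := w) (h := b + q + 1) (r := 5)
            (v := regs p i (a + 1) (b + 1) j q 0 1) (o := o) (by omega) (by simp ; omega)
      · refine ⟨q, by omega, ?_⟩
        have e : sameName (.bit c :: x) y = false ∧
            onToken (.bit c) (Transducer.inputCell w (b + q + 1)) = false := by
          cases y with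
          | nil => exact ⟨by simp [sameName], onToken_nil hy _⟩
          | cons u y =>
            have hu : u ≠ .bit c := fun h => hc ⟨y, by rw [h]⟩
            refine ⟨?_, by simp [onToken_cons hy, hu]⟩
            cases u <;> simp [sameName] at hu ⊢
            exact fun h => absurd h.symm hu
        rw [e.1]
        exact Runs.loop_nonzero_step one_ne_zero (hr (b + q + 1) _ (by omega) (fail _ _ e.2)) (exitLoop q)
    have other : t ≠ .bit true → t ≠ .bit false → t ≠ .fin →
        ∃ q' ≤ w.length, Runs w (loop (nonzero 7) compareStep)
          ⟨0, regs p i (a + 1) (b + 1) j q 0 1, o⟩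
          ⟨0, regs p i (a + 1) (b + 1) j q' (if sameName (t :: x) y = true then 1 else 0) 0, o⟩ := by
      intro h1 h2 h3
      refine ⟨q, by omega, ?_⟩
      have e : sameName (t :: x) y = false := by
        cases t with
        | bit c => cases c <;> simp at h1 h2
        | fin => simp at h3
        | _ => simp [sameName]
      rw [e]
      refine Runs.loop_nonzero_step one_ne_zero (start q (a + q + 1) (regs p i (a + 1) (b + 1) j q 0 0) ha (by omega) ?_) (exitLoop q)
      exact runs_ite_false (by simp [onToken_cons hx, h1]) <|
        runs_ite_false (by simp [onToken_cons hx, h2]) <|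
        runs_ite_false (by simp [onToken_cons hx, h3]) <| runs_dec_flag (by omega)
    cases t with
    | bit c =>
      cases c with
      | true =>
        exact bit true rfl fun h' v' hh' hr => start q h' v' ha hh'
          (runs_ite_true (by simp [onToken_cons hx]) hr)
      | false =>
        exact bit false rfl fun h' v' hh' hr => start q h' v' ha hh'
          (runs_ite_false (by simp [onToken_cons hx]) <|
            runs_ite_true (by simp [onToken_cons hx]) hr)
    | fin =>
      refine ⟨q, by omega, ?_⟩
      have hr : ∀ h' v', h' ≤ w.length + 1 →
          Runs w (probe .fin (seq (incTape 6) (decTape 7)))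
            ⟨a + q + 1, regs p i (a + 1) (b + 1) j q 0 1, o⟩ ⟨h', v', o⟩ →
          Runs w compareStep ⟨0, regs p i (a + 1) (b + 1) j q 0 1, o⟩ ⟨0, v', o⟩ :=
        fun h' v' hh' hr => start q h' v' ha hh'
          (runs_ite_false (by simp [onToken_cons hx]) <|
            runs_ite_false (by simp [onToken_cons hx]) <|
            runs_ite_true (by simp [onToken_cons hx]) hr)
      by_cases hc : ∃ y', y = .fin :: y'
      · obtain ⟨y', rfl⟩ := hc
        have e : sameName (.fin :: x) (.fin :: y') = true := by simp [sameName]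
        rw [e]
        refine Runs.loop_nonzero_step one_ne_zero (hr (b + q + 1)
          (regs p i (a + 1) (b + 1) j q 1 0) (by omega)
          (runs_probe _ (by omega) hb (runs_ite_true ?_ (Runs.seq ?_ (runs_dec_flag (by omega))))))
          (Runs.loop_nonzero_done rfl)
        · simp [onToken_cons hy]
        · simpa  using Runs.inc (O := LeafData.Token) (w := w) (h := b + q + 1) (r := 6)
            (v := regs p i (a + 1) (b + 1) j q 0 1) (o := o) (by omega) (by simp )
      · have e : sameName (.fin :: x) y = false ∧
            onToken .fin (Transducer.inputCell w (b + q + 1)) = false := by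
          cases y with
          | nil => exact ⟨by simp [sameName], onToken_nil hy _⟩
          | cons u y =>
            have hu : u ≠ .fin := fun h => hc ⟨y, by rw [h]⟩
            refine ⟨?_, by simp [onToken_cons hy, hu]⟩
            cases u <;> simp [sameName] at hu ⊢
        rw [e.1]
        exact Runs.loop_nonzero_step one_ne_zero (hr (b + q + 1) _ (by omega) (fail _ _ e.2)) (exitLoop q)
    | _ => exact other (by simp) (by simp) (by simp)

theorem runs_compareNames (ha : a ≤ w.length) (hb : b ≤ w.length) :
    Runs w compareNames ⟨b + 1, regs p i (a + 1) 0 j 0 0 0, o⟩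
      ⟨b + 1, regs p i (a + 1) 0 j 0 (if sameName (w.drop a) (w.drop b) = true then 1 else 0) 0, o⟩ := by
  obtain ⟨q, hq, h1⟩ := runs_compareStep_loop (w := w) (p := p) (i := i) (j := j) (o := o) (q := 0)
    (a := a) (b := b) rfl rfl ha hb
  refine (Runs.save (by decide) rfl rfl (by omega)).seq ?_
  rw [update_regs_3]
  refine (Runs.toLeftEnd (by omega)).seq <| Runs.seq
    (Runs.inc (O := LeafData.Token) (by omega) (by simp )) ?_
  rw [update_regs_7]
  refine h1.seq <| Runs.seq (Runs.clear (by omega) (by simp ; omega)) ?_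
  rw [update_regs_5]
  refine (Runs.advance (by decide) rfl (by simp ; omega)).seq ?_
  have := Runs.clear (O := LeafData.Token) (w := w) (h := b + 1) (r := 3) (o := o)
    (v := regs p i (a + 1) (b + 1) j 0 (if sameName (w.drop a) (w.drop b) = true then 1 else 0) 0)
    (by omega) (by simp ; omega)
  simpa  using this

end

end SVASReduction

/-! ### Programs that scan the input and print the sentence -/

namespace SVASReduction

open LogSpace LogSpace.Prog

/-- Print the disjunct with the number in register 4 if the flag is set. -/
def printMatch : Program :=
  ite (nonzero 6) (seq (io Move.stay [.or, .letter, .var .y]) <|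
    seq (repeatReg 8 4 (io Move.stay [.tally])) <| seq (io Move.stay [.fin]) (decTape 6)) nop

/-- Go on to the next token, counting commands in the register `r`. -/
def nextToken (r : Fin 9) : Program :=
  seq (ite (reads (InputCell.holds isCommand)) (incTape r) nop) (io Move.right [])

def printMatches (k : StackVAS.Token) : Program :=
  seq toLeftEnd <| seq (io Move.right []) <| seq
    (loop (reads fun c => !c.isRightEnd) <| seq
      (ite (reads (onToken k)) (seq (io Move.right []) <| seq compareNames <|
        seq (io Move.left []) printMatch) nop) (nextToken 4))
    (clear 4)

/-- Store the position of the next name. -/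
def nextName : Program :=
  seq toLeftEnd <| seq (advance 8 2) <| seq
    (loop (reads (InputCell.holds fun t => decide (t ≠ .fin))) (io Move.right [])) <|
    seq (io Move.right []) <| seq (clear 2) (save 8 2)

def printPiece : Piece → Program
  | .text l => io Move.stay l
  | .index => repeatReg 8 1 (io Move.stay [.tally])
  | .names k => printMatches k
  | .skip => nextName

def printPieces (ps : List Piece) : Program := ps.foldr (fun u P => seq (printPiece u) P) nop

/-- Print the clause of the command at the input head. -/
def printClause (ps : List Piece) : Program :=
  seq (save 8 0) <| seq (io Move.right []) <| seq (save 8 2) <| seq (printPieces ps) <|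
    seq (clear 2) <| seq toLeftEnd <| seq (advance 8 0) (clear 0)

/-- Branching on the token at the input head. -/
def dispatch (C : StackVAS.Token → Program) (l : List StackVAS.Token) : Program :=
  l.foldr (fun t P => ite (reads (onToken t)) (C t) P) nop

def printClauses (C : StackVAS.Token → List Piece) : Program :=
  loop (reads fun c => !c.isRightEnd) <|
    seq (dispatch (fun t => printClause (C t)) [.inc, .dec, .push, .pop, .goto, .halt]) (nextToken 1)

/-- Print the number of commands in unary. -/
def printCount : Program :=
  loop (reads fun c => !c.isRightEnd) <|
    seq (ite (reads (InputCell.holds isCommand)) (io Move.stay [.tally]) nop) (io Move.right [])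

/-- Print the number of commands, a fixed word, the clauses, another fixed word, and the number of
commands again. -/
def printSentence (C : StackVAS.Token → List Piece) (l l' : List LeafData.Token) : Program :=
  seq (io Move.right []) <| seq printCount <| seq (io Move.stay l) <| seq toLeftEnd <|
    seq (io Move.right []) <| seq (printClauses C) <| seq (io Move.stay l') <|
    seq (repeatReg 8 1 (io Move.stay [.tally])) (io Move.stay [.fin])

def sentenceCode (C : StackVAS.Token → List Piece) (l l' : List LeafData.Token)
    (w : List StackVAS.Token) : List LeafData.Token :=
  List.replicate (w.countP isCommand) .tally ++ l ++ clausesCode C w 0 w ++ l' ++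
    List.replicate (w.countP isCommand) .tally ++ [.fin]

section
variable {w x y : List StackVAS.Token} {p i a b j q f g h h' n : ℕ} {o : List LeafData.Token}
  {t : StackVAS.Token} {v v' : Fin 9 → ℕ}

theorem isRightEnd_cons (hx : w.drop a = t :: x) :
    (Transducer.inputCell w (a + 1)).isRightEnd = false := by
  rw [Transducer.inputCell_of_drop_eq_cons hx]; rfl

theorem isRightEnd_nil (hx : w.drop a = []) :
    (Transducer.inputCell w (a + 1)).isRightEnd = true := by
  rw [Transducer.inputCell_of_drop_eq_nil hx]; rfl

theorem holds_cons (hx : w.drop a = t :: x) (P : StackVAS.Token → Bool) :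
    (Transducer.inputCell w (a + 1)).holds P = P t := by
  rw [Transducer.inputCell_of_drop_eq_cons hx]; rfl

theorem holds_nil (hx : w.drop a = []) (P : StackVAS.Token → Bool) :
    (Transducer.inputCell w (a + 1)).holds P = false := by
  rw [Transducer.inputCell_of_drop_eq_nil hx]; rfl

theorem runs_printMatch (hj : j ≤ w.length) (hh : h ≤ w.length + 1) (c : Prop) [Decidable c] :
    Runs w printMatch ⟨h, regs p i a 0 j 0 (if c then 1 else 0) 0, o⟩
      ⟨h, regs p i a 0 j 0 0 0, o ++ if c then
        [.or, .letter, .var .y] ++ List.replicate j .tally ++ [.fin] else []⟩ := by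
  by_cases hc : c
  · simp only [hc, if_true]
    refine Runs.ite_nonzero (fun _ => ?_) (fun h => absurd h one_ne_zero)
    refine (Runs.write hh).seq <| (Runs.printReg (by decide) rfl (by simp; omega) hh).seq <|
      (Runs.write hh).seq ?_
    simpa using Runs.dec (O := LeafData.Token) (w := w) (v := regs p i a 0 j 0 1 0) (r := 6)
      (a := 0) hh rfl (Nat.zero_le _)
  · simp only [hc, if_false, List.append_nil]
    exact Runs.ite_nonzero (fun h => absurd rfl h) (fun _ => Runs.nop hh)

theorem runs_nextToken_4 (hx : w.drop b = t :: x) (hj : j ≤ b) :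
    Runs w (nextToken 4) ⟨b + 1, regs p i a 0 j 0 0 0, o⟩
      ⟨b + 1 + 1, regs p i a 0 (if isCommand t then j + 1 else j) 0 0 0, o⟩ := by
  have hb := List.length_eq_of_drop_eq_cons hx
  refine Runs.seq (Runs.ite (fun h => ?_) (fun h => ?_)) (Runs.right (by omega)) <;>
    rw [holds_cons hx] at h
  · rw [h]
    simpa using Runs.inc (O := LeafData.Token) (w := w) (h := b + 1) (r := 4)
      (v := regs p i a 0 j 0 0 0) (o := o) (by omega) (by simp; omega)
  · simp only [h]
    exact Runs.nop (by omega)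

/-- The count `j` of commands passed never exceeds the position `b`, which keeps its register within
the available space. -/
theorem runs_printMatches_loop {k : StackVAS.Token} (ha : a ≤ w.length) (hy : w.drop b = y)
    (hb : b ≤ w.length) (hj : j ≤ b) : ∃ j' ≤ w.length,
    Runs w (loop (reads fun c => !c.isRightEnd) <| seq
      (ite (reads (onToken k)) (seq (io Move.right []) <| seq compareNames <|
        seq (io Move.left []) printMatch) nop) (nextToken 4))
      ⟨b + 1, regs p i (a + 1) 0 j 0 0 0, o⟩
      ⟨w.length + 1, regs p i (a + 1) 0 j' 0 0 0, o ++ occurrences k (w.drop a) j y⟩ := by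
  induction y generalizing b j o with
  | nil =>
    refine ⟨j, by omega, ?_⟩
    have : b = w.length := by have := congrArg List.length hy; simp at this; omega
    subst this
    simp only [occurrences, List.append_nil]
    exact Runs.loop_done (by simp [isRightEnd_nil hy])
  | cons t y ih =>
    have hbl := List.length_eq_of_drop_eq_cons hy
    have hy' := List.drop_succ_of_drop_eq_cons hy
    obtain ⟨j', hj', h1⟩ := ih (o := o ++ if t = k ∧ sameName (w.drop a) y = true then
      [.or, .letter, .var .y] ++ List.replicate j .tally ++ [.fin] else [])
      (j := if isCommand t then j + 1 else j) hy' (by omega) (by split_ifs <;> omega)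
    rw [occurrences, ← List.append_assoc]
    refine ⟨j', hj', Runs.loop_step (by simp [isRightEnd_cons hy])
      (Runs.seq (Runs.ite (fun h => ?_) (fun h => ?_)) (runs_nextToken_4 hy hj)) h1⟩ <;>
      simp only [onToken_cons hy, decide_eq_true_eq, decide_eq_false_iff_not] at h
    -- The name to be compared starts one cell behind the matching token.
    · have hr := runs_compareNames (w := w) (p := p) (i := i) (j := j) (o := o) (a := a)
        (b := b + 1) ha (by omega)
      rw [hy'] at hr
      simp only [h, true_and]
      exact (Runs.right (by omega)).seq <| hr.seq <| (Runs.left (by omega)).seq <|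
        runs_printMatch (by omega) (by omega) _
    · simp only [h, false_and, if_false, List.append_nil]
      exact Runs.nop (by omega)

theorem runs_printMatches (k : StackVAS.Token) (ha : a ≤ w.length) (hh : h ≤ w.length + 1) :
    Runs w (printMatches k) ⟨h, regs p i (a + 1) 0 0 0 0 0, o⟩
      ⟨w.length + 1, regs p i (a + 1) 0 0 0 0 0, o ++ occurrences k (w.drop a) 0 w⟩ := by
  obtain ⟨j, hj, h1⟩ := runs_printMatches_loop (w := w) (p := p) (i := i) (j := 0) (o := o) (a := a)
    (b := 0) (k := k) (y := w) ha rfl (Nat.zero_le _) le_rfl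
  refine (Runs.toLeftEnd hh).seq <| (Runs.right (by omega)).seq <| h1.seq ?_
  simpa using Runs.clear (O := LeafData.Token) (w := w) (h := w.length + 1) (r := 4)
    (v := regs p i (a + 1) 0 j 0 0 0) (o := o ++ occurrences k (w.drop a) 0 w)
    (by omega) (by simp; omega)

/-- The statement covers arbitrary words: without a terminator the head stops at the right end
marker and the last move has no effect, in accordance with the value of `skipName` on such words.
The equation with `min` is a way of saying `b ≤ w.length`. -/
theorem runs_skip_loop (ha : a ≤ w.length) (hx : w.drop a = x) : ∃ b, b ≤ w.length + 1 ∧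
    w.drop b = skipName x ∧ min (b + 1) (w.length + 1) = b + 1 ∧
    Runs w (seq (loop (reads (InputCell.holds fun t => decide (t ≠ .fin))) (io Move.right []))
      (io Move.right [])) (⟨a + 1, v, o⟩ : Regs LeafData.Token 9) ⟨b + 1, v, o⟩ := by
  induction x generalizing a with
  | nil =>
    refine ⟨a, by omega, by simp [hx, skipName], by omega, Runs.seq (Runs.loop_done (holds_nil hx _)) ?_⟩
    have : a = w.length := by have := congrArg List.length hx; simp at this; omega
    subst this
    simpa [Transducer.moveHead] using Runs.io (O := LeafData.Token) (w := w) (d := Move.right) (l := [])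
      (v := v) (o := o) (h := w.length + 1)
  | cons t x ih =>
    have hal := List.length_eq_of_drop_eq_cons hx
    have hx' := List.drop_succ_of_drop_eq_cons hx
    by_cases ht : t = .fin
    · refine ⟨a + 1, by omega, by simp [hx', skipName, ht], by omega, Runs.seq (Runs.loop_done ?_)
        (Runs.right (by omega))⟩
      simp [holds_cons hx, ht]
    · obtain ⟨b, hb1, hb2, hb3, hb4⟩ := ih (a := a + 1) (by omega) hx'
      refine ⟨b, hb1, by simpa [skipName, ht] using hb2, hb3, ?_⟩
      cases hb4 with
      | seq h1 h2 =>
        have h3 : (Transducer.inputCell w (a + 1)).holds (fun t => decide (t ≠ .fin)) = true := by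
          simp [holds_cons hx, ht]
        exact Exec.seq (Exec.loop_true h3 (Runs.right (by omega)) h1) h2

theorem runs_nextName (ha : a ≤ w.length) (hh : h ≤ w.length + 1) : ∃ b ≤ w.length,
    w.drop b = skipName (w.drop a) ∧
    Runs w nextName ⟨h, regs p i (a + 1) 0 0 0 0 0, o⟩ ⟨b + 1, regs p i (b + 1) 0 0 0 0 0, o⟩ := by
  obtain ⟨b, hb1, hb2, hb3, hb4⟩ := runs_skip_loop (w := w) (v := regs p i (a + 1) 0 0 0 0 0) (o := o) ha rfl
  refine ⟨b, by omega, hb2, (Runs.toLeftEnd hh).seq <| (Runs.advance (by decide) rfl ?_).seq ?_⟩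
  · simp; omega
  -- The two halves of the search are separated because `nextName` nests its sequence to the right.
  · cases hb4 with
    | seq h1 h2 =>
      rw [regs_2, Nat.zero_add]
      refine Exec.seq h1 (Exec.seq h2 ?_)
      have h3 := Runs.clear (O := LeafData.Token) (w := w) (h := b + 1) (r := 2)
        (v := regs p i (a + 1) 0 0 0 0 0) (o := o) (by omega) (by simp; omega)
      have h4 := Runs.save (O := LeafData.Token) (w := w) (h := b + 1) (r := 2) (t := 8)
        (v := regs p i 0 0 0 0 0 0) (o := o) (by decide) rfl rfl (by omega)
      simp only [update_regs_2] at h3 h4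
      exact h3.seq h4

theorem runs_printPieces (ps : List Piece) (ha : a ≤ w.length) (hh : h ≤ w.length + 1)
    (hi : i ≤ w.length) : ∃ h' a', h' ≤ w.length + 1 ∧ a' ≤ w.length ∧
    Runs w (printPieces ps) ⟨h, regs p i (a + 1) 0 0 0 0 0, o⟩
      ⟨h', regs p i (a' + 1) 0 0 0 0 0, o ++ pieceCode w i (w.drop a) ps⟩ := by
  induction ps generalizing h a o with
  | nil => exact ⟨h, a, hh, ha, by simpa [pieceCode, printPieces] using Runs.nop hh⟩
  | cons u ps ih =>
    cases u with
    | text l =>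
      obtain ⟨h', a', hh', ha', h1⟩ := ih (o := o ++ l) ha hh
      refine ⟨h', a', hh', ha', Runs.seq (Runs.write hh) ?_⟩
      rw [pieceCode, ← List.append_assoc]
      exact h1
    | index =>
      obtain ⟨h', a', hh', ha', h1⟩ := ih (o := o ++ List.replicate i .tally) ha hh
      refine ⟨h', a', hh', ha', Runs.seq (Runs.printReg (by decide) rfl (by simp; omega) hh) ?_⟩
      rw [pieceCode, ← List.append_assoc]
      exact h1
    | names k =>
      obtain ⟨h', a', hh', ha', h1⟩ := ih (h := w.length + 1)
        (o := o ++ occurrences k (w.drop a) 0 w) ha le_rfl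
      refine ⟨h', a', hh', ha', Runs.seq (runs_printMatches k ha hh) ?_⟩
      rw [pieceCode, ← List.append_assoc]
      exact h1
    | skip =>
      obtain ⟨b, hb, hb', h2⟩ := runs_nextName (w := w) (p := p) (i := i) (o := o) ha hh
      obtain ⟨h', a', hh', ha', h1⟩ := ih (a := b) (o := o) (h := b + 1) hb (by omega)
      refine ⟨h', a', hh', ha', Runs.seq h2 ?_⟩
      rw [pieceCode, ← hb']
      exact h1

theorem runs_printClause (ps : List Piece) (hx : w.drop b = t :: x) (hi : i ≤ b) :
    Runs w (printClause ps) ⟨b + 1, regs 0 i 0 0 0 0 0 0, o⟩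
      ⟨b + 1, regs 0 i 0 0 0 0 0 0, o ++ pieceCode w i x ps⟩ := by
  have hb := List.length_eq_of_drop_eq_cons hx
  have hx' := List.drop_succ_of_drop_eq_cons hx
  obtain ⟨h', a', hh', ha', h1⟩ := runs_printPieces (w := w) (p := b + 1) (i := i) (o := o)
    (h := b + 1 + 1) (a := b + 1) ps (by omega) (by omega) (by omega)
  rw [hx'] at h1
  have s1 := Runs.save (O := LeafData.Token) (w := w) (h := b + 1) (r := 0) (t := 8)
    (v := regs 0 i 0 0 0 0 0 0) (o := o) (by decide) rfl rfl (by omega)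
  have s2 := Runs.save (O := LeafData.Token) (w := w) (h := b + 1 + 1) (r := 2) (t := 8)
    (v := regs (b + 1) i 0 0 0 0 0 0) (o := o) (by decide) rfl rfl (by omega)
  have s3 := Runs.clear (O := LeafData.Token) (w := w) (h := h') (r := 2)
    (v := regs (b + 1) i (a' + 1) 0 0 0 0 0) (o := o ++ pieceCode w i x ps) hh' (by simp; omega)
  have s4 := Runs.advance (O := LeafData.Token) (w := w) (h := 0) (r := 0) (t := 8)
    (v := regs (b + 1) i 0 0 0 0 0 0) (o := o ++ pieceCode w i x ps) (by decide) rfl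
    (by simp; omega)
  have s5 := Runs.clear (O := LeafData.Token) (w := w) (h := b + 1) (r := 0)
    (v := regs (b + 1) i 0 0 0 0 0 0) (o := o ++ pieceCode w i x ps) (by omega) (by simp; omega)
  simp only [update_regs_0, update_regs_2, regs_0, Nat.zero_add] at s1 s2 s3 s4 s5
  exact s1.seq <| (Runs.right (by omega)).seq <| s2.seq <| h1.seq <| s3.seq <|
    (Runs.toLeftEnd hh').seq <| s4.seq s5

theorem runs_dispatch {C : StackVAS.Token → Program} (l : List StackVAS.Token)
    (hx : w.drop b = t :: x) {o' : List LeafData.Token}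
    (h1 : t ∈ l → Runs w (C t) ⟨b + 1, v, o⟩ ⟨b + 1, v, o'⟩) (h2 : t ∉ l → o = o') :
    Runs w (dispatch C l) ⟨b + 1, v, o⟩ ⟨b + 1, v, o'⟩ := by
  have hb := List.length_eq_of_drop_eq_cons hx
  induction l with
  | nil =>
    rw [h2 (by simp)]
    exact Runs.nop (by omega)
  | cons u l ih =>
    by_cases hu : t = u
    · subst hu
      exact runs_ite_true (by simp [onToken_cons hx]) (h1 (by simp))
    · exact runs_ite_false (by simp [onToken_cons hx, hu])
        (ih (fun h => h1 (by simp [h])) (fun h => h2 (by simp [h, hu])))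

theorem runs_nextToken_1 (hx : w.drop b = t :: x) (hi : i ≤ b) :
    Runs w (nextToken 1) ⟨b + 1, regs 0 i 0 0 0 0 0 0, o⟩
      ⟨b + 1 + 1, regs 0 (if isCommand t then i + 1 else i) 0 0 0 0 0 0, o⟩ := by
  have hb := List.length_eq_of_drop_eq_cons hx
  refine Runs.seq (Runs.ite (fun h => ?_) (fun h => ?_)) (Runs.right (by omega)) <;>
    rw [holds_cons hx] at h
  · rw [h]
    simpa using Runs.inc (O := LeafData.Token) (w := w) (h := b + 1) (r := 1)
      (v := regs 0 i 0 0 0 0 0 0) (o := o) (by omega) (by simp; omega)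
  · simp only [h]
    exact Runs.nop (by omega)

/-- Every letter is dispatched, and only command tokens print a clause. The invariant `i ≤ b` bounds
the register that numbers the commands. -/
theorem runs_printClauses (C : StackVAS.Token → List Piece) (hx : w.drop b = x)
    (hb : b ≤ w.length) (hi : i ≤ b) :
    Runs w (printClauses C) ⟨b + 1, regs 0 i 0 0 0 0 0 0, o⟩
      ⟨w.length + 1, regs 0 (i + x.countP isCommand) 0 0 0 0 0 0, o ++ clausesCode C w i x⟩ := by
  induction x generalizing b i o with
  | nil =>
    have : b = w.length := by have := congrArg List.length hx; simp at this; omega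
    subst this
    simp only [clausesCode, List.append_nil]
    exact Runs.loop_done (by simp [isRightEnd_nil hx])
  | cons t x ih =>
    have hbl := List.length_eq_of_drop_eq_cons hx
    have hx' := List.drop_succ_of_drop_eq_cons hx
    have h1 := ih (o := o ++ if isCommand t then pieceCode w i x (C t) else [])
      (i := if isCommand t then i + 1 else i) hx' (by omega) (by split_ifs <;> omega)
    refine Runs.loop_step (by simp [isRightEnd_cons hx]) (Runs.seq
      (runs_dispatch (o' := o ++ if isCommand t then pieceCode w i x (C t) else []) _ hx
        (fun h => ?_) (fun h => ?_)) (runs_nextToken_1 hx hi)) ?_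
    · have : isCommand t = true := by
        simp only [List.mem_cons, List.not_mem_nil, or_false] at h
        rcases h with rfl | rfl | rfl | rfl | rfl | rfl <;> rfl
      simpa only [this, if_true] using runs_printClause (C t) hx hi
    · have : isCommand t = false := by
        cases t <;> simp at h <;> rfl
      simp [this]
    · have e1 : i + (t :: x).countP isCommand =
          (if isCommand t then i + 1 else i) + x.countP isCommand := by
        by_cases ht : isCommand t = true <;> simp [ht]; omega
      have e2 : clausesCode C w i (t :: x) = (if isCommand t then pieceCode w i x (C t) else []) ++
          clausesCode C w (if isCommand t then i + 1 else i) x := by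
        by_cases ht : isCommand t = true <;> simp [ht, clausesCode]
      rw [e1, e2, ← List.append_assoc]
      exact h1

theorem runs_printCount (hx : w.drop b = x) (hb : b ≤ w.length) :
    Runs w printCount (⟨b + 1, v, o⟩ : Regs LeafData.Token 9)
      ⟨w.length + 1, v, o ++ List.replicate (x.countP isCommand) .tally⟩ := by
  induction x generalizing b o with
  | nil =>
    have : b = w.length := by have := congrArg List.length hx; simp at this; omega
    subst this
    simp only [List.countP_nil, List.replicate_zero, List.append_nil]
    exact Runs.loop_done (by simp [isRightEnd_nil hx])
  | cons t x ih =>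
    have hbl := List.length_eq_of_drop_eq_cons hx
    have hx' := List.drop_succ_of_drop_eq_cons hx
    have h1 := ih (o := o ++ if isCommand t then [.tally] else []) hx' (by omega)
    have e : List.replicate ((t :: x).countP isCommand) LeafData.Token.tally =
        (if isCommand t then [.tally] else []) ++ List.replicate (x.countP isCommand) .tally := by
      by_cases ht : isCommand t = true <;> simp [ht, List.replicate_succ]
    rw [e, ← List.append_assoc]
    refine Runs.loop_step (by simp [isRightEnd_cons hx]) (Runs.seq (Runs.ite (fun h => ?_)
      (fun h => ?_)) (Runs.right (by omega))) h1
    · rw [holds_cons hx] at h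
      simp only [h, if_true]
      exact Runs.write (by omega)
    · rw [holds_cons hx] at h
      simp only [h]
      simpa using Runs.nop (by omega)

theorem runs_printSentence (C : StackVAS.Token → List Piece) (l l' : List LeafData.Token)
    (w : List StackVAS.Token) : ∃ τ : Regs LeafData.Token 9,
    Runs w (printSentence C l l') ⟨0, fun _ => 0, []⟩ τ ∧ τ.out = sentenceCode C l l' w := by
  have e : (fun _ => 0 : Fin 9 → ℕ) = regs 0 0 0 0 0 0 0 0 := by funext r; fin_cases r <;> rfl
  have hc : w.countP isCommand ≤ w.length := List.countP_le_length
  rw [e]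
  refine ⟨_, (Runs.right (Nat.zero_le _)).seq <| (runs_printCount rfl (Nat.zero_le _)).seq <|
    (Runs.write le_rfl).seq <| (Runs.toLeftEnd le_rfl).seq <| (Runs.right (Nat.zero_le _)).seq <|
    (runs_printClauses C rfl (Nat.zero_le _) le_rfl).seq <| (Runs.write le_rfl).seq <|
    (Runs.printReg (by decide) rfl ?_ le_rfl).seq <| Runs.write le_rfl, ?_⟩
  · simp; omega
  · simp [sentenceCode]

end

/-- A function whose graph on codes is given by clauses is computable in logarithmic space. -/
theorem computable_of_sentenceCode (C : StackVAS.Token → List Piece) (l l' : List LeafData.Token)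
    (F : StackVAS.SVAS → LeafData.Sentence) (hF : ∀ P, (F P).code = sentenceCode C l l' P.code) :
    LogSpace.Computable StackVAS.SVAS.encoding LeafData.Sentence.encoding F := by
  refine ⟨(seq setup (printSentence C l l')).machine Cell.blank, 6, fun P => ?_⟩
  obtain ⟨τ, h1, h2⟩ := runs_printSentence C l l' P.code
  obtain ⟨h3, h4⟩ := h1.machine
  rw [h2, ← hF] at h3
  exact ⟨h3, fun c hc i => (h4 c hc i).trans_le (space_le _)⟩

end SVASReduction

/-! ## The sentence of an SVAS -/

namespace SVASReduction

open StackVAS LeafData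

/-- The letter with the number `i`, which stands for the command at position `i`. -/
def lit (n i : ℕ) (v : Var) : Formula (Fin (n + 1)) := .letter (Fin.ofNat (n + 1) i) v

/-- The line contains the token `k` followed by the name `a`. -/
def Occurs (k : StackVAS.Token) (a : Name) (l : Line) : Prop :=
  match k with
  | .label => l.label = some a
  | .inc => l.command = .inc a
  | .dec => l.command = .dec a
  | .push => l.command = .push a
  | _ => False

open Classical in
/-- The node `y` is labelled by one of the given lines in which the token `k` is followed by the
name `a`. -/
noncomputable def matching (n : ℕ) (k : StackVAS.Token) (a : Name) :
    ℕ → List Line → Formula (Fin (n + 1))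
  -- The empty disjunction: no node is its own child.
  | _, [] => .child .y .y
  | j, l :: ls => if Occurs k a l then .or (lit n j .y) (matching n k a (j + 1) ls)
    else matching n k a (j + 1) ls

def noChild (n : ℕ) : Formula (Fin (n + 1)) := .neg (.ex .y (.child .x .y))

def noNext (n : ℕ) : Formula (Fin (n + 1)) := .neg (.ex .y (.next .x .y))

/-- What holds at the node `x` if it is labelled by the given command at position `i`. -/
noncomputable def condition (n : ℕ) (ls : List Line) (i : ℕ) : Command → Formula (Fin (n + 1))
  -- That the node is a leaf need not be demanded for increments and decrements, since `≺` relates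
  -- leaves only.
  | .inc a =>
    .and (.ex .y (.and (.next .x .y) (lit n (i + 1) .y)))
      (.and (.ex .y (.and (.prec .x .y) (.sim .x .y)))
        (.all .y (.imp (.and (.prec .x .y) (.sim .x .y)) (matching n .dec a 0 ls))))
  | .dec a =>
    .and (.ex .y (.and (.next .x .y) (lit n (i + 1) .y)))
      (.and (.ex .y (.and (.prec .y .x) (.sim .x .y)))
        (.all .y (.imp (.and (.prec .y .x) (.sim .x .y)) (matching n .inc a 0 ls))))
  -- The variable `x` is quantified again to say that `y` has no previous sibling, that is, `y` is
  -- the first child.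
  | .push _ =>
    .ex .y (.and (.child .x .y) (.and (lit n (i + 1) .y) (.neg (.ex .x (.next .x .y)))))
  | .pop a =>
    .and (noChild n) (.and (noNext n) (.ex .y (.and (.child .y .x)
      (.and (.ex .x (.and (.next .y .x) (lit n (i + 1) .x))) (matching n .push a 0 ls)))))
  | .goto L L' =>
    .and (noChild n) (.ex .y (.and (.next .x .y)
      (.or (matching n .label L 0 ls) (matching n .label L' 0 ls))))
  | .halt => .and (noChild n) (.and (noNext n) (.neg (.ex .y (.child .y .x))))

/-- The conditions for the given lines, and the condition that the letter `n` does not occur. -/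
noncomputable def conditions (n : ℕ) (ls : List Line) : ℕ → List Line → Formula (Fin (n + 1))
  -- The letter `n` would label the successor of the last line; excluding it prevents running past
  -- the end.
  | _, [] => .all .x (.neg (lit n n .x))
  | i, l :: ls' => .and (.all .x (.imp (lit n i .x) (condition n ls i l.command)))
      (conditions n ls (i + 1) ls')

/-- There is a node, the first root has the letter `0`, and the conditions for all lines hold. -/
noncomputable def formula (ls : List Line) : Formula (Fin (ls.length + 1)) :=
  .and (.ex .x (.neg (.child .x .x)))
    (.and (.all .x (.imp (.neg (.ex .y (.or (.next .y .x) (.child .y .x)))) (lit ls.length 0 .x)))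
      (conditions ls.length ls 0 ls))

theorem freeVars_matching (n : ℕ) (k : StackVAS.Token) (a : Name) (j : ℕ) (ls : List Line) :
    (matching n k a j ls).freeVars = {.y} := by
  induction ls generalizing j with
  | nil => simp [matching, Formula.freeVars]
  | cons l ls ih =>
    rw [matching]
    split_ifs <;> simp [Formula.freeVars, ih, lit]

theorem freeVars_condition (n : ℕ) (ls : List Line) (i : ℕ) (c : Command) :
    (condition n ls i c).freeVars ⊆ {.x} := by
  intro v hv
  cases v with
  | x => rfl
  | y =>
    cases c <;>
      simp [condition, Formula.freeVars, noChild, noNext, lit, freeVars_matching] at hv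

theorem freeVars_conditions (n : ℕ) (ls : List Line) (i : ℕ) (ls' : List Line) :
    (conditions n ls i ls').freeVars = ∅ := by
  induction ls' generalizing i with
  | nil => simp [conditions, Formula.freeVars, lit]
  | cons l ls' ih =>
    simpa [conditions, Formula.freeVars, lit, ih, Set.sdiff_eq_empty] using
      freeVars_condition n ls i l.command

/-- The instance of the satisfiability problem to which an SVAS is mapped. -/
noncomputable def sentence (P : SVAS) : Sentence where
  card := P.lines.length + 1
  formula := formula P.lines
  closed := by
    simp only [formula, Formula.freeVars, lit, freeVars_conditions]
    ext v
    cases v <;> simp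

/-! ### The code of the sentence -/

/-- The prefix code of each clause. The number `i + 1` appears as one tally in front of the index,
and each list of occurrences is closed by the code of the empty disjunction. -/
def pieces : StackVAS.Token → List Piece
  | .inc => [.text [.and, .all, .var .x, .imp, .letter, .var .x], .index,
      .text [.fin, .and, .ex, .var .y, .and, .next, .var .x, .var .y, .letter, .var .y, .tally],
      .index,
      .text [.fin, .and, .ex, .var .y, .and, .prec, .var .x, .var .y, .sim, .var .x, .var .y,
        .all, .var .y, .imp, .and, .prec, .var .x, .var .y, .sim, .var .x, .var .y],
      .names .dec, .text [.child, .var .y, .var .y]]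
  | .dec => [.text [.and, .all, .var .x, .imp, .letter, .var .x], .index,
      .text [.fin, .and, .ex, .var .y, .and, .next, .var .x, .var .y, .letter, .var .y, .tally],
      .index,
      .text [.fin, .and, .ex, .var .y, .and, .prec, .var .y, .var .x, .sim, .var .x, .var .y,
        .all, .var .y, .imp, .and, .prec, .var .y, .var .x, .sim, .var .x, .var .y],
      .names .inc, .text [.child, .var .y, .var .y]]
  | .push => [.text [.and, .all, .var .x, .imp, .letter, .var .x], .index,
      .text [.fin, .ex, .var .y, .and, .child, .var .x, .var .y, .and, .letter, .var .y, .tally],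
      .index, .text [.fin, .neg, .ex, .var .x, .next, .var .x, .var .y]]
  | .pop => [.text [.and, .all, .var .x, .imp, .letter, .var .x], .index,
      .text [.fin, .and, .neg, .ex, .var .y, .child, .var .x, .var .y,
        .and, .neg, .ex, .var .y, .next, .var .x, .var .y,
        .ex, .var .y, .and, .child, .var .y, .var .x,
        .and, .ex, .var .x, .and, .next, .var .y, .var .x, .letter, .var .x, .tally], .index,
      .text [.fin], .names .push, .text [.child, .var .y, .var .y]]
  | .goto => [.text [.and, .all, .var .x, .imp, .letter, .var .x], .index,
      .text [.fin, .and, .neg, .ex, .var .y, .child, .var .x, .var .y,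
        .ex, .var .y, .and, .next, .var .x, .var .y, .or], .names .label,
      .text [.child, .var .y, .var .y], .skip, .names .label, .text [.child, .var .y, .var .y]]
  | .halt => [.text [.and, .all, .var .x, .imp, .letter, .var .x], .index,
      .text [.fin, .and, .neg, .ex, .var .y, .child, .var .x, .var .y,
        .and, .neg, .ex, .var .y, .next, .var .x, .var .y,
        .neg, .ex, .var .y, .child, .var .y, .var .x]]
  | _ => []

/-- It is printed after the number of commands in unary: its first tally completes that number to
the size of the alphabet. -/
def header : List LeafData.Token :=
  [.tally, .fin, .and, .ex, .var .x, .neg, .child, .var .x, .var .x, .and, .all, .var .x, .imp,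
    .neg, .ex, .var .y, .or, .next, .var .y, .var .x, .child, .var .y, .var .x,
    .letter, .var .x, .fin]

def footer : List LeafData.Token := [.all, .var .x, .neg, .letter, .var .x]

theorem code_lit {n i : ℕ} (h : i ≤ n) (v : Var) :
    (lit n i v).code = [.letter, .var v] ++ List.replicate i .tally ++ [.fin] := by
  simp [lit, Formula.code, numCode, Nat.mod_eq_of_lt (Nat.lt_succ_of_le h)]

/-- The terminator makes the codes of names prefix-free, so whatever follows them is irrelevant. -/
theorem sameName_nameCode (a b : Name) (r s : List StackVAS.Token) :
    sameName (nameCode a ++ r) (nameCode b ++ s) = true ↔ b = a := by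
  induction a generalizing b with
  | nil => cases b <;> simp [nameCode, sameName]
  | cons c a ih =>
    cases b with
    | nil => simp [nameCode, sameName]
    | cons d b =>
      have e : sameName (nameCode (c :: a) ++ r) (nameCode (d :: b) ++ s) =
          (c == d && sameName (nameCode a ++ r) (nameCode b ++ s)) := by
        simp [nameCode, sameName]
      rw [e, Bool.and_eq_true, ih, beq_iff_eq, List.cons.injEq, @eq_comm _ c d]

theorem skipName_nameCode (a : Name) (r : List StackVAS.Token) : skipName (nameCode a ++ r) = r := by
  induction a with
  | nil => simp [nameCode, skipName]
  | cons c a ih => simpa [nameCode, skipName] using ih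

theorem isCommand_of_mem_nameCode {a : Name} {t : StackVAS.Token} (h : t ∈ nameCode a) :
    isCommand t = false ∧ t ≠ .label := by
  simp only [nameCode, List.mem_append, List.mem_map, List.mem_singleton] at h
  rcases h with ⟨b, _, rfl⟩ | rfl <;> simp [isCommand]

theorem occurrences_append_of_not_isCommand {k : StackVAS.Token} (hk : isCommand k ∨ k = .label)
    (x : List StackVAS.Token) (j : ℕ) (y z : List StackVAS.Token)
    (hy : ∀ t ∈ y, isCommand t = false ∧ t ≠ .label) :
    occurrences k x j (y ++ z) = occurrences k x j z := by
  induction y with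
  | nil => rfl
  | cons t y ih =>
    obtain ⟨h1, h2⟩ := hy t (by simp)
    have : t ≠ k := by
      rintro rfl
      rcases hk with h | h
      · simp [h1] at h
      · exact h2 h
    simp only [List.cons_append, occurrences, this, h1, false_and, if_false, List.nil_append]
    exact ih fun t ht => hy t (by simp [ht])

theorem occurrences_nameCode {k : StackVAS.Token} (hk : isCommand k ∨ k = .label)
    (x : List StackVAS.Token) (j : ℕ) (a : Name) (z : List StackVAS.Token) :
    occurrences k x j (nameCode a ++ z) = occurrences k x j z :=
  occurrences_append_of_not_isCommand hk x j _ z fun _ => isCommand_of_mem_nameCode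

open Classical in
-- The label precedes the command token, and only the command token raises the count, so both are
-- reported with the number `j` of their line. The bits and terminators of names neither match nor
-- count.
theorem occurrences_line {k : StackVAS.Token}
    (hk : k = .label ∨ k = .inc ∨ k = .dec ∨ k = .push) (a : Name) (r : List StackVAS.Token) (j : ℕ)
    (l : Line) (z : List StackVAS.Token) :
    occurrences k (nameCode a ++ r) j (l.code ++ z) =
      (if Occurs k a l then [.or, .letter, .var .y] ++ List.replicate j .tally ++ [.fin] else []) ++
      occurrences k (nameCode a ++ r) (j + 1) z := by
  have hk' : isCommand k ∨ k = .label := by rcases hk with rfl | rfl | rfl | rfl <;> simp [isCommand]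
  have hcommand : ∀ c : Command, occurrences k (nameCode a ++ r) j (c.code ++ z) =
      (if k ≠ .label ∧ Occurs k a ⟨none, c⟩ then
        [.or, .letter, .var .y] ++ List.replicate j .tally ++ [.fin] else []) ++
      occurrences k (nameCode a ++ r) (j + 1) z := by
    intro c
    cases c <;> rcases hk with rfl | rfl | rfl | rfl <;>
      simp [Command.code, occurrences, occurrences_nameCode, isCommand, Occurs, sameName_nameCode]
  obtain ⟨m, c⟩ := l
  cases m with
  | none =>
    have e : (k ≠ .label ∧ Occurs k a ⟨none, c⟩) ↔ Occurs k a ⟨none, c⟩ := by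
      rcases hk with rfl | rfl | rfl | rfl <;> simp [Occurs]
    rw [Line.code, labelCode, List.nil_append, hcommand, if_congr e rfl rfl]
  | some L =>
    rw [Line.code, labelCode, List.append_assoc, List.cons_append, occurrences, List.append_assoc,
      occurrences_nameCode hk', if_congr (and_congr_right' (sameName_nameCode _ _ _ _)) rfl rfl]
    simp only [isCommand, Bool.false_eq_true, if_false]
    rw [hcommand]
    by_cases h1 : k = .label
    · subst h1
      simp [Occurs]
    · rw [if_neg (by simp [Ne.symm h1]), List.nil_append]
      refine congrArg₂ _ (if_congr ?_ rfl rfl) rfl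
      rcases hk with rfl | rfl | rfl | rfl <;> simp [Occurs] at h1 ⊢

/-- In prefix notation each disjunct is a front part of a right-nested disjunction; the appended
atom closes the nesting. -/
theorem occurrences_lines {k : StackVAS.Token}
    (hk : k = .label ∨ k = .inc ∨ k = .dec ∨ k = .push) (a : Name) (r : List StackVAS.Token)
    {n j : ℕ} (ls : List Line) (hj : j + ls.length ≤ n) :
    occurrences k (nameCode a ++ r) j (ls.flatMap Line.code) ++ [.child, .var .y, .var .y] =
      (matching n k a j ls).code := by
  induction ls generalizing j with
  | nil => simp [occurrences, matching, Formula.code]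
  | cons l ls ih =>
    simp only [List.length_cons] at hj
    rw [List.flatMap_cons, occurrences_line hk, matching, List.append_assoc, ih (by omega)]
    split_ifs
    · simp [Formula.code, code_lit (show j ≤ n by omega)]
    · simp

theorem clausesCode_append_of_not_isCommand (C : StackVAS.Token → List Piece)
    (w : List StackVAS.Token) (i : ℕ) (y z : List StackVAS.Token)
    (hy : ∀ t ∈ y, isCommand t = false) :
    clausesCode C w i (y ++ z) = clausesCode C w i z := by
  induction y with
  | nil => rfl
  | cons t y ih =>
    simp only [List.cons_append, clausesCode, hy t (by simp), Bool.false_eq_true, if_false]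
    exact ih fun t ht => hy t (by simp [ht])

theorem clausesCode_nameCode (C : StackVAS.Token → List Piece) (w : List StackVAS.Token) (i : ℕ)
    (a : Name) (z : List StackVAS.Token) :
    clausesCode C w i (nameCode a ++ z) = clausesCode C w i z :=
  clausesCode_append_of_not_isCommand C w i _ z fun _ h => (isCommand_of_mem_nameCode h).1

theorem clausesCode_line {n : ℕ} (ls : List Line) (hn : ls.length ≤ n) (i : ℕ) (hi : i < n)
    (l : Line) (z : List StackVAS.Token) :
    clausesCode pieces (ls.flatMap Line.code) i (l.code ++ z) =
      [.and, .all, .var .x, .imp] ++ (lit n i .x).code ++ (condition n ls i l.command).code ++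
        clausesCode pieces (ls.flatMap Line.code) (i + 1) z := by
  have h1 : ∀ c : Command, clausesCode pieces (ls.flatMap Line.code) i (c.code ++ z) =
      [.and, .all, .var .x, .imp] ++ (lit n i .x).code ++ (condition n ls i c).code ++
        clausesCode pieces (ls.flatMap Line.code) (i + 1) z := by
    intro c
    -- The rest `r` of the input behind the name is free; it differs between the two names of a
    -- jump.
    have hm : ∀ (k : StackVAS.Token) (a : Name) (r : List StackVAS.Token),
        (k = .label ∨ k = .inc ∨ k = .dec ∨ k = .push) → (matching n k a 0 ls).code = _ :=
      fun k a r hk => (occurrences_lines (n := n) (j := 0) hk a r ls (by omega)).symm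
    cases c <;>
      simp [Command.code, clausesCode, isCommand, pieces, pieceCode, condition, Formula.code,
        code_lit (show i ≤ n by omega), code_lit (show i + 1 ≤ n by omega), clausesCode_nameCode,
        List.replicate_succ, noChild, noNext, skipName_nameCode]
    case inc a => rw [hm .dec a z (by simp)]; simp
    case dec a => rw [hm .inc a z (by simp)]; simp
    case pop a => rw [hm .push a z (by simp)]; simp
    case goto L L' =>
      rw [hm .label L (nameCode L' ++ z) (by simp), hm .label L' z (by simp)]
      simp
  obtain ⟨m, c⟩ := l
  rw [Line.code, List.append_assoc, clausesCode_append_of_not_isCommand, h1]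
  intro t ht
  cases m with
  | none => simp [labelCode] at ht
  | some L =>
    simp only [labelCode, List.mem_cons] at ht
    rcases ht with rfl | ht
    · rfl
    · exact (isCommand_of_mem_nameCode ht).1

theorem clausesCode_lines {n : ℕ} (ls : List Line) (hn : ls.length ≤ n) (i : ℕ) (ls' : List Line)
    (hi : i + ls'.length ≤ n) :
    clausesCode pieces (ls.flatMap Line.code) i (ls'.flatMap Line.code) ++ footer ++
      List.replicate n .tally ++ [.fin] = (conditions n ls i ls').code := by
  induction ls' generalizing i with
  | nil => simp [clausesCode, conditions, Formula.code, footer, code_lit le_rfl]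
  | cons l ls' ih =>
    simp only [List.length_cons] at hi
    rw [List.flatMap_cons, clausesCode_line ls hn i (by omega), conditions, Formula.code,
      ← ih (i + 1) (by omega)]
    simp [Formula.code]

theorem countP_nameCode (a : Name) : (nameCode a).countP isCommand = 0 :=
  List.countP_eq_zero.2 fun t ht => by simp [(isCommand_of_mem_nameCode ht).1]

theorem countP_lines (ls : List Line) :
    (ls.flatMap Line.code).countP isCommand = ls.length := by
  induction ls with
  | nil => rfl
  | cons l ls ih =>
    obtain ⟨m, c⟩ := l
    rw [List.flatMap_cons, List.countP_append, ih]
    cases m <;> cases c <;>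
      simp [Line.code, labelCode, Command.code, List.countP_cons, countP_nameCode, isCommand,
        Nat.add_comm]

theorem code_sentence (P : SVAS) :
    (sentence P).code = sentenceCode pieces header footer P.code := by
  have h := clausesCode_lines P.lines le_rfl 0 P.lines (by omega)
  simp only [sentenceCode, SVAS.code, countP_lines]
  rw [List.append_assoc, List.append_assoc, List.append_assoc, ← List.append_assoc footer,
    ← List.append_assoc (clausesCode _ _ _ _), ← List.append_assoc (clausesCode _ _ _ _), h]
  simp [Sentence.code, sentence, formula, Formula.code, header, numCode, code_lit,
    List.replicate_succ']

end SVASReduction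

/-! ## The meaning of the sentence -/

namespace SVASReduction

open StackVAS LeafData

variable {n : ℕ} {F : LeafDataForest (Fin (n + 1))}

/-- The label of the node `p` is the position of a line in which the token `k` is followed by the
name `a`. -/
def OccursAt (F : LeafDataForest (Fin (n + 1))) (ls : List Line) (k : StackVAS.Token) (a : Name)
    (p : F.Node) : Prop :=
  ∃ l, ls[(F.label p).val]? = some l ∧ Occurs k a l

/-- The meaning of the condition for a command at a node. -/
def Condition (F : LeafDataForest (Fin (n + 1))) (ls : List Line) (p : F.Node) : Command → Prop
  | .inc a =>
    (∃ q, F.NextSibling p q ∧ (F.label q).val = (F.label p).val + 1) ∧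
      (∃ q, F.LeafPrec p q ∧ F.SameData p q) ∧
      ∀ q, F.LeafPrec p q → F.SameData p q → OccursAt F ls .dec a q
  | .dec a =>
    (∃ q, F.NextSibling p q ∧ (F.label q).val = (F.label p).val + 1) ∧
      (∃ q, F.LeafPrec q p ∧ F.SameData p q) ∧
      ∀ q, F.LeafPrec q p → F.SameData p q → OccursAt F ls .inc a q
  | .push _ => ∃ q, F.Child p q ∧ (F.label q).val = (F.label p).val + 1 ∧ ¬∃ r, F.NextSibling r q
  | .pop a => (¬∃ q, F.Child p q) ∧ (¬∃ q, F.NextSibling p q) ∧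
      ∃ q, F.Child q p ∧
        (∃ r, F.NextSibling q r ∧ (F.label r).val = (F.label p).val + 1) ∧ OccursAt F ls .push a q
  | .goto L L' => (¬∃ q, F.Child p q) ∧
      ∃ q, F.NextSibling p q ∧ (OccursAt F ls .label L q ∨ OccursAt F ls .label L' q)
  | .halt => (¬∃ q, F.Child p q) ∧ (¬∃ q, F.NextSibling p q) ∧ ¬∃ q, F.Child q p

theorem holds_lit {i : ℕ} (h : i ≤ n) (v : Var) (s : Var → Option F.Node) :
    (lit n i v).Holds F s ↔ ∃ p ∈ s v, (F.label p).val = i := by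
  simp [lit, Formula.Holds, Fin.ext_iff, Nat.mod_eq_of_lt (Nat.lt_succ_of_le h)]

theorem holds_matching_aux (k : StackVAS.Token) (a : Name) (ls : List Line) (j : ℕ)
    (h : j + ls.length ≤ n) (s : Var → Option F.Node) (q : F.Node) (hs : s .y = some q) :
    (matching n k a j ls).Holds F s ↔
      ∃ i l, ls[i]? = some l ∧ (F.label q).val = j + i ∧ Occurs k a l := by
  induction ls generalizing j with
  | nil => simp [matching, Formula.Holds, hs, Forest.Child]
  | cons l ls ih =>
    simp only [List.length_cons] at h
    have h1 : (∃ i m, (l :: ls)[i]? = some m ∧ (F.label q).val = j + i ∧ Occurs k a m) ↔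
        ((F.label q).val = j ∧ Occurs k a l) ∨
          ∃ i m, ls[i]? = some m ∧ (F.label q).val = j + 1 + i ∧ Occurs k a m := by
      constructor
      · rintro ⟨i, m, h1, h2, h3⟩
        rcases i with _ | i
        · simp only [List.getElem?_cons_zero, Option.some.injEq] at h1
          subst h1
          exact Or.inl ⟨h2, h3⟩
        · exact Or.inr ⟨i, m, by simpa using h1, by omega, h3⟩
      · rintro (⟨h1, h2⟩ | ⟨i, m, h1, h2, h3⟩)
        · exact ⟨0, l, rfl, h1, h2⟩
        · exact ⟨i + 1, m, by simpa using h1, by omega, h3⟩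
    rw [h1, matching]
    split_ifs with hl
    · simp only [Formula.Holds]
      rw [ih (j + 1) (by omega), holds_lit (by omega)]
      simp [hs, hl]
    · rw [ih (j + 1) (by omega)]
      simp [hl]

theorem holds_matching (k : StackVAS.Token) (a : Name) (ls : List Line) (h : ls.length ≤ n)
    (s : Var → Option F.Node) (q : F.Node) (hs : s .y = some q) :
    (matching n k a 0 ls).Holds F s ↔ OccursAt F ls k a q := by
  rw [holds_matching_aux k a ls 0 (by omega) s q hs]
  simp only [OccursAt, Nat.zero_add]
  constructor
  · rintro ⟨i, l, h1, h2, h3⟩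
    exact ⟨l, by rw [h2, h1], h3⟩
  · rintro ⟨l, h1, h2⟩
    exact ⟨_, l, h1, rfl, h2⟩

theorem holds_condition (ls : List Line) (hls : ls.length ≤ n) (c : Command)
    (s : Var → Option F.Node) (p : F.Node) (hs : s .x = some p) (hp : (F.label p).val < n) :
    (condition n ls (F.label p).val c).Holds F s ↔ Condition F ls p c := by
  have hm : ∀ k a (s : Var → Option F.Node) (q : F.Node),
      (matching n k a 0 ls).Holds F (Function.update s .y (some q)) ↔ OccursAt F ls k a q :=
    fun k a s q => holds_matching k a ls hls _ q (by simp)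
  cases c <;>
    simp [condition, Condition, Formula.Holds, hm, holds_lit (Nat.succ_le_of_lt hp), hs, noChild,
      noNext]

/-- Labels are at most `n`, and the last conjunct excludes `n`, so every label from `i` on belongs
to one of the remaining lines and falls under its clause. -/
theorem holds_conditions (ls : List Line) (hls : ls.length ≤ n) (ls' : List Line) (i : ℕ)
    (hi : i + ls'.length = n) (s : Var → Option F.Node) :
    (conditions n ls i ls').Holds F s ↔
      ∀ p, i ≤ (F.label p).val →
        ∃ l, ls'[(F.label p).val - i]? = some l ∧ Condition F ls p l.command := by
  induction ls' generalizing i with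
  | nil =>
    simp only [conditions, Formula.Holds, holds_lit le_rfl]
    simp only [List.length_nil, Nat.add_zero] at hi
    subst hi
    simp only [Function.update_self, Option.mem_some_iff, exists_eq_left', List.getElem?_nil, reduceCtorEq, false_and, exists_false, imp_false, not_le]
    exact forall_congr' fun p => ⟨fun h => lt_of_le_of_ne (Nat.lt_succ_iff.1 (F.label p).2) h, fun h => h.ne⟩
  | cons l ls' ih =>
    simp only [List.length_cons] at hi
    simp only [conditions, Formula.Holds]
    rw [ih (i + 1) (by omega)]
    simp only [holds_lit (show i ≤ n by omega), Function.update_self, Option.mem_some_iff, exists_eq_left']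
    have key : ∀ p, ((F.label p).val = i →
        (condition n ls i l.command).Holds F (Function.update s Var.x (some p))) ↔
        ((F.label p).val = i → Condition F ls p l.command) := by
      intro p
      refine imp_congr_right fun hp => ?_
      rw [← hp]
      exact holds_condition ls hls _ _ p (by simp) (by omega)
    simp only [key]
    constructor
    · rintro ⟨h1, h2⟩ p hp
      rcases Nat.eq_or_lt_of_le hp with hp | hp
      · exact ⟨l, by simp [← hp], h1 p hp.symm⟩
      · obtain ⟨m, hm1, hm2⟩ := h2 p hp
        have : (F.label p).val - i = (F.label p).val - (i + 1) + 1 := by omega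
        exact ⟨m, by rw [this, List.getElem?_cons_succ, hm1], hm2⟩
    · intro h
      constructor
      · intro p hp
        obtain ⟨m, hm1, hm2⟩ := h p hp.ge
        simp only [hp, Nat.sub_self, List.getElem?_cons_zero, Option.some.injEq] at hm1
        rwa [hm1]
      · intro p hp
        obtain ⟨m, hm1, hm2⟩ := h p (by omega)
        have : (F.label p).val - i = (F.label p).val - (i + 1) + 1 := by omega
        exact ⟨m, by rw [← hm1, this, List.getElem?_cons_succ], hm2⟩

/-- The meaning of the sentence of an SVAS. -/
theorem holds_formula (P : SVAS) (F : LeafDataForest (Fin (P.lines.length + 1))) :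
    (formula P.lines).Holds F (fun _ => none) ↔
      Nonempty F.Node ∧
      (∀ p, (¬∃ q, F.NextSibling q p ∨ F.Child q p) → (F.label p).val = 0) ∧
      ∀ p, ∃ l, P.lines[(F.label p).val]? = some l ∧ Condition F P.lines p l.command := by
  simp only [formula, Formula.Holds, holds_lit (Nat.zero_le _)]
  rw [holds_conditions _ le_rfl _ _ (by omega)]
  refine and_congr ?_ (and_congr ?_ ?_)
  -- No node is its own child, so the first conjunct only says that there is a node.
  · simp [Forest.Child]
  · simp
  · simp

end SVASReduction

/-! ## From models to computations -/

namespace SVASReduction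

open StackVAS LeafData

/-! ### Lexicographic order of addresses -/

section lex

variable {q u : List ℕ} {i : ℕ}

/-- The address of the first child is the immediate successor of `v` among all addresses. -/
theorem lt_append_zero_iff (q v : List ℕ) : q < v ++ [0] ↔ q < v ∨ q = v := by
  induction v generalizing q with
  | nil => cases q <;> simp [List.cons_lt_cons_iff]
  | cons a v ih =>
    cases q with
    | nil => simp
    | cons b q =>
      simp only [List.cons_append, List.cons_lt_cons_iff, ih, List.cons.injEq]
      tauto

/-- Exactly the subtree at `u ++ [i]` fits between this address and that of the next sibling. -/
theorem lt_append_succ_iff (q u : List ℕ) (i : ℕ) :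
    q < u ++ [i + 1] ↔ q < u ++ [i] ∨ u ++ [i] <+: q := by
  induction u generalizing q with
  | nil =>
    cases q with
    | nil => simp
    | cons b q =>
      simp only [List.nil_append, List.cons_lt_cons_iff, List.cons_prefix_cons]
      simp
      omega
  | cons a u ih =>
    cases q with
    | nil => simp
    | cons b q =>
      simp only [List.cons_append, List.cons_lt_cons_iff, List.cons_prefix_cons, ih]
      constructor
      · rintro (h | ⟨h1, h2 | h2⟩) <;> simp_all
      · rintro ((h | ⟨h1, h2⟩) | ⟨h1, h2⟩) <;> simp_all

theorem lt_or_prefix_of_lt_append {q w r : List ℕ} (h : q < w ++ r) : q < w ∨ w <+: q := by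
  induction w generalizing q with
  | nil => simp
  | cons a w ih =>
    cases q with
    | nil => simp
    | cons b q =>
      simp only [List.cons_append, List.cons_lt_cons_iff, List.cons_prefix_cons] at h ⊢
      rcases h with h | ⟨h1, h2⟩
      · exact Or.inl (Or.inl h)
      · rcases ih h2 with h3 | h3
        · exact Or.inl (Or.inr ⟨h1, h3⟩)
        · exact Or.inr ⟨h1.symm, h3⟩

theorem lt_append_of_lt {q w : List ℕ} (h : q < w) (r : List ℕ) : q < w ++ r := by
  induction w generalizing q with
  | nil => simp at h
  | cons a w ih =>
    cases q with
    | nil => simp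
    | cons b q =>
      simp only [List.cons_append, List.cons_lt_cons_iff] at h ⊢
      rcases h with h | ⟨h1, h2⟩
      · exact Or.inl h
      · exact Or.inr ⟨h1, ih h2⟩

theorem append_lt_append_left (w : List ℕ) {q r : List ℕ} (h : q < r) : w ++ q < w ++ r := by
  induction w with
  | nil => exact h
  | cons a w ih => exact List.cons_lt_cons_iff.2 (Or.inr ⟨rfl, ih⟩)

end lex

theorem _root_.LeafData.Forest.mem_of_prefix (F : Forest) {u v : List ℕ} (h : u ++ v ∈ F.nodes)
    (hu : u ≠ []) : u ∈ F.nodes := by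
  induction v using List.reverseRecOn with
  | nil => simpa using h
  | append_singleton v i ih =>
    rw [← List.append_assoc] at h
    exact ih (F.parent_mem _ i (by simp [hu]) h)

theorem _root_.LeafData.Forest.mem_of_le (F : Forest) {u : List ℕ} {i j : ℕ}
    (h : u ++ [j] ∈ F.nodes) (hij : i ≤ j) : u ++ [i] ∈ F.nodes := by
  induction j with
  | zero => rwa [Nat.le_zero.1 hij]
  | succ j ih =>
    rcases Nat.of_le_succ hij with h1 | h1
    · exact ih (F.sibling_mem _ _ h) h1
    · rwa [h1]

theorem _root_.LeafData.Forest.eq_of_isLeaf_of_prefix (F : Forest) {p q : F.Node}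
    (hp : F.IsLeaf p) (h : p.1 <+: q.1) : q.1 = p.1 := by
  obtain ⟨r, hr⟩ := h
  cases r with
  | nil => rw [← hr, List.append_nil]
  | cons i r =>
    refine absurd (F.mem_of_prefix (u := p.1 ++ [i]) (v := r) ?_ (by simp)) (hp i)
    rw [List.append_assoc, List.singleton_append, hr]
    exact q.2

/-! ### Counter values and computations read off a model -/

section

variable {P : SVAS} {F : LeafDataForest (Fin (P.lines.length + 1))}

/-- The command at a node. -/
def commandOf (P : SVAS) (F : LeafDataForest (Fin (P.lines.length + 1))) (p : F.Node) :
    Option Command := P.commandAt (F.label p).val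

/-- All nodes satisfy the condition for their command. -/
def Consistent (P : SVAS) (F : LeafDataForest (Fin (P.lines.length + 1))) : Prop :=
  ∀ p, ∃ c, commandOf P F p = some c ∧ Condition F P.lines p c

theorem OccursAt.commandOf_inc {a : Name} {p : F.Node} (h : OccursAt F P.lines .inc a p) :
    commandOf P F p = some (.inc a) := by
  obtain ⟨l, h1, h2⟩ := h
  simp only [commandOf, SVAS.commandAt, h1, Option.map_some]
  exact congrArg some h2

theorem OccursAt.commandOf_dec {a : Name} {p : F.Node} (h : OccursAt F P.lines .dec a p) :
    commandOf P F p = some (.dec a) := by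
  obtain ⟨l, h1, h2⟩ := h
  simp only [commandOf, SVAS.commandAt, h1, Option.map_some]
  exact congrArg some h2

theorem OccursAt.commandOf_push {a : Name} {p : F.Node} (h : OccursAt F P.lines .push a p) :
    commandOf P F p = some (.push a) := by
  obtain ⟨l, h1, h2⟩ := h
  simp only [commandOf, SVAS.commandAt, h1, Option.map_some]
  exact congrArg some h2

theorem OccursAt.labelAt {a : Name} {p : F.Node} (h : OccursAt F P.lines .label a p) :
    P.labelAt (F.label p).val = some a := by
  obtain ⟨l, h1, h2⟩ := h
  simp only [SVAS.labelAt, h1, Option.bind_some]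
  exact h2

theorem Consistent.condition (hF : Consistent P F) {p : F.Node} {c : Command}
    (h : commandOf P F p = some c) : Condition F P.lines p c := by
  obtain ⟨d, h1, h2⟩ := hF p
  rw [h] at h1
  rwa [Option.some.inj h1]

theorem _root_.LeafData.LeafDataForest.SameData.symm {A : Type} {F : LeafDataForest A}
    {p q : F.Node} (h : F.SameData p q) : F.SameData q p := by
  obtain ⟨h1, h2, h3⟩ := h
  exact ⟨h2, h1, h3.symm⟩

theorem _root_.LeafData.LeafDataForest.SameData.trans {A : Type} {F : LeafDataForest A}
    {p q r : F.Node} (h : F.SameData p q) (h' : F.SameData q r) : F.SameData p r := by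
  obtain ⟨h1, h2, h3⟩ := h
  obtain ⟨h4, h5, h6⟩ := h'
  exact ⟨h1, h5, h3.trans h6⟩

open Classical in
/-- The nodes with the command `c` in `D`. -/
noncomputable def nodesWith (P : SVAS) (F : LeafDataForest (Fin (P.lines.length + 1)))
    (D : F.Node → Prop) (c : Command) : Finset F.Node :=
  Finset.univ.filter fun p => D p ∧ commandOf P F p = some c

theorem mem_nodesWith {D : F.Node → Prop} {c : Command} {p : F.Node} :
    p ∈ nodesWith P F D c ↔ D p ∧ commandOf P F p = some c := by
  simp [nodesWith]

/-- Sending a decrement to an earlier increment with the same datum is injective: if two decrements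
shared an image they would share a datum, and the condition at the later one would make the earlier
one an increment. Closure of `D` under earlier leaves keeps the image inside `D`. -/
theorem card_dec_le_card_inc (hF : Consistent P F) (D : F.Node → Prop)
    (hD : ∀ p q, D p → F.LeafPrec q p → D q) (x : Name) :
    (nodesWith P F D (.dec x)).card ≤ (nodesWith P F D (.inc x)).card := by
  have h : ∀ p, commandOf P F p = some (.dec x) →
      ∃ q, F.LeafPrec q p ∧ F.SameData p q ∧ commandOf P F q = some (.inc x) := by
    intro p hp
    obtain ⟨_, ⟨q, h1, h2⟩, h3⟩ := hF.condition hp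
    exact ⟨q, h1, h2, (h3 q h1 h2).commandOf_inc⟩
  choose! f hf1 hf2 hf3 using h
  refine Finset.card_le_card_of_injOn f (fun p hp => ?_) (fun p hp q hq hpq => ?_)
  · obtain ⟨h1, h2⟩ := mem_nodesWith.1 hp
    exact mem_nodesWith.2 ⟨hD p _ h1 (hf1 p h2), hf3 p h2⟩
  · have hp := (mem_nodesWith.1 hp).2
    have hq := (mem_nodesWith.1 hq).2
    have key : ∀ p q, commandOf P F p = some (.dec x) → commandOf P F q = some (.dec x) →
        f p = f q → ¬ p.1 < q.1 := by
      intro p q hp hq hpq hlt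
      have h3 : F.SameData q p := (hf2 q hq).trans (hpq ▸ (hf2 p hp).symm)
      have := ((hF.condition hq).2.2 p ⟨(hf1 p hp).2.1, (hf1 q hq).2.1, hlt⟩ h3).commandOf_inc
      rw [hp] at this
      simp at this
    exact Subtype.ext (le_antisymm (not_lt.1 (key q p hq hp hpq.symm)) (not_lt.1 (key p q hp hq hpq)))

/-- The dual injection goes to a later decrement, so it is available only for the set of all nodes.
-/
theorem card_inc_le_card_dec (hF : Consistent P F) (x : Name) :
    (nodesWith P F (fun _ => True) (.inc x)).card ≤
      (nodesWith P F (fun _ => True) (.dec x)).card := by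
  have h : ∀ p, commandOf P F p = some (.inc x) →
      ∃ q, F.LeafPrec p q ∧ F.SameData p q ∧ commandOf P F q = some (.dec x) := by
    intro p hp
    obtain ⟨_, ⟨q, h1, h2⟩, h3⟩ := hF.condition hp
    exact ⟨q, h1, h2, (h3 q h1 h2).commandOf_dec⟩
  choose! f hf1 hf2 hf3 using h
  refine Finset.card_le_card_of_injOn f (fun p hp => ?_) (fun p hp q hq hpq => ?_)
  · exact mem_nodesWith.2 ⟨trivial, hf3 p (mem_nodesWith.1 hp).2⟩
  · have hp := (mem_nodesWith.1 hp).2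
    have hq := (mem_nodesWith.1 hq).2
    have key : ∀ p q, commandOf P F p = some (.inc x) → commandOf P F q = some (.inc x) →
        f p = f q → ¬ p.1 < q.1 := by
      intro p q hp hq hpq hlt
      have h3 : F.SameData p q := (hf2 p hp).trans (hpq ▸ (hf2 q hq).symm)
      have := ((hF.condition hp).2.2 q ⟨(hf1 p hp).1, (hf1 q hq).1, hlt⟩ h3).commandOf_dec
      rw [hq] at this
      simp at this
    exact Subtype.ext (le_antisymm (not_lt.1 (key q p hq hp hpq.symm)) (not_lt.1 (key p q hp hq hpq)))

/-- The value of a counter before the command at the address `v` is executed. -/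
noncomputable def counterAt (P : SVAS) (F : LeafDataForest (Fin (P.lines.length + 1)))
    (v : List ℕ) (x : Name) : ℕ :=
  (nodesWith P F (fun p => p.1 < v) (.inc x)).card -
    (nodesWith P F (fun p => p.1 < v) (.dec x)).card

/-- The address `v'` is the next one after the node `p`. -/
def IsNext (F : Forest) (p : F.Node) (v' : List ℕ) : Prop :=
  ∀ q : F.Node, q.1 < v' ↔ q.1 < p.1 ∨ q = p

open Classical in
-- Passing to the next address adds just `p` to the nodes counted. Integers are used so that the two
-- counts can be subtracted without truncation.
theorem card_nodesWith_of_isNext {p : F.Node} {v' : List ℕ} (h : IsNext F.toForest p v')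
    (c : Command) :
    ((nodesWith P F (fun q => q.1 < v') c).card : ℤ) =
      (nodesWith P F (fun q => q.1 < p.1) c).card + if commandOf P F p = some c then 1 else 0 := by
  have hp : p ∉ nodesWith P F (fun q => q.1 < p.1) c := by simp [mem_nodesWith]
  split_ifs with hc
  · have : nodesWith P F (fun q => q.1 < v') c = insert p (nodesWith P F (fun q => q.1 < p.1) c) := by
      ext q
      simp only [mem_nodesWith, h q, Finset.mem_insert]
      constructor
      · rintro ⟨h1 | h1, h2⟩
        · exact Or.inr ⟨h1, h2⟩
        · exact Or.inl h1
      · rintro (rfl | ⟨h1, h2⟩)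
        · exact ⟨Or.inr rfl, hc⟩
        · exact ⟨Or.inl h1, h2⟩
    rw [this, Finset.card_insert_of_notMem hp]
    push_cast
    ring
  · have : nodesWith P F (fun q => q.1 < v') c = nodesWith P F (fun q => q.1 < p.1) c := by
      ext q
      simp only [mem_nodesWith, h q]
      constructor
      · rintro ⟨h1 | rfl, h2⟩
        · exact ⟨h1, h2⟩
        · exact absurd h2 hc
      · rintro ⟨h1, h2⟩
        exact ⟨Or.inl h1, h2⟩
    rw [this]
    simp

/-- The subtraction is not truncated, because the nodes before an address are closed under earlier
leaves. -/
theorem cast_counterAt (hF : Consistent P F) (v : List ℕ) (x : Name) :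
    (counterAt P F v x : ℤ) = (nodesWith P F (fun p => p.1 < v) (.inc x)).card -
      (nodesWith P F (fun p => p.1 < v) (.dec x)).card :=
  Nat.cast_sub (card_dec_le_card_inc hF _ (fun _ _ h1 h2 => lt_trans (show _ < _ from h2.2.2) h1) x)

open Classical in
theorem counterAt_of_isNext (hF : Consistent P F) {p : F.Node} {v' : List ℕ}
    (h : IsNext F.toForest p v') (x : Name) :
    (counterAt P F v' x : ℤ) = counterAt P F p.1 x +
      (if commandOf P F p = some (.inc x) then 1 else 0) -
      (if commandOf P F p = some (.dec x) then 1 else 0) := by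
  rw [cast_counterAt hF, cast_counterAt hF, card_nodesWith_of_isNext h, card_nodesWith_of_isNext h]
  ring

theorem isNext_succ_of_isLeaf (F : Forest) {p : F.Node} {u : List ℕ} {i : ℕ} (hp : p.1 = u ++ [i])
    (hl : F.IsLeaf p) : IsNext F p (u ++ [i + 1]) := by
  intro q
  rw [lt_append_succ_iff, ← hp]
  refine or_congr_right ⟨fun h => Subtype.ext (F.eq_of_isLeaf_of_prefix hl h), fun h => ?_⟩
  rw [h]

theorem isNext_append_zero (F : Forest) (p : F.Node) : IsNext F p (p.1 ++ [0]) := by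
  intro q
  rw [lt_append_zero_iff, Subtype.ext_iff]

/-- This is the situation of a `pop`: the subtree of `p` ends with its last child `r`, a leaf, so
document order continues with the next sibling of `p`. -/
theorem isNext_of_last (F : Forest) {p r : F.Node} {u : List ℕ} {i j : ℕ} (hp : p.1 = u ++ [i])
    (hr : r.1 = p.1 ++ [j]) (hl : F.IsLeaf r) (hj : p.1 ++ [j + 1] ∉ F.nodes) :
    IsNext F r (u ++ [i + 1]) := by
  intro q
  rw [lt_append_succ_iff, ← hp, ← isNext_succ_of_isLeaf F hr hl q]
  constructor
  · rintro (h | ⟨s, hs⟩)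
    · exact lt_append_of_lt h _
    · rw [← hs]
      refine append_lt_append_left _ ?_
      cases s with
      | nil => simp
      | cons k s =>
        -- A descendant of `p` passes through some child number `k`, and `k ≤ j` because the child
        -- number `j + 1` is missing.
        rw [List.cons_lt_cons_iff]
        refine Or.inl (Nat.lt_succ_of_le (not_lt.1 fun hk => hj ?_))
        refine F.mem_of_le (j := k) (F.mem_of_prefix (v := s) ?_ (by simp)) hk
        rw [List.append_assoc, List.singleton_append, hs]
        exact q.2
  · exact lt_or_prefix_of_lt_append

theorem commandAt_eq_of_commandOf {p : F.Node} {c : Command} (h : commandOf P F p = some c) :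
    P.commandAt (F.label p).val = some c := h

theorem commandOf_injective {p : F.Node} {c d : Command} (h : commandOf P F p = some c)
    (h' : commandOf P F p = some d) : c = d := Option.some.inj (h.symm.trans h')

theorem counterAt_inc (hF : Consistent P F) {p : F.Node} {v' : List ℕ} {x : Name}
    (h : IsNext F.toForest p v') (hp : commandOf P F p = some (.inc x)) :
    counterAt P F v' = Function.update (counterAt P F p.1) x (counterAt P F p.1 x + 1) := by
  classical
  funext z
  have h1 := counterAt_of_isNext hF h z
  by_cases hz : z = x
  · subst hz
    simp [hp] at h1 ⊢
    omega
  · simp [hp, Ne.symm hz] at h1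
    simp [hz, h1]

theorem counterAt_dec (hF : Consistent P F) {p : F.Node} {v' : List ℕ} {x : Name}
    (h : IsNext F.toForest p v') (hp : commandOf P F p = some (.dec x)) :
    0 < counterAt P F p.1 x ∧
      counterAt P F v' = Function.update (counterAt P F p.1) x (counterAt P F p.1 x - 1) := by
  classical
  have h0 := counterAt_of_isNext hF h x
  simp [hp] at h0
  refine ⟨by omega, ?_⟩
  funext z
  have h1 := counterAt_of_isNext hF h z
  by_cases hz : z = x
  · subst hz
    simp [hp] at h1 ⊢
    omega
  · simp [hp, Ne.symm hz] at h1
    simp [hz, h1]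

theorem counterAt_eq_of_isNext (hF : Consistent P F) {p : F.Node} {v' : List ℕ} {c : Command}
    (h : IsNext F.toForest p v') (hp : commandOf P F p = some c) (hi : ∀ x, c ≠ .inc x)
    (hd : ∀ x, c ≠ .dec x) : counterAt P F v' = counterAt P F p.1 := by
  classical
  funext z
  have h1 := counterAt_of_isNext hF h z
  simpa [hp, hi, hd] using h1

theorem nextSibling_iff (F : Forest) {p q : F.Node} {u : List ℕ} {i : ℕ} (hp : p.1 = u ++ [i]) :
    F.NextSibling p q ↔ q.1 = u ++ [i + 1] := by
  constructor
  · rintro ⟨u', i', h1, h2⟩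
    rw [hp] at h1
    obtain ⟨rfl, h3⟩ := List.append_inj' h1 rfl
    simp only [List.cons.injEq, and_true] at h3
    rw [h2, h3]
  · exact fun h => ⟨u, i, hp, h⟩

/-- The computation along the siblings to the right of a node. -/
theorem exists_reaches_last (hF : Consistent P F) (p : F.Node) : ∀ (u : List ℕ) (i : ℕ),
    p.1 = u ++ [i] → ∀ s : List Name, ∃ (q : F.Node) (j : ℕ), q.1 = u ++ [j] ∧
      u ++ [j + 1] ∉ F.nodes ∧ F.IsLeaf q ∧
      ((∃ a, commandOf P F q = some (.pop a)) ∨ commandOf P F q = some .halt) ∧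
      Relation.ReflTransGen P.Step ⟨(F.label p).val, counterAt P F p.1, s⟩
        ⟨(F.label q).val, counterAt P F q.1, s⟩ := by
  -- Induction from the end of the document order: first children and next siblings are both larger
  -- than the node.
  induction p using WellFoundedGT.induction with
  | ind p ih =>
  intro u i hp s
  obtain ⟨c, hc, hcond⟩ := hF p
  have hc' := commandAt_eq_of_commandOf hc
  have next_gt : ∀ q : F.Node, q.1 = u ++ [i + 1] → p < q := by
    intro q hq
    show p.1 < q.1
    rw [hp, hq]
    exact append_lt_append_left _ (List.cons_lt_cons_iff.2 (Or.inl (Nat.lt_succ_self i)))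
  have leaf_of_noChild : (¬∃ q, F.Child p q) → F.IsLeaf p := fun h j hj => h ⟨⟨_, hj⟩, j, rfl⟩
  have last_of_noNext : (¬∃ q, F.NextSibling p q) → u ++ [i + 1] ∉ F.nodes :=
    fun h hj => h ⟨⟨_, hj⟩, (nextSibling_iff _ hp).2 rfl⟩
  cases c with
  | inc x =>
    obtain ⟨⟨q, hq, hlab⟩, ⟨r, hr, _⟩, _⟩ := hcond
    have hq' := (nextSibling_iff _ hp).1 hq
    obtain ⟨e, j, h1, h2, h3, h4, h5⟩ := ih q (next_gt q hq') u (i + 1) hq' s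
    refine ⟨e, j, h1, h2, h3, h4, .head ?_ h5⟩
    rw [hq', hlab, counterAt_inc hF (isNext_succ_of_isLeaf _ hp hr.1) hc]
    exact .inc hc'
  | dec x =>
    obtain ⟨⟨q, hq, hlab⟩, ⟨r, hr, _⟩, _⟩ := hcond
    have hq' := (nextSibling_iff _ hp).1 hq
    obtain ⟨e, j, h1, h2, h3, h4, h5⟩ := ih q (next_gt q hq') u (i + 1) hq' s
    refine ⟨e, j, h1, h2, h3, h4, .head ?_ h5⟩
    obtain ⟨h6, h7⟩ := counterAt_dec hF (isNext_succ_of_isLeaf _ hp hr.2.1) hc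
    rw [hq', hlab, h7]
    exact .dec hc' h6
  | goto L L' =>
    obtain ⟨hl, q, hq, hlab⟩ := hcond
    have hq' := (nextSibling_iff _ hp).1 hq
    obtain ⟨e, j, h1, h2, h3, h4, h5⟩ := ih q (next_gt q hq') u (i + 1) hq' s
    refine ⟨e, j, h1, h2, h3, h4, .head ?_ h5⟩
    rw [hq', counterAt_eq_of_isNext hF (isNext_succ_of_isLeaf _ hp (leaf_of_noChild hl)) hc
      (by simp) (by simp)]
    exact .goto hc' (hlab.imp OccursAt.labelAt OccursAt.labelAt)
  | pop a =>
    exact ⟨p, i, hp, last_of_noNext hcond.2.1, leaf_of_noChild hcond.1, Or.inl ⟨a, hc⟩, .refl⟩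
  | halt =>
    exact ⟨p, i, hp, last_of_noNext hcond.2.1, leaf_of_noChild hcond.1, Or.inr hc, .refl⟩
  | push a =>
    obtain ⟨q, ⟨k, hk⟩, hlab, hq⟩ := hcond
    -- A child without previous sibling has index `0`.
    have hk0 : k = 0 := by
      rcases k with _ | k
      · rfl
      · have hmem : p.1 ++ [k] ∈ F.nodes := F.sibling_mem _ _ (by rw [← hk]; exact q.2)
        exact absurd ⟨⟨_, hmem⟩, p.1, k, rfl, hk⟩ hq
    subst hk0
    have hpq : p < q := by
      show p.1 < q.1
      rw [hk, lt_append_zero_iff]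
      exact Or.inr rfl
    -- The excursion through the children starts and ends with the stack `a :: s`; the remaining
    -- computation starts at the next sibling of `p` with the stack `s`.
    obtain ⟨e, j, h1, h2, h3, h4, h5⟩ := ih q hpq p.1 0 hk (a :: s)
    rcases h4 with ⟨b, hb⟩ | hb
    · obtain ⟨_, _, p', ⟨j', hj'⟩, ⟨r, hr, hlab'⟩, hocc⟩ := hF.condition hb
      obtain rfl : p' = p := by
        rw [h1] at hj'
        exact Subtype.ext (List.append_inj' hj' rfl).1.symm
      -- The condition for the final `pop b` requires that its parent, which is `p`, pushes `b`.
      obtain rfl : b = a := by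
        have := commandOf_injective hocc.commandOf_push hc
        simpa using this
      have hr' := (nextSibling_iff _ hp).1 hr
      obtain ⟨e', j'', h1', h2', h3', h4', h5'⟩ := ih r (next_gt r hr') u (i + 1) hr' s
      refine ⟨e', j'', h1', h2', h3', h4', .head (b := ⟨(F.label q).val, counterAt P F q.1, b :: s⟩)
        ?_ (h5.trans (.head ?_ h5'))⟩
      · rw [hk, counterAt_eq_of_isNext hF (isNext_append_zero _ p') hc (by simp) (by simp), hlab]
        exact .push hc'
      · rw [hr', counterAt_eq_of_isNext hF (isNext_of_last _ hp h1 h3 h2) hb (by simp) (by simp),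
          hlab']
        exact .pop (commandAt_eq_of_commandOf hb)
    -- A `halt` node has no parent, so it cannot end the excursion.
    · exact absurd ⟨p, j, h1⟩ (hF.condition hb).2.2

/-- The computation along the roots ends at the last root. That node cannot be a `pop`, which needs
a parent, so it is `halt`. All other nodes precede it, hence the final counter values compare the
total numbers of increments and decrements. -/
theorem reachable_of_satisfiable (P : SVAS) (h : (sentence P).Satisfiable) : P.Reachable := by
  obtain ⟨F, hF⟩ : ∃ F : LeafDataForest (Fin (P.lines.length + 1)),
      (formula P.lines).Holds F fun _ => none := h
  obtain ⟨⟨p⟩, hinit, hcond⟩ := (holds_formula P F).1 hF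
  have hF : Consistent P F := fun p => by
    obtain ⟨l, h1, h2⟩ := hcond p
    exact ⟨l.command, by simp [commandOf, SVAS.commandAt, h1], h2⟩
  -- Closure under prefixes and previous siblings leads from any node to the first root.
  have hroot : [0] ∈ F.nodes := by
    obtain ⟨u, hu⟩ := p
    cases u with
    | nil => exact absurd hu F.nil_notMem
    | cons k u => exact F.mem_of_le (u := []) (F.mem_of_prefix (u := [k]) hu (by simp)) (Nat.zero_le k)
  have hlab : (F.label ⟨[0], hroot⟩).val = 0 := by
    refine hinit _ ?_
    rintro ⟨q, ⟨u, i, _, h2⟩ | ⟨i, h2⟩⟩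
    · obtain ⟨_, h3⟩ := List.append_inj' (s₁ := []) (t₁ := [0]) h2 rfl
      simp at h3
    · obtain ⟨h3, _⟩ := List.append_inj' (s₁ := []) (t₁ := [0]) h2 rfl
      exact F.nil_notMem (by rw [h3]; exact q.2)
  obtain ⟨q, j, h1, h2, h3, h4, h5⟩ := exists_reaches_last hF ⟨[0], hroot⟩ [] 0 rfl []
  have hq : commandOf P F q = some .halt := by
    rcases h4 with ⟨a, ha⟩ | h4
    · obtain ⟨_, _, p', ⟨i, hi⟩, _⟩ := hF.condition ha
      rw [h1] at hi
      refine absurd p'.2 ?_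
      rw [← (List.append_inj' (s₁ := []) (t₁ := [j]) hi rfl).1]
      exact F.nil_notMem
    · exact h4
  have hmax : ∀ r : F.Node, r ≠ q → r.1 < q.1 := by
    intro r hr
    have := isNext_succ_of_isLeaf F.toForest h1 h3 r
    refine (this.1 ?_).resolve_right hr
    obtain ⟨v, hv⟩ := r
    cases v with
    | nil => exact absurd hv F.nil_notMem
    | cons k v =>
      refine List.cons_lt_cons_iff.2 (Or.inl (Nat.lt_succ_of_le (not_lt.1 fun hk => h2 ?_)))
      exact F.mem_of_le (u := []) (F.mem_of_prefix (u := [k]) hv (by simp)) hk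
  have hzero : ∀ x, counterAt P F q.1 x = 0 := by
    intro x
    -- Only the `halt` node itself is not before `q`, so counting before `q` counts all increments
    -- and decrements.
    have e : ∀ c, c ≠ .halt → nodesWith P F (fun p => p.1 < q.1) c =
        nodesWith P F (fun _ => True) c := by
      intro c hc
      ext r
      simp only [mem_nodesWith, true_and, and_iff_right_iff_imp]
      intro hr
      refine hmax r ?_
      rintro rfl
      exact hc (commandOf_injective hr hq)
    rw [counterAt, e _ (by simp), e _ (by simp)]
    exact Nat.sub_eq_zero_of_le (card_inc_le_card_dec hF x)
  have hstart : ∀ x, counterAt P F [0] x = 0 := by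
    intro x
    have : nodesWith P F (fun p => p.1 < [0]) (.inc x) = ∅ := by
      refine Finset.eq_empty_of_forall_notMem fun r hr => ?_
      have h6 := (mem_nodesWith.1 hr).1
      rcases (lt_append_zero_iff r.1 []).1 h6 with h7 | h7
      · simp at h7
      · exact F.nil_notMem (h7 ▸ r.2)
    simp [counterAt, this]
  refine ⟨_, commandAt_eq_of_commandOf hq, ?_⟩
  rw [hlab, show counterAt P F [0] = fun _ => 0 from funext hstart,
    show counterAt P F q.1 = fun _ => 0 from funext hzero] at h5
  exact h5

end

end SVASReduction

/-! ## From computations to models -/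

namespace SVASReduction

open StackVAS LeafData

/-! ### Data -/

/-- The commands `κ` at the addresses `N` are those of a computation with final counter values `c`,
where matching increments and decrements have the same datum. -/
structure DataInv (N : Finset (List ℕ)) (κ : List ℕ → Option Command) (dat : List ℕ → ℕ)
    (c : Name → ℕ) : Prop where
  eq_imp : ∀ p ∈ N, ∀ q ∈ N, p < q → dat p = dat q → ∃ x, κ p = some (.inc x) ∧ κ q = some (.dec x)
  exists_inc : ∀ q ∈ N, ∀ x, κ q = some (.dec x) → ∃ p ∈ N, p < q ∧ dat p = dat q
  card_pending : ∀ x, {p ∈ (N : Set (List ℕ)) | κ p = some (.inc x) ∧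
    ∀ q ∈ N, dat q = dat p → q = p}.ncard = c x

variable {N : Finset (List ℕ)} {κ : List ℕ → Option Command} {dat : List ℕ → ℕ} {c : Name → ℕ}
  {v : List ℕ}

theorem DataInv.congr (h : DataInv N κ dat c) {κ' : List ℕ → Option Command}
    (hκ : ∀ p ∈ N, κ' p = κ p) : DataInv N κ' dat c where
  eq_imp p hp q hq h1 h2 := by
    obtain ⟨x, h3, h4⟩ := h.eq_imp p hp q hq h1 h2
    exact ⟨x, by rw [hκ p hp, h3], by rw [hκ q hq, h4]⟩
  exists_inc q hq x h1 := h.exists_inc q hq x (by rw [← hκ q hq, h1])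
  card_pending x := by
    rw [← h.card_pending x]
    congr 1
    ext p
    simp only [Set.mem_ofPred_eq]
    exact and_congr_right fun hp => by rw [hκ p hp]

/-- A fresh datum forms a class of its own. It makes a new increment pending and leaves the status
of all old nodes unchanged. -/
theorem DataInv.insert_fresh (h : DataInv N κ dat c) (hv : ∀ p ∈ N, p < v)
    (hd : ∀ x, κ v ≠ some (.dec x)) {c' : Name → ℕ}
    (hc : ∀ x, c' x = c x ∧ κ v ≠ some (.inc x) ∨ c' x = c x + 1 ∧ κ v = some (.inc x)) :
    ∃ dat', DataInv (insert v N) κ dat' c' := by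
  obtain ⟨d, hfresh⟩ : ∃ d, ∀ p ∈ N, dat p ≠ d := by
    obtain ⟨d, hd⟩ := Infinite.exists_notMem_finset (N.image dat)
    exact ⟨d, fun p hp h => hd (Finset.mem_image.2 ⟨p, hp, h⟩)⟩
  have hvN : v ∉ N := fun h => lt_irrefl _ (hv v h)
  have hne : ∀ p ∈ N, p ≠ v := fun p hp h => hvN (h ▸ hp)
  have hdat : ∀ p ∈ N, Function.update dat v d p = dat p := fun p hp =>
    Function.update_of_ne (hne p hp) _ _
  have hdatv : Function.update dat v d v = d := Function.update_self _ _ _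
  refine ⟨Function.update dat v d, ?_, ?_, ?_⟩
  · intro p hp q hq h1 h2
    rcases Finset.mem_insert.1 hp with hpv | hp <;> rcases Finset.mem_insert.1 hq with hqv | hq
    · exact absurd h1 (by rw [hpv, hqv]; exact lt_irrefl _)
    · exact absurd h1 (lt_asymm (by rw [hpv]; exact hv q hq))
    · rw [hdat p hp, hqv, hdatv] at h2
      exact absurd h2 (hfresh p hp)
    · rw [hdat p hp, hdat q hq] at h2
      exact h.eq_imp p hp q hq h1 h2
  · intro q hq x h1
    rcases Finset.mem_insert.1 hq with rfl | hq
    · exact absurd h1 (hd x)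
    · obtain ⟨p, hp, h2, h3⟩ := h.exists_inc q hq x h1
      exact ⟨p, Finset.mem_insert_of_mem hp, h2, by rw [hdat p hp, hdat q hq, h3]⟩
  · intro x
    have key : ∀ p ∈ N, ((∀ q ∈ insert v N, Function.update dat v d q = Function.update dat v d p →
        q = p) ↔ ∀ q ∈ N, dat q = dat p → q = p) := by
      intro p hp
      rw [hdat p hp]
      constructor
      · intro h1 q hq h2
        exact h1 q (Finset.mem_insert_of_mem hq) (by rw [hdat q hq, h2])
      · intro h1 q hq h2
        rcases Finset.mem_insert.1 hq with rfl | hq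
        · rw [hdatv] at h2
          exact absurd h2.symm (hfresh p hp)
        · exact h1 q hq (by rw [← hdat q hq, h2])
    rcases hc x with ⟨h1, h2⟩ | ⟨h1, h2⟩
    · rw [h1, ← h.card_pending x]
      congr 1
      ext p
      simp only [Finset.coe_insert, Set.mem_insert_iff, Finset.mem_coe, Set.mem_ofPred_eq]
      constructor
      · rintro ⟨rfl | hp, h3, h4⟩
        · exact absurd h3 h2
        · exact ⟨hp, h3, (key p hp).1 h4⟩
      · rintro ⟨hp, h3, h4⟩
        exact ⟨Or.inr hp, h3, (key p hp).2 h4⟩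
    · rw [h1, ← h.card_pending x, ← Set.ncard_insert_of_notMem (a := v)]
      · congr 1
        ext p
        simp only [Finset.coe_insert, Set.mem_insert_iff, Finset.mem_coe, Set.mem_ofPred_eq]
        constructor
        · rintro ⟨rfl | hp, h3, h4⟩
          · exact Or.inl rfl
          · exact Or.inr ⟨hp, h3, (key p hp).1 h4⟩
        · rintro (rfl | ⟨hp, h3, h4⟩)
          · refine ⟨Or.inl rfl, h2, fun q hq h5 => ?_⟩
            rcases Finset.mem_insert.1 hq with rfl | hq
            · rfl
            · rw [hdat q hq, hdatv] at h5
              exact absurd h5 (hfresh q hq)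
          · exact ⟨Or.inr hp, h3, (key p hp).2 h4⟩
      · exact fun h => hvN h.1

theorem DataInv.insert_other (h : DataInv N κ dat c) (hv : ∀ p ∈ N, p < v)
    (hi : ∀ x, κ v ≠ some (.inc x)) (hd : ∀ x, κ v ≠ some (.dec x)) :
    ∃ dat', DataInv (insert v N) κ dat' c :=
  h.insert_fresh hv hd fun x => Or.inl ⟨rfl, hi x⟩

theorem DataInv.insert_inc (h : DataInv N κ dat c) (hv : ∀ p ∈ N, p < v) {x : Name}
    (hx : κ v = some (.inc x)) :
    ∃ dat', DataInv (insert v N) κ dat' (Function.update c x (c x + 1)) := by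
  refine h.insert_fresh hv (by simp [hx]) fun z => ?_
  by_cases hz : z = x
  · subst hz; exact Or.inr ⟨by simp, hx⟩
  · exact Or.inl ⟨by simp [hz], by simp [hx, Ne.symm hz]⟩

/-- A positive counter has a pending increment `r`, whose datum is given to the new node. Then `r`
ceases to be pending, and nothing else changes. -/
theorem DataInv.insert_dec (h : DataInv N κ dat c) (hv : ∀ p ∈ N, p < v) {x : Name}
    (hx : κ v = some (.dec x)) (hc : 0 < c x) :
    ∃ dat', DataInv (insert v N) κ dat' (Function.update c x (c x - 1)) := by
  obtain ⟨r, hr, hrx, hru⟩ : {p ∈ (N : Set (List ℕ)) | κ p = some (.inc x) ∧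
      ∀ q ∈ N, dat q = dat p → q = p}.Nonempty := by
    refine Set.nonempty_of_ncard_ne_zero ?_
    rw [h.card_pending x]
    exact hc.ne'
  have hvN : v ∉ N := fun h => lt_irrefl _ (hv v h)
  have hne : ∀ p ∈ N, p ≠ v := fun p hp h => hvN (h ▸ hp)
  have hdat : ∀ p ∈ N, Function.update dat v (dat r) p = dat p := fun p hp =>
    Function.update_of_ne (hne p hp) _ _
  have hdatv : Function.update dat v (dat r) v = dat r := Function.update_self _ _ _
  refine ⟨Function.update dat v (dat r), ?_, ?_, ?_⟩
  · intro p hp q hq h1 h2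
    rcases Finset.mem_insert.1 hp with hpv | hp <;> rcases Finset.mem_insert.1 hq with hqv | hq
    · exact absurd h1 (by rw [hpv, hqv]; exact lt_irrefl _)
    · exact absurd h1 (lt_asymm (by rw [hpv]; exact hv q hq))
    · rw [hdat p hp, hqv, hdatv] at h2
      -- Since `r` was pending, it is the only old node with this datum.
      obtain rfl := hru p hp h2
      exact ⟨x, hrx, by rw [hqv, hx]⟩
    · rw [hdat p hp, hdat q hq] at h2
      exact h.eq_imp p hp q hq h1 h2
  · intro q hq y h1
    rcases Finset.mem_insert.1 hq with rfl | hq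
    · exact ⟨r, Finset.mem_insert_of_mem hr, hv r hr, by rw [hdat r hr, hdatv]⟩
    · obtain ⟨p, hp, h2, h3⟩ := h.exists_inc q hq y h1
      exact ⟨p, Finset.mem_insert_of_mem hp, h2, by rw [hdat p hp, hdat q hq, h3]⟩
  · intro y
    -- An old node remains pending exactly if it is not the increment `r` that has just been
    -- matched.
    have key : ∀ p ∈ N, ((∀ q ∈ insert v N, Function.update dat v (dat r) q =
        Function.update dat v (dat r) p → q = p) ↔ (∀ q ∈ N, dat q = dat p → q = p) ∧ p ≠ r) := by
      intro p hp
      rw [hdat p hp]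
      constructor
      · intro h1
        refine ⟨fun q hq h2 => h1 q (Finset.mem_insert_of_mem hq) (by rw [hdat q hq, h2]), ?_⟩
        rintro rfl
        exact hvN ((h1 v (Finset.mem_insert_self _ _) hdatv) ▸ hp)
      · rintro ⟨h1, h3⟩ q hq h2
        rcases Finset.mem_insert.1 hq with rfl | hq
        · rw [hdatv] at h2
          exact absurd (h1 r hr h2).symm h3
        · exact h1 q hq (by rw [← hdat q hq, h2])
    have e : {p ∈ ((insert v N : Finset (List ℕ)) : Set (List ℕ)) | κ p = some (.inc y) ∧
        ∀ q ∈ insert v N, Function.update dat v (dat r) q = Function.update dat v (dat r) p →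
          q = p} = {p ∈ (N : Set (List ℕ)) | κ p = some (.inc y) ∧
        ∀ q ∈ N, dat q = dat p → q = p} \ {r} := by
      ext p
      simp only [Finset.coe_insert, Set.mem_insert_iff, Finset.mem_coe, Set.mem_ofPred_eq,
        Set.mem_sdiff, Set.mem_singleton_iff]
      constructor
      · rintro ⟨rfl | hp, h3, h4⟩
        · rw [hx] at h3
          simp at h3
        · exact ⟨⟨hp, h3, ((key p hp).1 h4).1⟩, ((key p hp).1 h4).2⟩
      · rintro ⟨⟨hp, h3, h4⟩, h5⟩
        exact ⟨Or.inr hp, h3, (key p hp).2 ⟨h4, h5⟩⟩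
    rw [e]
    by_cases hy : y = x
    · subst hy
      rw [Function.update_self, ← h.card_pending y]
      exact Set.ncard_sdiff_singleton_of_mem ⟨hr, hrx, hru⟩
    · rw [Function.update_of_ne hy, ← h.card_pending y, Set.sdiff_singleton_eq_self]
      rintro ⟨_, h3, _⟩
      rw [hrx] at h3
      simp only [Option.some.injEq, Command.inc.injEq] at h3
      exact hy h3.symm

/-! ### Addresses -/

/-- The node `u` and its ancestors are labelled by `push` commands for the symbols on the stack `s`,
and have no child yet that is labelled by a `pop` command. -/
inductive Open (N : Finset (List ℕ)) (κ : List ℕ → Option Command) : List ℕ → List Name → Prop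
  | nil : Open N κ [] []
  | cons {u i s a} : Open N κ u s → u ++ [i] ∈ N → κ (u ++ [i]) = some (.push a) →
      (∀ j b, u ++ [i] ++ [j] ∈ N → κ (u ++ [i] ++ [j]) ≠ some (.pop b)) →
      Open N κ (u ++ [i]) (a :: s)

theorem Open.congr {u : List ℕ} {s : List Name} (h : Open N κ u s) {κ' : List ℕ → Option Command}
    (hκ : ∀ p ∈ N, κ' p = κ p) : Open N κ' u s := by
  induction h with
  | nil => exact .nil
  | cons _ h1 h2 h3 ih =>
    exact .cons ih h1 (by rw [hκ _ h1, h2]) fun j b hj => by rw [hκ _ hj]; exact h3 j b hj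

/-- Only a `pop` that becomes a child of `u` or of an ancestor could do harm. Bounding the length of
the parent is enough; a `pop` placed below `u` is too deep to be such a child. -/
theorem Open.insert_node {u : List ℕ} {s : List Name} (h : Open N κ u s)
    (hv : ∀ w j b, w.length ≤ u.length → v = w ++ [j] → κ v ≠ some (.pop b)) :
    Open (insert v N) κ u s := by
  induction h with
  | nil => exact .nil
  | @cons u i s a _ h1 h2 h3 ih =>
    refine .cons (ih fun w j b hw => hv w j b (by simp; omega)) (Finset.mem_insert_of_mem h1) h2 ?_
    intro j b hj
    rcases Finset.mem_insert.1 hj with hj | hj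
    · rw [hj]
      exact hv _ j b le_rfl hj.symm
    · exact h3 j b hj

/-- The condition for the command at the address `q`, for the set `M` of nodes with labels
`lab`. -/
def Fits (P : SVAS) (M : Finset (List ℕ)) (lab : List ℕ → ℕ) (q : List ℕ) : Command → Prop
  | .inc _ | .dec _ => (∀ j, q ++ [j] ∉ M) ∧
      ∃ w k, q = w ++ [k] ∧ w ++ [k + 1] ∈ M ∧ lab (w ++ [k + 1]) = lab q + 1
  | .push _ => q ++ [0] ∈ M ∧ lab (q ++ [0]) = lab q + 1
  | .pop a => (∀ j, q ++ [j] ∉ M) ∧ ∃ w k l, q = w ++ [k] ++ [l] ∧ w ++ [k] ++ [l + 1] ∉ M ∧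
      w ++ [k] ∈ M ∧ P.commandAt (lab (w ++ [k])) = some (.push a) ∧
      w ++ [k + 1] ∈ M ∧ lab (w ++ [k + 1]) = lab q + 1
  | .goto L L' => (∀ j, q ++ [j] ∉ M) ∧
      ∃ w k, q = w ++ [k] ∧ w ++ [k + 1] ∈ M ∧
        (P.labelAt (lab (w ++ [k + 1])) = some L ∨ P.labelAt (lab (w ++ [k + 1])) = some L')
  | .halt => False

/-- Requirements that a node exists, or has a certain label, persist when nodes are added. Only
absences are at risk: children of a node that does not push, and a next sibling of a `pop`; `h1` and
`h2` exclude these. -/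
theorem Fits.insert_node {P : SVAS} {M : Finset (List ℕ)} {lab : List ℕ → ℕ} {q : List ℕ} {e : Command}
    (h : Fits P M lab q e) {m : ℕ} (hq : q ∈ M) (hv : v ∉ M)
    (h1 : (∀ a, e ≠ .push a) → ∀ j, v ≠ q ++ [j])
    (h2 : ∀ a, e = .pop a → ∀ w k l, q = w ++ [k] ++ [l] → v ≠ w ++ [k] ++ [l + 1]) :
    Fits P (insert v M) (Function.update lab v m) q e := by
  have hlab : ∀ p ∈ M, Function.update lab v m p = lab p := fun p hp =>
    Function.update_of_ne (by rintro rfl; exact hv hp) _ _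
  have hno : (∀ a, e ≠ .push a) → (∀ j, q ++ [j] ∉ M) → ∀ j, q ++ [j] ∉ insert v M := by
    intro he hj j hmem
    rcases Finset.mem_insert.1 hmem with h3 | h3
    · exact h1 he j h3.symm
    · exact hj j h3
  cases e with
  | inc x | dec x =>
    obtain ⟨h3, w, k, h4, h5, h6⟩ := h
    exact ⟨hno (by simp) h3, w, k, h4, Finset.mem_insert_of_mem h5, by rw [hlab _ h5, hlab _ hq, h6]⟩
  | push a =>
    obtain ⟨h3, h4⟩ := h
    exact ⟨Finset.mem_insert_of_mem h3, by rw [hlab _ h3, hlab _ hq, h4]⟩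
  | pop a =>
    obtain ⟨h3, w, k, l, h4, h5, h6, h7, h8, h9⟩ := h
    refine ⟨hno (by simp) h3, w, k, l, h4, ?_, Finset.mem_insert_of_mem h6, by rw [hlab _ h6, h7],
      Finset.mem_insert_of_mem h8, by rw [hlab _ h8, hlab _ hq, h9]⟩
    intro hmem
    rcases Finset.mem_insert.1 hmem with h10 | h10
    · exact h2 a rfl w k l h4 h10.symm
    · exact h5 h10
  | goto L L' =>
    obtain ⟨h3, w, k, h4, h5, h6⟩ := h
    exact ⟨hno (by simp) h3, w, k, h4, Finset.mem_insert_of_mem h5, by rwa [hlab _ h5]⟩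
  | halt => exact h

/-- The nodes `N` for the commands executed so far, the next node `u ++ [i]`, and the stack `s`. -/
structure AddressInv (P : SVAS) (N : Finset (List ℕ)) (lab : List ℕ → ℕ) (u : List ℕ) (i : ℕ)
    (s : List Name) : Prop where
  nil_notMem : [] ∉ N
  parent_mem : ∀ w k, w ≠ [] → w ++ [k] ∈ N → w ∈ N
  sibling_mem : ∀ w k, w ++ [k + 1] ∈ N → w ++ [k] ∈ N
  prev_mem : ∀ k, i = k + 1 → u ++ [k] ∈ N
  lt : ∀ q ∈ N, q < u ++ [i]
  lab_root : lab [0] = 0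
  opened : Open N (fun q => P.commandAt (lab q)) u s
  -- The next node is included because the condition for the command just executed refers to it and
  -- its label.
  fits : ∀ q ∈ N, ∃ e, P.commandAt (lab q) = some e ∧ Fits P (insert (u ++ [i]) N) lab q e

variable {P : SVAS} {lab : List ℕ → ℕ} {u u' : List ℕ} {i i' : ℕ} {s s' : List Name}

theorem Open.mem (h : Open N κ u s) (hu : u ≠ []) : u ∈ N ∧ ∃ a, κ u = some (.push a) := by
  cases h with
  | nil => exact absurd rfl hu
  | cons _ h1 h2 _ => exact ⟨h1, _, h2⟩

theorem AddressInv.notMem (h : AddressInv P N lab u i s) : u ++ [i] ∉ N :=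
  fun h' => lt_irrefl _ (h.lt _ h')

/-- Old nodes keep their conditions thanks to `Open`: the parent of the next node is a `push`, so no
other command acquires a child, and it has no `pop` child yet, so no `pop` acquires a next sibling.
-/
theorem AddressInv.step (h : AddressInv P N lab u i s) (hlt : u ++ [i] < u' ++ [i']) (m : ℕ)
    (hopen : Open (insert (u ++ [i]) N) (fun q => P.commandAt (lab q)) u' s')
    (hprev : ∀ k, i' = k + 1 → u' ++ [k] ∈ insert (u ++ [i]) N)
    {e : Command} (he : P.commandAt (lab (u ++ [i])) = some e)
    (hfits : Fits P (insert (u' ++ [i']) (insert (u ++ [i]) N))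
      (Function.update lab (u' ++ [i']) m) (u ++ [i]) e) :
    AddressInv P (insert (u ++ [i]) N) (Function.update lab (u' ++ [i']) m) u' i' s' := by
  have hlt' : ∀ q ∈ insert (u ++ [i]) N, q < u' ++ [i'] := by
    intro q hq
    rcases Finset.mem_insert.1 hq with rfl | hq
    · exact hlt
    · exact (h.lt q hq).trans hlt
  have hnot : u' ++ [i'] ∉ insert (u ++ [i]) N := fun h' => lt_irrefl _ (hlt' _ h')
  have hlab : ∀ p ∈ insert (u ++ [i]) N, Function.update lab (u' ++ [i']) m p = lab p :=
    fun p hp => Function.update_of_ne (by rintro rfl; exact hnot hp) _ _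
  have hself := Finset.mem_insert_self (u ++ [i]) N
  refine ⟨?_, ?_, ?_, hprev, hlt', ?_, hopen.congr fun p hp => by rw [hlab p hp], ?_⟩
  · intro hmem
    rcases Finset.mem_insert.1 hmem with h1 | h1
    · simp at h1
    · exact h.nil_notMem h1
  · intro w k hw hmem
    rcases Finset.mem_insert.1 hmem with h1 | h1
    · obtain ⟨rfl, _⟩ := List.append_inj' h1 rfl
      exact Finset.mem_insert_of_mem (h.opened.mem hw).1
    · exact Finset.mem_insert_of_mem (h.parent_mem w k hw h1)
  · intro w k hmem
    rcases Finset.mem_insert.1 hmem with h1 | h1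
    · obtain ⟨rfl, h2⟩ := List.append_inj' h1 rfl
      simp only [List.cons.injEq, and_true] at h2
      exact Finset.mem_insert_of_mem (h.prev_mem k h2.symm)
    · exact Finset.mem_insert_of_mem (h.sibling_mem w k h1)
  · rw [Function.update_of_ne, h.lab_root]
    intro h1
    rw [← h1] at hlt
    rcases (lt_append_zero_iff _ []).1 hlt with h2 | h2 <;> simp at h2
  · intro q hq
    rcases Finset.mem_insert.1 hq with rfl | hqN
    · exact ⟨e, by rw [hlab _ hself, he], hfits⟩
    · obtain ⟨d, hd, hd'⟩ := h.fits q hqN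
      refine ⟨d, by rw [hlab q hq, hd], hd'.insert_node hq hnot ?_ ?_⟩
      · rintro hpush j hj
        obtain ⟨rfl, _⟩ := List.append_inj' hj rfl
        have hne : u' ≠ [] := fun h1 => h.nil_notMem (h1 ▸ hqN)
        obtain ⟨_, a, ha⟩ := hopen.mem hne
        rw [hd] at ha
        exact hpush a (Option.some.inj ha)
      · rintro a rfl w k l rfl hj
        obtain ⟨rfl, _⟩ := List.append_inj' hj rfl
        -- The case distinction on `Open` needs a variable as its address.
        generalize hx : w ++ [k] = x at *
        cases hopen with
        | nil => simp at hx
        | cons _ _ _ h3 => exact h3 l a hq hd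

theorem lt_next (u : List ℕ) (i : ℕ) : u ++ [i] < u ++ [i + 1] :=
  append_lt_append_left _ (List.cons_lt_cons_iff.2 (Or.inl (Nat.lt_succ_self i)))

theorem AddressInv.noChild (h : AddressInv P N lab u i s) (j : ℕ) :
    u ++ [i] ++ [j] ∉ insert (u ++ [i]) N := by
  intro hmem
  rcases Finset.mem_insert.1 hmem with h1 | h1
  · have := congrArg List.length h1
    simp at this
  · exact h.notMem (h.parent_mem _ j (by simp) h1)

theorem AddressInv.noChild_insert (h : AddressInv P N lab u i s) {v' : List ℕ}
    (hv' : v'.length ≤ u.length + 1) (j : ℕ) :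
    u ++ [i] ++ [j] ∉ insert v' (insert (u ++ [i]) N) := by
  intro hmem
  rcases Finset.mem_insert.1 hmem with h1 | h1
  · have := congrArg List.length h1
    simp at this
    omega
  · exact h.noChild j h1

/-- Every configuration that is reached comes with nodes for the commands executed so far. -/
theorem exists_inv {d : SVAS.Config} (h : Relation.ReflTransGen P.Step SVAS.init d) :
    ∃ N lab dat u i, AddressInv P N lab u i d.stack ∧
      DataInv N (fun q => P.commandAt (lab q)) dat d.counter ∧ lab (u ++ [i]) = d.pc := by
  induction h with
  | refl =>
    -- Nothing has been executed, and the next node is the first root.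
    refine ⟨∅, fun _ => 0, fun _ => 0, [], 0, ⟨by simp, by simp, by simp, by simp, by simp, rfl, .nil,
      by simp⟩, ⟨by simp, by simp, by simp [SVAS.init]⟩, rfl⟩
  | @tail d d' _ hstep ih =>
    obtain ⟨N, lab, dat, u, i, hA, hD, hpc⟩ := ih
    have hself := Finset.mem_insert_self (u ++ [i]) N
    have update_mem : ∀ {u' i' m}, u ++ [i] < u' ++ [i'] → ∀ p ∈ insert (u ++ [i]) N,
        P.commandAt (Function.update lab (u' ++ [i']) m p) = P.commandAt (lab p) := by
      intro u' i' m hlt p hp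
      rw [Function.update_of_ne]
      rintro rfl
      rcases Finset.mem_insert.1 hp with h1 | h1
      · exact lt_irrefl _ (h1 ▸ hlt)
      · exact lt_irrefl _ ((hA.lt _ h1).trans hlt)
    have open_next : ∀ {e}, P.commandAt (lab (u ++ [i])) = some e → (∀ b, e ≠ .pop b) →
        Open (insert (u ++ [i]) N) (fun q => P.commandAt (lab q)) u d.stack := by
      intro e he hpop
      refine hA.opened.insert_node fun w j b _ _ => ?_
      simp only [he, ne_eq, Option.some.injEq]
      exact hpop b
    have prev_next : ∀ k, i + 1 = k + 1 → u ++ [k] ∈ insert (u ++ [i]) N := by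
      rintro k hk
      obtain rfl : i = k := by omega
      exact hself
    have hchild := hA.noChild_insert (v' := u ++ [i + 1]) (by simp)
    have hne : u ++ [i] ≠ u ++ [i + 1] := (lt_next u i).ne
    cases hstep with
    | @inc pc c s x hc =>
      simp only at hpc hA hD
      rw [← hpc] at hc ⊢
      obtain ⟨dat', hD'⟩ := hD.insert_inc hA.lt hc
      refine ⟨_, _, dat', u, i + 1, hA.step (lt_next u i) (lab (u ++ [i]) + 1)
        (open_next hc (by simp)) prev_next hc ?_, hD'.congr (update_mem (lt_next u i)), by simp⟩
      exact ⟨hchild, u, i, rfl, by simp, by simp [hne]⟩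
    | @dec pc c s x hc hpos =>
      simp only at hpc hA hD
      rw [← hpc] at hc ⊢
      obtain ⟨dat', hD'⟩ := hD.insert_dec hA.lt hc hpos
      refine ⟨_, _, dat', u, i + 1, hA.step (lt_next u i) (lab (u ++ [i]) + 1)
        (open_next hc (by simp)) prev_next hc ?_, hD'.congr (update_mem (lt_next u i)), by simp⟩
      exact ⟨hchild, u, i, rfl, by simp, by simp [hne]⟩
    | @goto pc j c s L L' hc hj =>
      simp only at hpc hA hD
      rw [← hpc] at hc
      obtain ⟨dat', hD'⟩ := hD.insert_other hA.lt (by simp [hc]) (by simp [hc])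
      refine ⟨_, _, dat', u, i + 1, hA.step (lt_next u i) j
        (open_next hc (by simp)) prev_next hc ?_, hD'.congr (update_mem (lt_next u i)), by simp⟩
      exact ⟨hchild, u, i, rfl, by simp, by simpa using hj⟩
    | @push pc c s a hc =>
      simp only at hpc hA hD
      rw [← hpc] at hc ⊢
      -- After a push the next node is the first child, and the current node becomes the innermost
      -- open one.
      have hlt : u ++ [i] < u ++ [i] ++ [0] := (lt_append_zero_iff _ _).2 (Or.inr rfl)
      obtain ⟨dat', hD'⟩ := hD.insert_other hA.lt (by simp [hc]) (by simp [hc])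
      refine ⟨_, _, dat', u ++ [i], 0, hA.step hlt (lab (u ++ [i]) + 1)
        (.cons (open_next hc (by simp)) hself hc fun j b hj => absurd hj (hA.noChild j)) (by simp) hc
        ⟨by simp, ?_⟩, hD'.congr (update_mem hlt), by simp⟩
      rw [Function.update_self, Function.update_of_ne hlt.ne]
    | @pop pc c s a hc =>
      simp only at hpc hA hD
      rw [← hpc] at hc ⊢
      obtain ⟨dat', hD'⟩ := hD.insert_other hA.lt (by simp [hc]) (by simp [hc])
      -- The non-empty stack shows that the current parent is the node that pushed its top symbol;
      -- the next node is the next sibling of that parent.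
      obtain ⟨w, k, rfl, h1, h2, h3, _⟩ : ∃ w k, u = w ++ [k] ∧
          Open N (fun q => P.commandAt (lab q)) w s ∧ w ++ [k] ∈ N ∧
          P.commandAt (lab (w ++ [k])) = some (.push a) ∧ True := by
        have := hA.opened
        cases this with
        | cons h1 h2 h3 h4 => exact ⟨_, _, rfl, h1, h2, h3, trivial⟩
      have hlt : w ++ [k] ++ [i] < w ++ [k + 1] :=
        (lt_append_succ_iff _ _ _).2 (Or.inr (List.prefix_append _ _))
      refine ⟨_, _, dat', w, k + 1, hA.step hlt (lab (w ++ [k] ++ [i]) + 1)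
        (h1.insert_node fun w' j b hw' hj => ?_) ?_ hc
        ⟨hA.noChild_insert (by simp), w, k, i, rfl, ?_, ?_, ?_, by simp, ?_⟩,
        hD'.congr (update_mem hlt), by simp⟩
      · have := congrArg List.length hj
        simp at this
        omega
      · rintro l hl
        obtain rfl : k = l := by omega
        exact Finset.mem_insert_of_mem h2
      · intro hmem
        rcases Finset.mem_insert.1 hmem with h4 | h4
        · have := congrArg List.length h4
          simp at this
        · rcases Finset.mem_insert.1 h4 with h4 | h4
          · simp at h4
          · exact lt_asymm (hA.lt _ h4) (lt_next _ _)
      · exact Finset.mem_insert_of_mem (Finset.mem_insert_of_mem h2)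
      · rw [update_mem hlt _ (Finset.mem_insert_of_mem h2), h3]
      · rw [Function.update_self, Function.update_of_ne hlt.ne]

/-- The forest for a computation that reaches `halt`. -/
def AddressInv.forest (h : AddressInv P N lab u i []) : Forest where
  nodes := insert (u ++ [i]) N
  nil_notMem := by
    intro hmem
    rcases Finset.mem_insert.1 hmem with h1 | h1
    · simp at h1
    · exact h.nil_notMem h1
  parent_mem := by
    intro w k hw hmem
    rcases Finset.mem_insert.1 hmem with h1 | h1
    · obtain ⟨rfl, _⟩ := List.append_inj' h1 rfl
      exact Finset.mem_insert_of_mem (h.opened.mem hw).1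
    · exact Finset.mem_insert_of_mem (h.parent_mem w k hw h1)
  sibling_mem := by
    intro w k hmem
    rcases Finset.mem_insert.1 hmem with h1 | h1
    · obtain ⟨rfl, h2⟩ := List.append_inj' h1 rfl
      simp only [List.cons.injEq, and_true] at h2
      exact Finset.mem_insert_of_mem (h.prev_mem k h2.symm)
    · exact Finset.mem_insert_of_mem (h.sibling_mem w k h1)

/-- The leaf-data forest for a computation that reaches `halt`. -/
def AddressInv.leafDataForest (h : AddressInv P N lab u i []) (dat : List ℕ → ℕ) :
    LeafDataForest (Fin (P.lines.length + 1)) where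
  toForest := h.forest
  label p := Fin.ofNat _ (lab p.1)
  data p := dat p.1.1

/-! ### The forest of a halting computation is a model -/

theorem exists_line_of_commandAt {j : ℕ} {e : Command} (h : P.commandAt j = some e) :
    ∃ l, P.lines[j]? = some l ∧ l.command = e := by
  simpa [SVAS.commandAt] using h

theorem exists_line_of_labelAt {j : ℕ} {L : Name} (h : P.labelAt j = some L) :
    ∃ l, P.lines[j]? = some l ∧ l.label = some L := by
  simpa [SVAS.labelAt, Option.bind_eq_some_iff] using h

/-- The empty stack makes the `halt` node a root, and the vanishing counters mean that no increment
is pending, so each one has a decrement with its datum. -/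
theorem satisfiable_of_reachable (P : SVAS) (h : P.Reachable) : (sentence P).Satisfiable := by
  obtain ⟨pc, hhalt, hreach⟩ := h
  obtain ⟨N, lab, dat, u, i, hA, hD, hpc⟩ := exists_inv hreach
  simp only at hA hD hpc
  rw [← hpc] at hhalt
  obtain rfl : u = [] := by
    have := hA.opened
    cases this
    rfl
  obtain ⟨dat, hD⟩ := hD.insert_other hA.lt (fun x hx => by simpa using hhalt.symm.trans hx)
    (fun x hx => by simpa using hhalt.symm.trans hx)
  have hself := Finset.mem_insert_self ([] ++ [i]) N
  have hcommand : ∀ q ∈ insert ([] ++ [i]) N, ∃ e, P.commandAt (lab q) = some e ∧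
      (q = [] ++ [i] ∧ e = .halt ∨ Fits P (insert ([] ++ [i]) N) lab q e) := by
    intro q hq
    rcases Finset.mem_insert.1 hq with rfl | hq
    · exact ⟨_, hhalt, Or.inl ⟨rfl, rfl⟩⟩
    · obtain ⟨e, h1, h2⟩ := hA.fits q hq
      exact ⟨e, h1, Or.inr h2⟩
  obtain ⟨F, hnodes, hlab, hdat⟩ : ∃ F : LeafDataForest (Fin (P.lines.length + 1)),
      F.nodes = insert ([] ++ [i]) N ∧ (∀ p, (F.label p).val = lab p.1) ∧
      ∀ p, F.data p = dat p.1.1 := by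
    refine ⟨hA.leafDataForest dat, rfl, fun p => ?_, fun _ => rfl⟩
    obtain ⟨e, h1, _⟩ := hcommand p.1 p.2
    obtain ⟨l, h2, _⟩ := exists_line_of_commandAt h1
    have h3 := (List.getElem?_eq_some_iff.1 h2).1
    -- Every label is the position of a line, so the reduction in `Fin.ofNat` changes nothing.
    exact Nat.mod_eq_of_lt (by omega)
  have noChild := hA.noChild
  have noNext : [] ++ [i + 1] ∉ insert ([] ++ [i]) N := by
    intro h
    rcases Finset.mem_insert.1 h with h | h
    · simp at h
    · exact lt_asymm (hA.lt _ h) (lt_next _ _)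
  have lab_root := hA.lab_root
  rw [← hnodes] at hself hcommand hD noChild noNext
  refine ⟨F, (holds_formula P F).2 ?_⟩
  have hleaf : ∀ p : F.Node, (∃ x, P.commandAt (lab p.1) = some (.inc x) ∨
      P.commandAt (lab p.1) = some (.dec x)) → F.IsLeaf p := by
    rintro p ⟨x, hx⟩
    obtain ⟨e, h1, ⟨_, rfl⟩ | h2⟩ := hcommand p.1 p.2
    · rw [h1] at hx
      simp at hx
    · rw [h1] at hx
      rcases hx with hx | hx
      · obtain rfl := Option.some.inj hx
        exact h2.1
      · obtain rfl := Option.some.inj hx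
        exact h2.1
  have hocc : ∀ (p : F.Node) (k : StackVAS.Token) (a : Name) (l : Line),
      P.lines[lab p.1]? = some l → Occurs k a l →
      OccursAt F P.lines k a p := by
    intro p k a l h1 h2
    exact ⟨l, by rw [hlab, h1], h2⟩
  have heq : ∀ p q : F.Node, F.LeafPrec p q →
      F.SameData p q → ∃ x, P.commandAt (lab p.1) = some (.inc x) ∧
        P.commandAt (lab q.1) = some (.dec x) := by
    rintro p q ⟨_, _, h1⟩ ⟨_, _, h2⟩
    rw [hdat, hdat] at h2
    exact hD.eq_imp p.1 p.2 q.1 q.2 h1 h2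
  refine ⟨⟨⟨[] ++ [i], hself⟩⟩, ?_, ?_⟩
  · rintro ⟨v, hv⟩ hno
    rw [hlab]
    obtain rfl | ⟨w, k, rfl⟩ : v = [] ∨ ∃ w k, v = w ++ [k] := by
      induction v using List.reverseRecOn with
      | nil => exact Or.inl rfl
      | append_singleton w k _ => exact Or.inr ⟨w, k, rfl⟩
    · exact absurd hv F.nil_notMem
    obtain rfl : w = [] := by
      by_contra hw
      exact hno ⟨⟨w, F.parent_mem w k hw hv⟩, Or.inr ⟨k, rfl⟩⟩
    rcases k with _ | k
    · exact lab_root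
    · exact absurd ⟨⟨[] ++ [k], F.sibling_mem [] k hv⟩, Or.inl ⟨[], k, rfl, rfl⟩⟩ hno
  · intro p
    obtain ⟨e, h1, h2⟩ := hcommand p.1 p.2
    obtain ⟨l, h3, rfl⟩ := exists_line_of_commandAt h1
    refine ⟨l, by rw [hlab, h3], ?_⟩
    generalize l.command = e at h1 h2
    have noChild' : (∀ j, p.1 ++ [j] ∉ F.nodes) →
        ¬∃ q, F.Child p q := by
      rintro h4 ⟨q, j, hj⟩
      exact h4 j (by rw [← hj]; exact q.2)
    rcases h2 with ⟨h2, rfl⟩ | h2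
    · refine ⟨noChild' fun j => ?_, ?_, ?_⟩
      · rw [h2]
        exact noChild j
      · rintro ⟨q, hq⟩
        have hq' := (nextSibling_iff _ h2).1 hq
        exact noNext (by rw [← hq']; exact q.2)
      · rintro ⟨q, j, hj⟩
        rw [h2] at hj
        exact F.nil_notMem (by rw [(List.append_inj' hj rfl).1]; exact q.2)
    · cases e with
      | inc x =>
        obtain ⟨h4, w, k, h5, h6, h7⟩ := h2
        refine ⟨⟨⟨_, h6⟩, ⟨w, k, h5, rfl⟩, by rw [hlab, hlab, h7]⟩, ?_, ?_⟩
        -- Otherwise `p` would be pending, contrary to the final counter value `0`. The invariant on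
        -- equal data then forces `q` to be later than `p`.
        · obtain ⟨q, hq, h8, h9⟩ : ∃ q ∈ F.nodes, dat q = dat p.1 ∧ q ≠ p.1 := by
            by_contra hcon
            push Not at hcon
            have h10 := hD.card_pending x
            rw [Set.ncard_eq_zero ((F.nodes).finite_toSet.subset fun p hp => hp.1)] at h10
            exact Set.eq_empty_iff_forall_notMem.1 h10 p.1 ⟨p.2, h1, hcon⟩
          rcases lt_or_gt_of_ne h9 with h10 | h10
          · obtain ⟨y, _, h11⟩ := hD.eq_imp q hq p.1 p.2 h10 h8
            rw [h1] at h11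
            simp at h11
          · obtain ⟨y, _, h11⟩ := hD.eq_imp p.1 p.2 q hq h10 h8.symm
            have hp := hleaf p ⟨x, Or.inl h1⟩
            have hq' := hleaf ⟨q, hq⟩ ⟨y, Or.inr h11⟩
            exact ⟨⟨q, hq⟩, ⟨hp, hq', h10⟩, hp, hq', by rw [hdat, hdat]; exact h8.symm⟩
        · intro q hq hq'
          obtain ⟨y, h8, h9⟩ := heq p q hq hq'
          obtain ⟨l', h10, h11⟩ := exists_line_of_commandAt h9
          rw [h1] at h8
          simp only [Option.some.injEq, Command.inc.injEq] at h8
          exact hocc q _ x l' h10 (by rw [h8]; exact h11)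
      | dec x =>
        obtain ⟨h4, w, k, h5, h6, h7⟩ := h2
        refine ⟨⟨⟨_, h6⟩, ⟨w, k, h5, rfl⟩, by rw [hlab, hlab, h7]⟩, ?_, ?_⟩
        · obtain ⟨q, hq, h8, h9⟩ := hD.exists_inc p.1 p.2 x h1
          obtain ⟨y, h10, _⟩ := hD.eq_imp q hq p.1 p.2 h8 h9
          have hp := hleaf p ⟨x, Or.inr h1⟩
          have hq' := hleaf ⟨q, hq⟩ ⟨y, Or.inl h10⟩
          exact ⟨⟨q, hq⟩, ⟨hq', hp, h8⟩, hp, hq', by rw [hdat, hdat]; exact h9.symm⟩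
        · intro q hq hq'
          obtain ⟨y, h8, h9⟩ := heq q p hq ⟨hq'.2.1, hq'.1, hq'.2.2.symm⟩
          obtain ⟨l', h10, h11⟩ := exists_line_of_commandAt h8
          rw [h1] at h9
          simp only [Option.some.injEq, Command.dec.injEq] at h9
          exact hocc q _ x l' h10 (by rw [h9]; exact h11)
      | push a =>
        refine ⟨⟨_, h2.1⟩, ⟨0, rfl⟩, by rw [hlab, hlab, h2.2], ?_⟩
        rintro ⟨r, w, k, _, h4⟩
        -- The index `0` is not a successor, so the first child has no previous sibling.
        have := (List.append_inj' (s₁ := p.1) (t₁ := [0]) h4 rfl).2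
        simp at this
      | pop a =>
        obtain ⟨h4, w, k, j, h5, h6, h7, h8, h9, h10⟩ := h2
        refine ⟨noChild' h4, ?_, ⟨_, h7⟩, ⟨j, h5⟩, ⟨⟨_, h9⟩, ⟨w, k, rfl, rfl⟩, by rw [hlab, hlab, h10]⟩, ?_⟩
        · rintro ⟨q, hq⟩
          exact h6 (by rw [← (nextSibling_iff _ h5).1 hq]; exact q.2)
        · obtain ⟨l', h11, h12⟩ := exists_line_of_commandAt h8
          exact hocc _ _ a l' h11 h12
      | goto L L' =>
        obtain ⟨h4, w, k, h5, h6, h7⟩ := h2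
        refine ⟨noChild' h4, ⟨_, h6⟩, ⟨w, k, h5, rfl⟩, ?_⟩
        refine h7.imp (fun h => ?_) (fun h => ?_) <;>
        · obtain ⟨l', h8, h9⟩ := exists_line_of_labelAt h
          exact hocc _ _ _ l' h8 h9
      | halt => exact h2.elim

end SVASReduction

/-- The reachability problem for SVAS is reducible in logarithmic space to the satisfiability
problem for FO²(+1, ≺, ∼) on leaf-data forests. -/
theorem theorem2 :
    LogSpace.Reducible StackVAS.SVAS.encoding LeafData.Sentence.encoding
      StackVAS.SVAS.Reachable LeafData.Sentence.Satisfiable :=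
  ⟨SVASReduction.sentence,
    SVASReduction.computable_of_sentenceCode SVASReduction.pieces SVASReduction.header
      SVASReduction.footer _ SVASReduction.code_sentence,
    fun P => ⟨SVASReduction.satisfiable_of_reachable P, SVASReduction.reachable_of_satisfiable P⟩⟩
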